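/- **Setting and conventions.** Round brackets denote the sum over all permutations, without a factor. Let $(M,g)$ be a smooth Lorentzian manifold of dimension $m$, of signature $(-,+,\dots,+)$, with Levi-Civita connection $\nabla$. Let $M$ be foliated by the slices $S_s=\{\Phi=s\}$ of a smooth function $\Phi$ with nowhere null gradient, all slices being timelike ($\epsilon=+1$) or all spacelike ($\epsilon=-1$). Put $\varphi=\|\nabla\Phi\|^{-1}$, $n_\alpha=\pm\varphi\nabla_\alpha\Phi$ (one fixed sign), so that $n^\alpha n_\alpha=\epsilon$; $h_{\alpha\beta}=g_{\alpha\beta}-\epsilon n_\alpha n_\beta$; $\chi_{\alpha\beta}=h^\lambda_\alpha h^\rho_\beta\nabla_\lambda n_\rho$; and $\mathcal D_\alpha f=h_\alpha^\beta\nabla_\beta f$ for functions $f$. A vector field $K^\alpha$ is conformal Killing if $\nabla_{(\alpha}K_{\beta)}=\Omega g_{(\alpha\beta)}$ with $\Omega=\frac1m\nabla_\alpha K^\alpha$. A smooth symmetric tensor $K_{\alpha\beta}$ is a conformal Killing tensor (CKT) if $\nabla_{(\alpha}K_{\beta\gamma)}=\Omega_{(\alpha}g_{\beta\gamma)}$ with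 $\Omega_\gamma=\frac1{m+2}\nabla_\alpha(2K^\alpha{}_\gamma+K^\lambda{}_\lambda\delta^\alpha_\gamma)$; write ${}^n\Omega=n^\alpha\Omega_\alpha$ and ${}^\tau\Omega_\tau=h_\tau^\alpha\Omega_\alpha$. It is slice-reducible (along the foliation) if on each connected component of each slice its tangent projection has the form $\beta h_{\alpha\beta}+\sum_{a,b} c^{ab}L_{a\alpha}L_{b\beta}$ with conformal Killing vectors $L_a$ of the slice, a function $\beta$ and a symmetric matrix of constants $c^{ab}$. On an open set $U\subseteq M$ these notions refer to the foliation of $U$ by the sets $U\cap S_s$. **Theorem.** Let $\mathcal K_1,\dots,\mathcal K_n$, $n\le m-2$, be conformal Killing vector fields of $M$, tangent to the slices, whose Gram matrix $\mathcal G_{ab}=g(\mathcal K_a,\mathcal K_b)$ is everywhere invertible, with inverse $\mathcal G^{ab}$. Call vectors tangent to the slices and orthogonal to all $\mathcal K_a$ complementary, and let $\chi$ be the metric trace of $\chi_{\alpha\beta}$ over the complementary directions divided by their number $m-n-1$. Assume that for all complementary $\mathcal X,\mathcal Y$ $$\chi_{\alpha\beta}\mathcal K_a{}^\alpha\mathcal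 X^\beta=0,\qquad \chi_{\alpha\beta}\mathcal X^\alpha\mathcal Y^\beta=\chi\,h_{\alpha\beta}\mathcal X^\alpha\mathcal Y^\beta,$$ that $$\mathcal D_\gamma\left(\varphi\chi-\varphi n^\alpha\nabla_\alpha\ln\varphi\right)=0,$$ that where $\chi\ne0$ $$\mathcal D_\gamma\Big(\mathcal G^{ab}+\tfrac1{2\chi}n^\alpha\nabla_\alpha\mathcal G^{ab}\Big)=-\mathcal D_\gamma\ln|\chi\varphi^3|\,\Big(\mathcal G^{ab}+\tfrac1{2\chi}n^\alpha\nabla_\alpha\mathcal G^{ab}\Big),$$ and that on the interior of the set $\{\chi=0\}$ $$\mathcal D_\gamma(n^\alpha\nabla_\alpha\mathcal G^{ab})=-\mathcal D_\gamma\ln\varphi^3\; n^\alpha\nabla_\alpha\mathcal G^{ab}.$$ For an open set $U\subseteq M$ consider the following steps, with smooth functions on $U$. *Step one.* $\Psi=\ln\varphi^2+\tilde\Psi$, where $n^\alpha\nabla_\alpha\tilde\Psi=2(\chi-n^\alpha\nabla_\alpha\ln\varphi)$ and $\mathcal D_\tau\tilde\Psi=0$. *Step two.* $\gamma^{ab}=\gamma^{ba}=\epsilon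 e^\Psi\mathcal G^{ab}+\nu^{ab}$, where $n^\alpha\nabla_\alpha\nu^{ab}=0$ and $\mathcal D_\tau\gamma^{ab}=0$. *Step three.* $K_{\alpha\beta}=\alpha g_{\alpha\beta}+\gamma^{ab}\mathcal K_{a\alpha}\mathcal K_{b\beta}+e^\Psi n_\alpha n_\beta$, where $\alpha$ is an arbitrary smooth function on $U$. Then: 1. Every point of $M$ has an open neighbourhood $U$ on which step one has a solution and, for every solution of step one, step two has a solution. The same holds on every open set $U$ for which all $U\cap S_s$ are connected or empty; in particular on $U=M$ if all slices are connected. 2. For every open $U$, all solutions of steps one and two on $U$ and every smooth $\alpha$ on $U$, the tensor $K_{\alpha\beta}$ of step three is a slice-reducible conformal Killing tensor on $U$ (along the given foliation), with $${}^n\Omega=n^\alpha\nabla_\alpha\alpha+2\epsilon\chi e^\Psi,\qquad {}^\tau\Omega_\tau=\mathcal D_\tau\alpha+2\gamma^{ab}\mathcal K_{a\tau}\mathcal K_b{}^\alpha\mathcal D_\alpha\ln\varphi .$$ In particular, $M$ carries a slice-reducible conformal Killing tensor constructed in this way locally, and globally if all slices are connected. -/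

import Mathlib

open Bundle Set VectorField
open scoped Manifold ContDiff Topology

noncomputable section

/-- A (not necessarily continuous) vector field on `M`. -/
abbrev VectorFieldOn (m : ℕ) (M : Type*) [TopologicalSpace M]
    [ChartedSpace (EuclideanSpace ℝ (Fin m)) M] : Type _ :=
  (x : M) → TangentSpace (𝓡 m) x

/-- Differentiability of a vector field at a point. -/
abbrev SectionDiffAt {m : ℕ} {M : Type*} [TopologicalSpace M]
    [ChartedSpace (EuclideanSpace ℝ (Fin m)) M] [IsManifold (𝓡 m) ∞ M]
    (X : VectorFieldOn m M) (x : M) : Prop :=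
  MDifferentiableAt (𝓡 m) ((𝓡 m).prod 𝓘(ℝ, EuclideanSpace ℝ (Fin m)))
    (fun y ↦ TotalSpace.mk' (EuclideanSpace ℝ (Fin m)) y (X y)) x

/-- A smooth Lorentzian metric, signature `(-, +, …, +)`. -/
structure LorentzMetric (m : ℕ) (M : Type*) [TopologicalSpace M]
    [ChartedSpace (EuclideanSpace ℝ (Fin m)) M] [IsManifold (𝓡 m) ∞ M] where
  val (x : M) : TangentSpace (𝓡 m) x →L[ℝ] TangentSpace (𝓡 m) x →L[ℝ] ℝ
  symm (x : M) (v w : TangentSpace (𝓡 m) x) : val x v w = val x w v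
  signature (x : M) : ∃ v : TangentSpace (𝓡 m) x, val x v v < 0 ∧
    ∀ w, val x v w = 0 → w ≠ 0 → 0 < val x w w
  contMDiff : ContMDiff (𝓡 m)
    ((𝓡 m).prod 𝓘(ℝ, EuclideanSpace ℝ (Fin m) →L[ℝ] EuclideanSpace ℝ (Fin m) →L[ℝ] ℝ)) ∞
    (fun x ↦ TotalSpace.mk' (EuclideanSpace ℝ (Fin m) →L[ℝ] EuclideanSpace ℝ (Fin m) →L[ℝ] ℝ)
      x (val x))

/-- A field of bilinear forms (a tensor field of type `(0, 2)`) on `M`. -/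
abbrev TwoTensorField (m : ℕ) (M : Type*) [TopologicalSpace M]
    [ChartedSpace (EuclideanSpace ℝ (Fin m)) M] : Type _ :=
  (x : M) → TangentSpace (𝓡 m) x →L[ℝ] TangentSpace (𝓡 m) x →L[ℝ] ℝ

/-- Smoothness of a vector field on a set. -/
def SmoothVectorFieldOn {m : ℕ} {M : Type*} [TopologicalSpace M]
    [ChartedSpace (EuclideanSpace ℝ (Fin m)) M] [IsManifold (𝓡 m) ∞ M]
    (X : VectorFieldOn m M) (U : Set M) : Prop :=
  ContMDiffOn (𝓡 m) ((𝓡 m).prod 𝓘(ℝ, EuclideanSpace ℝ (Fin m))) ∞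
    (fun x ↦ TotalSpace.mk' (EuclideanSpace ℝ (Fin m)) x (X x)) U

/-- Smoothness of a field of bilinear forms on a set. -/
def SmoothTwoTensorOn {m : ℕ} {M : Type*} [TopologicalSpace M]
    [ChartedSpace (EuclideanSpace ℝ (Fin m)) M] [IsManifold (𝓡 m) ∞ M]
    (K : TwoTensorField m M) (U : Set M) : Prop :=
  ContMDiffOn (𝓡 m)
    ((𝓡 m).prod 𝓘(ℝ, EuclideanSpace ℝ (Fin m) →L[ℝ] EuclideanSpace ℝ (Fin m) →L[ℝ] ℝ)) ∞
    (fun x ↦ TotalSpace.mk' (EuclideanSpace ℝ (Fin m) →L[ℝ] EuclideanSpace ℝ (Fin m) →L[ℝ] ℝ)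
      x (K x)) U

/-- The sum over all permutations of three arguments. -/
def permSum {V : Type*} (T : V → V → V → ℝ) (u v w : V) : ℝ :=
  T u v w + T u w v + T v u w + T v w u + T w u v + T w v u

namespace LorentzMetric

variable {m : ℕ} {M : Type*} [TopologicalSpace M]
  [ChartedSpace (EuclideanSpace ℝ (Fin m)) M] [IsManifold (𝓡 m) ∞ M]
  (g : LorentzMetric m M)

theorem nondegenerate (x : M) (v : TangentSpace (𝓡 m) x) (h : ∀ w, g.val x v w = 0) : v = 0 := by
  obtain ⟨t, ht, hpos⟩ := g.signature x
  by_contra hv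
  have h1 : g.val x t v = 0 := by rw [g.symm]; exact h t
  have h2 := hpos v h1 hv
  rw [h v] at h2
  exact lt_irrefl _ h2

/-- The coordinate (holonomic) basis of `T_x M` in the preferred chart at `x`. -/
def coordBasis (x : M) : Module.Basis (Fin m) ℝ (TangentSpace (𝓡 m) x) :=
  (EuclideanSpace.basisFun (Fin m) ℝ).toBasis

/-- The components `g^{ij}` of the inverse metric at `x`. -/
def invComp (x : M) : Matrix (Fin m) (Fin m) ℝ :=
  (Matrix.of fun i j ↦ g.val x (coordBasis x i) (coordBasis x j))⁻¹

/-- Raising the index of a covector. -/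
def sharp (x : M) (θ : TangentSpace (𝓡 m) x →L[ℝ] ℝ) : TangentSpace (𝓡 m) x :=
  ∑ i, ∑ j, (g.invComp x i j * θ (coordBasis x i)) • (coordBasis x j : TangentSpace (𝓡 m) x)

theorem isUnit_gram (x : M) : IsUnit
    (Matrix.of fun i j ↦ g.val x (coordBasis x i) (coordBasis x j) : Matrix (Fin m) (Fin m) ℝ).det := by
  rw [isUnit_iff_ne_zero]
  intro h0
  obtain ⟨c, hc, hc0⟩ := Matrix.exists_vecMul_eq_zero_iff.2 h0
  apply hc
  have hz : ∑ i, c i • (coordBasis x i : TangentSpace (𝓡 m) x) = 0 := by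
    apply g.nondegenerate x
    intro w
    have hw := (coordBasis x).sum_repr w
    rw [← hw]
    simp only [map_sum, map_smul, _root_.sum_apply, _root_.smul_apply]
    apply Finset.sum_eq_zero
    intro j _
    have := congrFun hc0 j
    simp only [Matrix.vecMul, dotProduct, Matrix.of_apply, Pi.zero_apply] at this
    simp only [smul_eq_mul, this, mul_zero]
  funext i
  exact Fintype.linearIndependent_iff.1 (coordBasis x).linearIndependent c hz i

theorem val_sharp (x : M) (θ : TangentSpace (𝓡 m) x →L[ℝ] ℝ) (w : TangentSpace (𝓡 m) x) :
    g.val x (g.sharp x θ) w = θ w := by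
  have key : ∀ k, g.val x (g.sharp x θ) (coordBasis x k) = θ (coordBasis x k) := by
    intro k
    have hmul := Matrix.nonsing_inv_mul _ (g.isUnit_gram x)
    simp only [sharp, map_sum, map_smul, _root_.sum_apply,
      _root_.smul_apply, smul_eq_mul]
    have : ∀ i, ∑ j, g.invComp x i j * θ (coordBasis x i) *
        g.val x (coordBasis x j) (coordBasis x k) = (if i = k then 1 else 0) * θ (coordBasis x i) := by
      intro i
      have h := congrFun (congrFun hmul i) k
      rw [Matrix.mul_apply, Matrix.one_apply] at h
      rw [← h, Finset.sum_mul]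
      refine Finset.sum_congr rfl fun j _ ↦ ?_
      simp only [invComp, Matrix.of_apply]; ring
    simp [this]
  rw [← (coordBasis x).sum_repr w]
  simp only [map_sum, map_smul, key]

theorem ext_val (x : M) {v w : TangentSpace (𝓡 m) x} (h : ∀ u, g.val x v u = g.val x w u) :
    v = w := by
  rw [← sub_eq_zero]
  apply g.nondegenerate x
  intro u
  simp [h u]


/-- The scalar function `g(X, Y)`. -/
def pair (X Y : VectorFieldOn m M) (x : M) : ℝ := g.val x (X x) (Y x)

theorem pair_comm (X Y : VectorFieldOn m M) : g.pair X Y = g.pair Y X :=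
  funext fun x ↦ g.symm x _ _

theorem mdifferentiableAt_pair {X Y : VectorFieldOn m M} {x : M}
    (hX : SectionDiffAt X x) (hY : SectionDiffAt Y x) : MDifferentiableAt (𝓡 m) 𝓘(ℝ, ℝ) (g.pair X Y) x := by
  have hg := (g.contMDiff x).mdifferentiableAt (by simp)
  have : MDifferentiableAt (𝓡 m) ((𝓡 m).prod 𝓘(ℝ, ℝ))
      (fun y ↦ TotalSpace.mk' ℝ (E := Bundle.Trivial M ℝ) y (g.val y (X y) (Y y))) x := by
    apply MDifferentiableAt.clm_bundle_apply₂ (F₁ := EuclideanSpace ℝ (Fin m))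
      (F₂ := EuclideanSpace ℝ (Fin m))
    · exact hg
    · exact hX
    · exact hY
  simp only [mdifferentiableAt_totalSpace] at this
  exact this.2

/-- Half the right-hand side of the Koszul formula: the value of `g(∇_X Y, Z)`. -/
def koszul (Y X Z : VectorFieldOn m M) (x : M) : ℝ :=
  (1 / 2) * (mvfderiv (𝓡 m) (g.pair Y Z) x (X x) + mvfderiv (𝓡 m) (g.pair X Z) x (Y x)
    - mvfderiv (𝓡 m) (g.pair X Y) x (Z x) + g.val x (mlieBracket (𝓡 m) X Y x) (Z x)
    - g.val x (mlieBracket (𝓡 m) X Z x) (Y x) - g.val x (mlieBracket (𝓡 m) Y Z x) (X x))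

theorem pair_add_left (X X' Y : VectorFieldOn m M) :
    g.pair (X + X') Y = g.pair X Y + g.pair X' Y := by
  funext y; simp [pair]

theorem pair_add_right (X Y Y' : VectorFieldOn m M) :
    g.pair X (Y + Y') = g.pair X Y + g.pair X Y' := by
  funext y; simp [pair]

theorem pair_smul_left (f : M → ℝ) (X Y : VectorFieldOn m M) :
    g.pair (f • X) Y = f * g.pair X Y := by
  funext y; simp [pair]

theorem pair_smul_right (f : M → ℝ) (X Y : VectorFieldOn m M) :
    g.pair X (f • Y) = f * g.pair X Y := by
  funext y; simp [pair]

theorem tensorialAt_koszul_left {Y Z : VectorFieldOn m M} {x : M}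
    (hY : SectionDiffAt Y x) (hZ : SectionDiffAt Z x) :
    TensorialAt (𝓡 m) (EuclideanSpace ℝ (Fin m)) (fun X ↦ g.koszul Y X Z x) x where
  smul {f X} hf hX := by
    simp only [koszul, pair_smul_left]
    rw [mvfderiv_mul hf (g.mdifferentiableAt_pair hX hZ),
      mvfderiv_mul hf (g.mdifferentiableAt_pair hX hY),
      mlieBracket_smul_left hf hX, mlieBracket_smul_left hf hX]
    simp [pair]
    ring
  add {X X'} hX hX' := by
    simp only [koszul, pair_add_left]
    rw [mvfderiv_add (g.mdifferentiableAt_pair hX hZ) (g.mdifferentiableAt_pair hX' hZ),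
      mvfderiv_add (g.mdifferentiableAt_pair hX hY) (g.mdifferentiableAt_pair hX' hY),
      mlieBracket_add_left hX hX', mlieBracket_add_left hX hX']
    simp
    ring

theorem tensorialAt_koszul_right {Y X : VectorFieldOn m M} {x : M}
    (hY : SectionDiffAt Y x) (hX : SectionDiffAt X x) :
    TensorialAt (𝓡 m) (EuclideanSpace ℝ (Fin m)) (fun Z ↦ g.koszul Y X Z x) x where
  smul {f Z} hf hZ := by
    simp only [koszul, pair_smul_right]
    rw [mvfderiv_mul hf (g.mdifferentiableAt_pair hY hZ),
      mvfderiv_mul hf (g.mdifferentiableAt_pair hX hZ),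
      mlieBracket_smul_right hf hZ, mlieBracket_smul_right hf hZ]
    simp [pair]
    rw [g.symm x (Z x) (X x), g.symm x (Z x) (Y x)]
    ring
  add {Z Z'} hZ hZ' := by
    simp only [koszul, pair_add_right]
    rw [mvfderiv_add (g.mdifferentiableAt_pair hY hZ) (g.mdifferentiableAt_pair hY hZ'),
      mvfderiv_add (g.mdifferentiableAt_pair hX hZ) (g.mdifferentiableAt_pair hX hZ'),
      mlieBracket_add_right hZ hZ', mlieBracket_add_right hZ hZ']
    simp
    ring

theorem koszul_add {Y Y' X Z : VectorFieldOn m M} {x : M}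
    (hY : SectionDiffAt Y x) (hY' : SectionDiffAt Y' x) (hX : SectionDiffAt X x)
    (hZ : SectionDiffAt Z x) :
    g.koszul (Y + Y') X Z x = g.koszul Y X Z x + g.koszul Y' X Z x := by
  simp only [koszul, pair_add_left, pair_add_right]
  rw [mvfderiv_add (g.mdifferentiableAt_pair hY hZ) (g.mdifferentiableAt_pair hY' hZ),
    mvfderiv_add (g.mdifferentiableAt_pair hX hY) (g.mdifferentiableAt_pair hX hY'),
    mlieBracket_add_right hY hY', mlieBracket_add_left hY hY']
  simp
  ring

theorem koszul_smul {Y X Z : VectorFieldOn m M} {f : M → ℝ} {x : M}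
    (hf : MDifferentiableAt (𝓡 m) 𝓘(ℝ, ℝ) f x) (hY : SectionDiffAt Y x) (hX : SectionDiffAt X x)
    (hZ : SectionDiffAt Z x) :
    g.koszul (f • Y) X Z x =
      f x * g.koszul Y X Z x + mvfderiv (𝓡 m) f x (X x) * g.val x (Y x) (Z x) := by
  simp only [koszul, pair_smul_left, pair_smul_right]
  rw [mvfderiv_mul hf (g.mdifferentiableAt_pair hY hZ),
    mvfderiv_mul hf (g.mdifferentiableAt_pair hX hY),
    mlieBracket_smul_right hf hY, mlieBracket_smul_left hf hY]
  simp [pair]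
  rw [g.symm x (Y x) (X x)]
  ring

/-- The bilinear form `(w, u) ↦ g(∇_u Y, w)` at a point where `Y` is differentiable. -/
def koszulForm (Y : VectorFieldOn m M) (x : M) (hY : SectionDiffAt Y x) :
    TangentSpace (𝓡 m) x →L[ℝ] TangentSpace (𝓡 m) x →L[ℝ] ℝ :=
  TensorialAt.mkHom₂ (F := EuclideanSpace ℝ (Fin m)) (F' := EuclideanSpace ℝ (Fin m))
    (fun Z X ↦ g.koszul Y X Z x) x
    (fun _ hX ↦ g.tensorialAt_koszul_right hY hX) (fun _ hZ ↦ g.tensorialAt_koszul_left hY hZ)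

theorem koszulForm_apply {Y X Z : VectorFieldOn m M} {x : M}
    (hY : SectionDiffAt Y x) (hX : SectionDiffAt X x) (hZ : SectionDiffAt Z x) :
    g.koszulForm Y x hY (Z x) (X x) = g.koszul Y X Z x :=
  TensorialAt.mkHom₂_apply _ _ hZ hX

open Classical in
/-- `∇Y` as an endomorphism field: the metric dual of the Koszul form, in components. -/
def leviCivitaAux (Y : VectorFieldOn m M) (x : M) :
    TangentSpace (𝓡 m) x →L[ℝ] TangentSpace (𝓡 m) x :=
  if hY : SectionDiffAt Y x then
    ∑ i, ∑ j, g.invComp x i j •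
      (g.koszulForm Y x hY (coordBasis x i)).smulRight (coordBasis x j : TangentSpace (𝓡 m) x)
  else 0

theorem val_leviCivitaAux {Y X Z : VectorFieldOn m M} {x : M}
    (hY : SectionDiffAt Y x) (hX : SectionDiffAt X x) (hZ : SectionDiffAt Z x) :
    g.val x (g.leviCivitaAux Y x (X x)) (Z x) = g.koszul Y X Z x := by
  let B := g.koszulForm Y x hY
  have hB : ∀ w, g.val x (g.leviCivitaAux Y x (X x)) w = B w (X x) := by
    have key : ∀ k, g.val x (g.leviCivitaAux Y x (X x)) (coordBasis x k) =
        B (coordBasis x k) (X x) := by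
      intro k
      have hmul := Matrix.nonsing_inv_mul _ (g.isUnit_gram x)
      have : ∀ i, ∑ j, g.invComp x i j * (B (coordBasis x i) (X x) *
          g.val x (coordBasis x j) (coordBasis x k)) =
          (if i = k then 1 else 0) * B (coordBasis x i) (X x) := by
        intro i
        have h := congrFun (congrFun hmul i) k
        rw [Matrix.mul_apply, Matrix.one_apply] at h
        rw [← h, Finset.sum_mul]
        refine Finset.sum_congr rfl fun j _ ↦ ?_
        simp only [invComp, Matrix.of_apply]; ring
      simp [leviCivitaAux, dif_pos hY, B] at this ⊢
      simp [this]
    intro w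
    rw [← (coordBasis x).sum_repr w]
    simp only [map_sum, map_smul, key, _root_.sum_apply, _root_.smul_apply]
  rw [hB, g.koszulForm_apply hY hX hZ]

/-- The Levi-Civita connection of `g`, built from the Koszul formula:
`g.leviCivita Y x u` is `∇_u Y` at `x`. -/
def leviCivita : CovariantDerivative (𝓡 m) (EuclideanSpace ℝ (Fin m))
    (TangentSpace (𝓡 m) : M → Type _) where
  toFun := g.leviCivitaAux
  isCovariantDerivativeOnUniv :=
    { add := by
        intro Y Y' x hY hY' _
        ext1 u
        apply g.ext_val
        intro w
        have hX := FiberBundle.mdifferentiableAt_extend (𝓡 m) (EuclideanSpace ℝ (Fin m)) u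
        have hZ := FiberBundle.mdifferentiableAt_extend (𝓡 m) (EuclideanSpace ℝ (Fin m)) w
        have e := g.koszul_add hY hY' hX hZ
        rw [← g.val_leviCivitaAux hY hX hZ, ← g.val_leviCivitaAux hY' hX hZ,
          ← g.val_leviCivitaAux (mdifferentiableAt_add_section hY hY') hX hZ] at e
        simpa using e
      leibniz := by
        intro Y f x hY hf _
        ext1 u
        apply g.ext_val
        intro w
        have hX := FiberBundle.mdifferentiableAt_extend (𝓡 m) (EuclideanSpace ℝ (Fin m)) u
        have hZ := FiberBundle.mdifferentiableAt_extend (𝓡 m) (EuclideanSpace ℝ (Fin m)) w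
        have e := g.koszul_smul hf hY hX hZ
        rw [← g.val_leviCivitaAux hY hX hZ,
          ← g.val_leviCivitaAux (MDifferentiableAt.smul_section hf hY) hX hZ] at e
        simpa using e }

/-- The Levi-Civita connection is torsion-free. -/
theorem leviCivita_torsion : g.leviCivita.torsion = 0 := by
  rw [CovariantDerivative.torsion_eq_zero_iff]
  intro X Y x hX hY
  apply g.ext_val
  intro w
  have hZ := FiberBundle.mdifferentiableAt_extend (𝓡 m) (EuclideanSpace ℝ (Fin m)) w
  have e1 := g.val_leviCivitaAux hY hX hZ
  have e2 := g.val_leviCivitaAux hX hY hZ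
  simp only [FiberBundle.extend_apply_self] at e1 e2
  change g.val x (g.leviCivitaAux Y x (X x) - g.leviCivitaAux X x (Y x)) w = _
  rw [map_sub, _root_.sub_apply, e1, e2]
  simp only [koszul, FiberBundle.extend_apply_self]
  rw [g.pair_comm Y X, mlieBracket_swap_apply (V := Y) (W := X)]
  simp
  ring

/-- The Levi-Civita connection is compatible with the metric. -/
theorem leviCivita_metric {X Y Z : VectorFieldOn m M} {x : M}
    (hX : SectionDiffAt X x) (hY : SectionDiffAt Y x) (hZ : SectionDiffAt Z x) :
    mvfderiv (𝓡 m) (g.pair Y Z) x (X x) =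
      g.val x (g.leviCivita Y x (X x)) (Z x) + g.val x (Y x) (g.leviCivita Z x (X x)) := by
  change _ = g.val x (g.leviCivitaAux Y x (X x)) (Z x) + g.val x (Y x) (g.leviCivitaAux Z x (X x))
  rw [g.symm x (Y x), g.val_leviCivitaAux hY hX hZ, g.val_leviCivitaAux hZ hX hY]
  simp only [koszul]
  rw [g.pair_comm Z Y, mlieBracket_swap_apply (V := Z) (W := Y)]
  simp
  ring

/-! ### Conformal Killing vectors and conformal Killing tensors -/

/-- The metric trace `g^{αβ} B_{αβ}`. -/
def metricTrace (x : M) (B : TangentSpace (𝓡 m) x → TangentSpace (𝓡 m) x → ℝ) : ℝ :=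
  ∑ i, ∑ j, g.invComp x i j * B (coordBasis x i) (coordBasis x j)

/-- The divergence `∇_α X^α`. -/
def divergence (X : VectorFieldOn m M) (x : M) : ℝ :=
  g.metricTrace x fun u v ↦ g.val x (g.leviCivita X x u) v

/-- Conformal Killing vector fields: `∇_α X_β + ∇_β X_α = Ω (g_{αβ} + g_{βα})`
with `Ω = (1 / m) ∇_α X^α`. -/
def IsConformalKilling (X : VectorFieldOn m M) : Prop :=
  SmoothVectorFieldOn X univ ∧
  ∀ (x : M) (u v : TangentSpace (𝓡 m) x),
    g.val x (g.leviCivita X x u) v + g.val x (g.leviCivita X x v) u =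
      (1 / (m : ℝ)) * g.divergence X x * (g.val x u v + g.val x v u)

/-- The covariant derivative `(∇_u K)(v, w)` of a tensor field of type `(0, 2)`: the vectors
`v`, `w` at `x` are extended to vector fields `V`, `W` near `x`, and
`(∇_u K)(V, W) = u (K(V, W)) - K(∇_u V, W) - K(V, ∇_u W)`. -/
def covTensor (K : TwoTensorField m M) (x : M) (u v w : TangentSpace (𝓡 m) x) : ℝ :=
  mvfderiv (𝓡 m) (fun y ↦ K y (FiberBundle.extend (EuclideanSpace ℝ (Fin m)) v y)
      (FiberBundle.extend (EuclideanSpace ℝ (Fin m)) w y)) x u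
    - K x (g.leviCivita (FiberBundle.extend (EuclideanSpace ℝ (Fin m)) v) x u) w
    - K x v (g.leviCivita (FiberBundle.extend (EuclideanSpace ℝ (Fin m)) w) x u)

/-- The one-form `Ω_γ = (1 / (m + 2)) ∇_α (2 K^α_γ + K^λ_λ δ^α_γ)` of a symmetric tensor `K`. -/
def conformalOneForm (K : TwoTensorField m M) (x : M) (w : TangentSpace (𝓡 m) x) : ℝ :=
  (1 / ((m : ℝ) + 2)) * (2 * g.metricTrace x (fun u v ↦ g.covTensor K x u v w)
    + mvfderiv (𝓡 m) (fun y ↦ g.metricTrace y (fun u v ↦ K y u v)) x w)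

/-- `K` is a conformal Killing tensor (of rank two) on the open set `U`: it is smooth, symmetric and
satisfies `∇_{(α} K_{βγ)} = Ω_{(α} g_{βγ)}`, where round brackets denote the sum over all
permutations. -/
def IsConformalKillingTensorOn (U : Set M) (K : TwoTensorField m M) : Prop :=
  SmoothTwoTensorOn K U ∧
  ∀ x ∈ U, (∀ u v, K x u v = K x v u) ∧
    ∀ u v w, permSum (g.covTensor K x) u v w =
      permSum (fun a b c ↦ g.conformalOneForm K x a * g.val x b c) u v w

/-- The gradient of a function. -/
def grad (f : M → ℝ) (x : M) : TangentSpace (𝓡 m) x := g.sharp x (mvfderiv (𝓡 m) f x)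

end LorentzMetric

/-! ### Foliations of codimension one -/

/-- A foliation of `M` by the level sets (slices) of a foliation function `toFun` with nowhere null
gradient, together with the choice of a unit normal. The sign `eps` is `1` for timelike slices
and `-1` for spacelike slices, and `orient` is the sign in `n_α = ± φ ∇_α Φ`. -/
structure SliceFoliation {m : ℕ} {M : Type*} [TopologicalSpace M]
    [ChartedSpace (EuclideanSpace ℝ (Fin m)) M] [IsManifold (𝓡 m) ∞ M]
    (g : LorentzMetric m M) where
  toFun : M → ℝ
  contMDiff : ContMDiff (𝓡 m) 𝓘(ℝ, ℝ) ∞ toFun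
  eps : ℝ
  eps_eq : eps = 1 ∨ eps = -1
  nonnull (x : M) : 0 < eps * g.val x (g.grad toFun x) (g.grad toFun x)
  orient : ℝ
  orient_eq : orient = 1 ∨ orient = -1

namespace SliceFoliation

variable {m : ℕ} {M : Type*} [TopologicalSpace M]
  [ChartedSpace (EuclideanSpace ℝ (Fin m)) M] [IsManifold (𝓡 m) ∞ M]
  {g : LorentzMetric m M} (F : SliceFoliation g)

/-- The slice `S_s`. -/
def slice (s : ℝ) : Set M := {x | F.toFun x = s}

/-- The lapse function `φ = ‖∇Φ‖⁻¹`. -/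
def lapse (x : M) : ℝ :=
  (Real.sqrt |g.val x (g.grad F.toFun x) (g.grad F.toFun x)|)⁻¹

/-- The unit normal `n = ± φ ∇Φ`. -/
def normal (x : M) : TangentSpace (𝓡 m) x := (F.orient * F.lapse x) • g.grad F.toFun x

/-- The projector `h^α_β = δ^α_β - ε n^α n_β` onto the tangent space of the slice. -/
def proj (x : M) (v : TangentSpace (𝓡 m) x) : TangentSpace (𝓡 m) x :=
  v - (F.eps * g.val x (F.normal x) v) • F.normal x

/-- The induced metric `h_{αβ} = g_{αβ} - ε n_α n_β`. -/
def induced (x : M) (u v : TangentSpace (𝓡 m) x) : ℝ :=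
  g.val x u v - F.eps * (g.val x (F.normal x) u * g.val x (F.normal x) v)

/-- The second fundamental form `χ_{αβ} = h^λ_α h^ρ_β ∇_λ n_ρ`. -/
def secondForm (x : M) (u v : TangentSpace (𝓡 m) x) : ℝ :=
  g.val x (g.leviCivita F.normal x (F.proj x u)) (F.proj x v)

/-- The normal derivative `n^α ∇_α f` of a function. -/
def normalDeriv (f : M → ℝ) (x : M) : ℝ := mvfderiv (𝓡 m) f x (F.normal x)

/-- The slice derivative `v^α 𝒟_α f = v^α h_α^β ∇_β f` of a function. -/
def sliceDeriv (f : M → ℝ) (x : M) (v : TangentSpace (𝓡 m) x) : ℝ :=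
  mvfderiv (𝓡 m) f x (F.proj x v)

/-- `L` is tangent to the slice at `x` and satisfies there the conformal Killing equation
`𝒟_α L_β + 𝒟_β L_α = 2 c h_{αβ}` of the slice. -/
def SliceConformalKillingAt (L : VectorFieldOn m M) (x : M) : Prop :=
  g.val x (F.normal x) (L x) = 0 ∧
  ∃ c : ℝ, ∀ u v : TangentSpace (𝓡 m) x,
    g.val x (g.leviCivita L x (F.proj x u)) (F.proj x v)
      + g.val x (g.leviCivita L x (F.proj x v)) (F.proj x u) = 2 * c * F.induced x u v

/-- `K` is slice-reducible on `U` along the foliation: on every slice (on every connected component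
of it in `U`, if there are several), the tangent projection of `K` is a reducible conformal Killing
tensor of the slice, i.e. `h h K = β h + ∑ c^{ab} L_a L_b` with conformal Killing vectors `L_a` of
the slice, a function `β` and a symmetric matrix of constants `c^{ab}`. -/
def IsSliceReducibleOn (U : Set M) (K : TwoTensorField m M) : Prop :=
  ∀ p ∈ U, ∃ (N : ℕ) (L : Fin N → VectorFieldOn m M) (c : Fin N → Fin N → ℝ) (β : M → ℝ),
    (∀ a, SmoothVectorFieldOn (L a) U) ∧ ContMDiffOn (𝓡 m) 𝓘(ℝ, ℝ) ∞ β U ∧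
    (∀ a b, c a b = c b a) ∧
    ∀ x ∈ connectedComponentIn (U ∩ F.slice (F.toFun p)) p,
      (∀ a, F.SliceConformalKillingAt (L a) x) ∧
      ∀ u v : TangentSpace (𝓡 m) x, K x (F.proj x u) (F.proj x v) =
        β x * F.induced x u v
          + ∑ a, ∑ b, c a b * (g.val x (L a x) (F.proj x u) * g.val x (L b x) (F.proj x v))

end SliceFoliation

/-! ### Foliations with tangent conformal Killing vectors -/

section Symmetries

variable {m : ℕ} {M : Type*} [TopologicalSpace M]
  [ChartedSpace (EuclideanSpace ℝ (Fin m)) M] [IsManifold (𝓡 m) ∞ M]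
  {g : LorentzMetric m M}

/-- The Gram matrix `𝒢_{ab} = g(𝒦_a, 𝒦_b)`. -/
def gram (g : LorentzMetric m M) {n : ℕ} (K : Fin n → VectorFieldOn m M) (x : M) :
    Matrix (Fin n) (Fin n) ℝ :=
  Matrix.of fun a b ↦ g.val x (K a x) (K b x)

/-- The entries `𝒢^{ab}` of the inverse Gram matrix, as functions on `M`. -/
def gramInv (g : LorentzMetric m M) {n : ℕ} (K : Fin n → VectorFieldOn m M) (a b : Fin n)
    (x : M) : ℝ :=
  (gram g K x)⁻¹ a b

namespace SliceFoliation

variable (F : SliceFoliation g) {n : ℕ} (K : Fin n → VectorFieldOn m M)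

/-- `v` belongs to the span of the complementary vectors `𝒳_i`, that is `v` is tangent to the slice
and orthogonal to all `𝒦_a`. -/
def IsComplementary (x : M) (v : TangentSpace (𝓡 m) x) : Prop :=
  g.val x (F.normal x) v = 0 ∧ ∀ a, g.val x (K a x) v = 0

/-- The orthogonal projection onto the complementary vectors. -/
def complProj (x : M) (v : TangentSpace (𝓡 m) x) : TangentSpace (𝓡 m) x :=
  F.proj x v - ∑ a, ∑ b, (gramInv g K a b x * g.val x (K a x) v) • K b x

/-- The weighted trace `χ` of the second fundamental form over the complementary directions: its
metric trace there divided by their number `m - n - 1`. In an orthogonal basis `𝒳_i` of the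
complementary directions, it is `(m - n - 1)⁻¹ ∑ χ(𝒳_i, 𝒳_i) / h(𝒳_i, 𝒳_i)`. -/
def weightedTrace (x : M) : ℝ :=
  (1 / ((m : ℝ) - n - 1)) *
    g.metricTrace x fun u v ↦ F.secondForm x (F.complProj K x u) (F.complProj K x v)

/-- The second fundamental form is block diagonal: `χ(𝒦_a, 𝒳) = 0`. -/
def IsBlockDiagonal : Prop :=
  ∀ (x : M) (a : Fin n) (v : TangentSpace (𝓡 m) x), F.IsComplementary K x v →
    F.secondForm x (K a x) v = 0

/-- The second fundamental form is partially umbilic: `χ(𝒳, 𝒳') = χ h(𝒳, 𝒳')`. -/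
def IsPartiallyUmbilic : Prop :=
  ∀ (x : M) (u v : TangentSpace (𝓡 m) x), F.IsComplementary K x u → F.IsComplementary K x v →
    F.secondForm x u v = F.weightedTrace K x * F.induced x u v

/-- The first integrability condition `𝒟_γ (φ χ - φ n^α ∇_α ln φ) = 0`. -/
def IntegrabilityPsi : Prop :=
  ∀ (x : M) (v : TangentSpace (𝓡 m) x),
    F.sliceDeriv (fun y ↦ F.lapse y * F.weightedTrace K y
      - F.lapse y * F.normalDeriv (fun z ↦ Real.log (F.lapse z)) y) x v = 0

/-- The second integrability condition. Where `χ ≠ 0`, it reads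
`𝒟_γ (𝒢^{ab} + (2χ)⁻¹ n^α ∇_α 𝒢^{ab}) = - 𝒟_γ ln (χ φ³) (𝒢^{ab} + (2χ)⁻¹ n^α ∇_α 𝒢^{ab})`
(`Real.log` is the logarithm of the absolute value), and where `χ` vanishes identically it is
replaced by `𝒟_γ (n^α ∇_α 𝒢^{ab}) = - 𝒟_γ ln φ³ · n^α ∇_α 𝒢^{ab}`. -/
def IntegrabilityGamma : Prop :=
  (∀ x : M, F.weightedTrace K x ≠ 0 → ∀ (a b : Fin n) (v : TangentSpace (𝓡 m) x),
    F.sliceDeriv (fun y ↦ gramInv g K a b y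
        + 1 / (2 * F.weightedTrace K y) * F.normalDeriv (gramInv g K a b) y) x v =
      - F.sliceDeriv (fun y ↦ Real.log (F.weightedTrace K y * F.lapse y ^ 3)) x v *
        (gramInv g K a b x
          + 1 / (2 * F.weightedTrace K x) * F.normalDeriv (gramInv g K a b) x)) ∧
  (∀ x ∈ interior {y : M | F.weightedTrace K y = 0},
    ∀ (a b : Fin n) (v : TangentSpace (𝓡 m) x),
    F.sliceDeriv (F.normalDeriv (gramInv g K a b)) x v =
      - F.sliceDeriv (fun y ↦ Real.log (F.lapse y ^ 3)) x v *
        F.normalDeriv (gramInv g K a b) x)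

/-- The function `Ψ = ln φ² + Ψ'` obtained from `Ψ'` (which is written `Ψ` with a tilde in the
formulas below). -/
def psi (Ψt : M → ℝ) (x : M) : ℝ := Real.log (F.lapse x ^ 2) + Ψt x

/-- Step one on the open set `U`: `n^α ∇_α Ψ̃ = 2 (χ - n^α ∇_α ln φ)` and `𝒟_τ Ψ̃ = 0`. -/
def StepOne (U : Set M) (Ψt : M → ℝ) : Prop :=
  ContMDiffOn (𝓡 m) 𝓘(ℝ, ℝ) ∞ Ψt U ∧
  ∀ x ∈ U,
    F.normalDeriv Ψt x =
      2 * (F.weightedTrace K x - F.normalDeriv (fun z ↦ Real.log (F.lapse z)) x) ∧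
    ∀ v : TangentSpace (𝓡 m) x, F.sliceDeriv Ψt x v = 0

/-- Step two on the open set `U`: `γ^{ab} = ε e^Ψ 𝒢^{ab} + ν^{ab}`, `n^α ∇_α ν^{ab} = 0` and
`𝒟_τ γ^{ab} = 0`, with symmetric `γ^{ab}`. -/
def StepTwo (U : Set M) (Ψt : M → ℝ) (γ ν : Fin n → Fin n → M → ℝ) : Prop :=
  (∀ a b, ContMDiffOn (𝓡 m) 𝓘(ℝ, ℝ) ∞ (γ a b) U) ∧
  (∀ a b, ContMDiffOn (𝓡 m) 𝓘(ℝ, ℝ) ∞ (ν a b) U) ∧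
  ∀ x ∈ U, ∀ a b : Fin n,
    γ a b x = γ b a x ∧
    γ a b x = F.eps * Real.exp (F.psi Ψt x) * gramInv g K a b x + ν a b x ∧
    F.normalDeriv (ν a b) x = 0 ∧
    ∀ v : TangentSpace (𝓡 m) x, F.sliceDeriv (γ a b) x v = 0

/-- Step three: the tensor `α g_{αβ} + γ^{ab} 𝒦_{aα} 𝒦_{bβ} + e^Ψ n_α n_β`. -/
def liftTensor (α Ψt : M → ℝ) (γ : Fin n → Fin n → M → ℝ) : TwoTensorField m M := fun x ↦
  α x • g.val x
    + ∑ a, ∑ b, γ a b x • (g.val x (K a x)).smulRight (g.val x (K b x))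
    + Real.exp (F.psi Ψt x) • (g.val x (F.normal x)).smulRight (g.val x (F.normal x))

/-- Steps one and two can be carried out on `U`: step one has a solution, and for every solution of
step one, step two has a solution. -/
def StepsSolvableOn (U : Set M) : Prop :=
  (∃ Ψt, F.StepOne K U Ψt) ∧ ∀ Ψt, F.StepOne K U Ψt → ∃ γ ν, F.StepTwo K U Ψt γ ν

end SliceFoliation

end Symmetries

end

/-! The conformal Killing equation is an identity between symmetrized trilinear forms, so by
polarization (`permSum_eq_of_diagonal`) it is enough to prove `(∇_u K)(u, u) = Ω(u) g(u, u)` for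
each vector `u`. Write `u = t + ε N n` with `t` tangent to the slice and `N = g(n, u)`.

The term `α g` contributes `dα(u) g(u, u)`. A tangent conformal Killing vector satisfies `g(∇_u 𝒦,
u) = 𝒦(ln φ) g(u, u)`: the `(n, n)` component of its equation identifies the conformal factor. This
gives the term of `Ω` that contains `γ`. The remaining terms are `dγ(u)`, `d e^Ψ(u) N²` and `2 e^Ψ N
g(∇_u n, u)`. Steps one and two are made so that `d e^Ψ` has slice part `2 e^Ψ 𝒟 ln φ`, which
cancels the acceleration of `n`, and normal derivative `2 χ e^Ψ`, while `dγ(u) = N e^Ψ (2χ 𝒢^{ab} +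
n(𝒢^{ab}))`. What is left is the pointwise identity `sum_gramInv_add_normalDeriv`. To see it, split
`t = k + X` with `k` in the span of the `𝒦_a` and `X` complementary. The sum over `𝒢^{ab}` is `2χ
g(k, k)`. Since `n(𝒢_{ab})` is twice the second fundamental form, the sum over `n(𝒢^{ab})` is minus
twice the second fundamental form at `(k, k)`. Block diagonality and partial umbilicity then supply
`2χ g(X, X)`. The total is `2 χ e^Ψ N g(u, u)`, the last term of `Ω`. Tracing the equation shows
that this one-form is the `Ω` of the definition (`conformalOneForm_eq`).

Slice-reducibility holds because `𝒟 γ = 0` makes `γ` constant on connected components of slices, and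
the `𝒦_a` restrict to conformal Killing vectors of the slices.

For solvability, both steps have the form `df = A dΦ`. The integrability conditions say exactly that
`𝒟 A = 0`; for step two this is extended by continuity to the boundary of `{χ = 0}`. If the slices
in `U` are connected, then `A = a ∘ Φ` with `a` smooth on the open set `Φ(U)`, and an antiderivative
of `a` composed with `Φ` solves the equation (`exists_primitive`). Near a point the slices become
connected in a flow box, a ball in which `Φ` is linear. -/

/-! ### Smooth functions and fields; the Lie bracket as a commutator of derivations -/

section Smoothness

variable {m : ℕ} {M : Type*} [TopologicalSpace M]
  [ChartedSpace (EuclideanSpace ℝ (Fin m)) M]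

/-- Smoothness of a function at a point. -/
abbrev SmoothFunAt (f : M → ℝ) (x : M) : Prop := ContMDiffAt (𝓡 m) 𝓘(ℝ, ℝ) ∞ f x

theorem SmoothFunAt.mdifferentiableAt {f : M → ℝ} {x : M} (hf : SmoothFunAt (m := m) f x) :
    MDifferentiableAt (𝓡 m) 𝓘(ℝ, ℝ) f x :=
  ContMDiffAt.mdifferentiableAt hf (by simp)

/-- The entries of the inverse of a smooth family of invertible matrices are smooth. -/
theorem smoothFunAt_matrix_inv {ι : Type*} [Fintype ι] [DecidableEq ι] {A : M → Matrix ι ι ℝ}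
    {x : M} (hA : ∀ i j, SmoothFunAt (m := m) (fun y ↦ A y i j) x) (hdet : (A x).det ≠ 0)
    (i j : ι) :
    SmoothFunAt (m := m) (fun y ↦ (A y)⁻¹ i j) x := by
  have det_smooth : ∀ {B : M → Matrix ι ι ℝ}, (∀ i j, SmoothFunAt (m := m) (fun y ↦ B y i j) x) →
      SmoothFunAt (m := m) (fun y ↦ (B y).det) x := by
    intro B hB
    simp only [Matrix.det_apply']
    refine ContMDiffAt.sum fun σ _ ↦ ?_
    exact contMDiffAt_const.mul (contMDiffAt_finsetProd fun k _ ↦ hB _ _)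
  simp only [Matrix.inv_def, Ring.inverse_eq_inv', Matrix.smul_apply, smul_eq_mul,
    Matrix.adjugate_apply]
  refine ContMDiffAt.mul ?_ (det_smooth fun k l ↦ ?_)
  · exact (det_smooth hA).inv₀ hdet
  · simp only [Matrix.updateRow_apply]
    split_ifs
    · exact contMDiffAt_const
    · exact hA _ _

variable [IsManifold (𝓡 m) ∞ M]

/-- Smoothness of a vector field at a point. -/
abbrev SmoothSectionAt (X : VectorFieldOn m M) (x : M) : Prop :=
  ContMDiffAt (𝓡 m) ((𝓡 m).prod 𝓘(ℝ, EuclideanSpace ℝ (Fin m))) ∞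
    (fun y ↦ TotalSpace.mk' (EuclideanSpace ℝ (Fin m)) y (X y)) x

theorem SmoothSectionAt.mdifferentiableAt {X : VectorFieldOn m M} {x : M}
    (hX : SmoothSectionAt X x) : SectionDiffAt X x :=
  ContMDiffAt.mdifferentiableAt hX (by simp)

theorem SmoothSectionAt.eventually_mdifferentiableAt {X : VectorFieldOn m M} {x : M}
    (hX : SmoothSectionAt X x) : ∀ᶠ y in 𝓝 x, SectionDiffAt X y := by
  have h1 : ContMDiffAt (𝓡 m) ((𝓡 m).prod 𝓘(ℝ, EuclideanSpace ℝ (Fin m))) 1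
    (fun y ↦ TotalSpace.mk' (EuclideanSpace ℝ (Fin m)) y (X y)) x := hX.of_le (by simp)
  filter_upwards [(contMDiffAt_iff_contMDiffAt_nhds (by simp)).1 h1] with y hy
  exact hy.mdifferentiableAt (by simp)

theorem SmoothFunAt.eventually_mdifferentiableAt {f : M → ℝ} {x : M}
    (hf : SmoothFunAt (m := m) f x) : ∀ᶠ y in 𝓝 x, MDifferentiableAt (𝓡 m) 𝓘(ℝ, ℝ) f y := by
  have h1 : ContMDiffAt (𝓡 m) 𝓘(ℝ, ℝ) 1 f x := hf.of_le (by simp)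
  filter_upwards [(contMDiffAt_iff_contMDiffAt_nhds (by simp)).1 h1] with y hy
  exact hy.mdifferentiableAt (by simp)

theorem smoothSectionAt_extend {x : M} (v : TangentSpace (𝓡 m) x) :
    SmoothSectionAt (FiberBundle.extend (EuclideanSpace ℝ (Fin m)) v) x :=
  FiberBundle.contMDiffAt_extend (𝓡 m) (EuclideanSpace ℝ (Fin m)) v

theorem LorentzMetric.smoothFunAt_pair (g : LorentzMetric m M) {X Y : VectorFieldOn m M} {x : M}
    (hX : SmoothSectionAt X x) (hY : SmoothSectionAt Y x) :
    SmoothFunAt (m := m) (g.pair X Y) x := by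
  have : ContMDiffAt (𝓡 m) ((𝓡 m).prod 𝓘(ℝ, ℝ)) ∞
      (fun y ↦ TotalSpace.mk' ℝ (E := Bundle.Trivial M ℝ) y (g.val y (X y) (Y y))) x := by
    apply ContMDiffAt.clm_bundle_apply₂ (F₁ := EuclideanSpace ℝ (Fin m))
      (F₂ := EuclideanSpace ℝ (Fin m))
    · exact g.contMDiff x
    · exact hX
    · exact hY
  simp only [contMDiffAt_totalSpace] at this
  exact this.2

theorem SmoothSectionAt.mlieBracket {X Y : VectorFieldOn m M} {x : M}
    (hX : SmoothSectionAt X x) (hY : SmoothSectionAt Y x) :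
    SmoothSectionAt (mlieBracket (𝓡 m) X Y) x := by
  have : IsManifold (𝓡 m) ((⊤ : ℕ∞) + 1) M := by simpa
  have : IsManifold (𝓡 m) (minSmoothness ℝ 2) M := by
    simp only [minSmoothness_of_isRCLikeNormedField]
    infer_instance
  exact ContMDiffAt.mlieBracket_vectorField (m := ⊤) (n := ⊤) hX hY (by simp)

theorem SmoothSectionAt.smul {f : M → ℝ} {X : VectorFieldOn m M} {x : M}
    (hf : SmoothFunAt (m := m) f x) (hX : SmoothSectionAt X x) : SmoothSectionAt (f • X) x :=
  ContMDiffAt.smul_section hf hX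

theorem SmoothSectionAt.sub {X Y : VectorFieldOn m M} {x : M}
    (hX : SmoothSectionAt X x) (hY : SmoothSectionAt Y x) : SmoothSectionAt (X - Y) x :=
  ContMDiffAt.sub_section hX hY

theorem SmoothFunAt.mvfderiv_apply {f : M → ℝ} {X : VectorFieldOn m M} {x : M}
    (hf : SmoothFunAt (m := m) f x) (hX : SmoothSectionAt X x) :
    SmoothFunAt (m := m) (fun y ↦ mvfderiv (𝓡 m) f y (X y)) x := by
  have h1 := ContMDiffAt.mfderiv_const (m := ∞) hf (by simp)
  have h2 := ContMDiffAt.clm_apply_of_inCoordinates (b₁ := id) (b₂ := f) h1 hX hf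
  simp only [contMDiffAt_totalSpace] at h2
  have h3 := h2.2
  simp only [trivializationAt_model_space_apply] at h3
  exact h3

/-- `[X, Y]` acts on functions as the commutator. -/
theorem mvfderiv_mlieBracket {f : M → ℝ} {X Y : VectorFieldOn m M} {x : M}
    (hf : SmoothFunAt (m := m) f x) (hX : SmoothSectionAt X x) (hY : SmoothSectionAt Y x) :
    mvfderiv (𝓡 m) f x (mlieBracket (𝓡 m) X Y x) =
      mvfderiv (𝓡 m) (fun y ↦ mvfderiv (𝓡 m) f y (Y y)) x (X x)
        - mvfderiv (𝓡 m) (fun y ↦ mvfderiv (𝓡 m) f y (X y)) x (Y x) := by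
  -- A vector `w ≠ 0` is needed to compare coefficients at the end. If there is none, all vectors at
  -- `x` vanish and both sides are zero.
  by_cases hE : ∃ w : TangentSpace (𝓡 m) x, w ≠ 0
  swap
  · push Not at hE
    simp [hE (mlieBracket (𝓡 m) X Y x), hE (X x), hE (Y x)]
  obtain ⟨w, hw⟩ := hE
  set W : VectorFieldOn m M := FiberBundle.extend (EuclideanSpace ℝ (Fin m)) w with hWdef
  have hW : SmoothSectionAt W x := smoothSectionAt_extend w
  have hWx : W x = w := by simp [W]
  have : IsManifold (𝓡 m) (minSmoothness ℝ 3) M := by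
    simp only [minSmoothness_of_isRCLikeNormedField]
    exact IsManifold.of_le (n := ∞) (by exact WithTop.coe_le_coe.2 le_top)
  have h2 : minSmoothness ℝ 2 ≤ ∞ := by
    simp only [minSmoothness_of_isRCLikeNormedField]; exact WithTop.coe_le_coe.2 le_top
  have expand : ∀ {Z : VectorFieldOn m M}, SmoothSectionAt Z x →
      mlieBracket (𝓡 m) Z (f • W) =ᶠ[𝓝 x]
        (fun y ↦ mvfderiv (𝓡 m) f y (Z y)) • W + f • mlieBracket (𝓡 m) Z W := by
    intro Z hZ
    filter_upwards [hf.eventually_mdifferentiableAt, hW.eventually_mdifferentiableAt] with y h1 h2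
    rw [mlieBracket_smul_right h1 h2]
    rfl
  have outer : ∀ {Z Z' : VectorFieldOn m M}, SmoothSectionAt Z x → SmoothSectionAt Z' x →
      mlieBracket (𝓡 m) Z' (mlieBracket (𝓡 m) Z (f • W)) x =
        mvfderiv (𝓡 m) (fun y ↦ mvfderiv (𝓡 m) f y (Z y)) x (Z' x) • w
          + mvfderiv (𝓡 m) f x (Z x) • mlieBracket (𝓡 m) Z' W x
          + mvfderiv (𝓡 m) f x (Z' x) • mlieBracket (𝓡 m) Z W x
          + f x • mlieBracket (𝓡 m) Z' (mlieBracket (𝓡 m) Z W) x := by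
    intro Z Z' hZ hZ'
    rw [Filter.EventuallyEq.mlieBracket_vectorField_eq (Filter.EventuallyEq.refl _ Z') (expand hZ)]
    have hd := (hf.mvfderiv_apply hZ)
    rw [mlieBracket_add_right (hd.mdifferentiableAt.smul_section hW.mdifferentiableAt)
      (hf.mdifferentiableAt.smul_section (hZ.mlieBracket hW).mdifferentiableAt),
      mlieBracket_smul_right hd.mdifferentiableAt hW.mdifferentiableAt,
      mlieBracket_smul_right hf.mdifferentiableAt (hZ.mlieBracket hW).mdifferentiableAt, hWx]
    module
  -- The Jacobi identity for `X`, `Y`, `f W`, compared with `f` times the one for `X`, `Y`, `W`: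
  -- every term cancels except a multiple of `w`, whose coefficient is the difference of the two
  -- sides of the claim.
  have J1 := leibniz_identity_mlieBracket_apply (𝕜 := ℝ) (I := 𝓡 m) (hX.of_le h2) (hY.of_le h2)
    ((hW.smul hf).of_le h2)
  have J2 := leibniz_identity_mlieBracket_apply (𝕜 := ℝ) (I := 𝓡 m) (hX.of_le h2) (hY.of_le h2)
    (hW.of_le h2)
  rw [outer hY hX, outer hX hY, (expand (hX.mlieBracket hY)).eq_of_nhds, J2] at J1
  simp only [Pi.add_apply, Pi.smul_apply', hWx] at J1
  have J3 : (mvfderiv (𝓡 m) f x (mlieBracket (𝓡 m) X Y x) -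
      (mvfderiv (𝓡 m) (fun y ↦ mvfderiv (𝓡 m) f y (Y y)) x (X x)
        - mvfderiv (𝓡 m) (fun y ↦ mvfderiv (𝓡 m) f y (X y)) x (Y x))) • w = 0 := by
    linear_combination (norm := module) -J1
  exact sub_eq_zero.1 ((smul_eq_zero.1 J3).resolve_right hw)

end Smoothness

/-! ### Gradients and the symmetry of the Hessian -/

namespace LorentzMetric

variable {m : ℕ} {M : Type*} [TopologicalSpace M]
  [ChartedSpace (EuclideanSpace ℝ (Fin m)) M] [IsManifold (𝓡 m) ∞ M]
  (g : LorentzMetric m M)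

theorem val_grad (f : M → ℝ) (x : M) (v : TangentSpace (𝓡 m) x) :
    g.val x (g.grad f x) v = mvfderiv (𝓡 m) f x v := g.val_sharp x _ v

theorem det_gram_basis_ne_zero {ι : Type*} [Fintype ι] [DecidableEq ι] (x : M)
    (b : Module.Basis ι ℝ (TangentSpace (𝓡 m) x)) :
    (Matrix.of fun i j ↦ g.val x (b i) (b j) : Matrix ι ι ℝ).det ≠ 0 := by
  intro h0
  obtain ⟨c, hc, hc0⟩ := Matrix.exists_vecMul_eq_zero_iff.2 h0
  apply hc
  have hz : ∑ i, c i • (b i : TangentSpace (𝓡 m) x) = 0 := by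
    apply g.nondegenerate x
    intro w
    rw [← b.sum_repr w]
    simp only [map_sum, map_smul, _root_.sum_apply, _root_.smul_apply]
    apply Finset.sum_eq_zero
    intro j _
    have := congrFun hc0 j
    simp only [Matrix.vecMul, dotProduct, Matrix.of_apply, Pi.zero_apply] at this
    simp only [smul_eq_mul, this, mul_zero]
  funext i
  exact Fintype.linearIndependent_iff.1 b.linearIndependent c hz i

theorem eq_sum_gram_inv {ι : Type*} [Fintype ι] [DecidableEq ι] (x : M)
    (b : Module.Basis ι ℝ (TangentSpace (𝓡 m) x)) (v : TangentSpace (𝓡 m) x) :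
    v = ∑ j, Matrix.vecMul (fun i ↦ g.val x v (b i))
      (Matrix.of fun i j ↦ g.val x (b i) (b j) : Matrix ι ι ℝ)⁻¹ j • b j := by
  set A : Matrix ι ι ℝ := Matrix.of fun i j ↦ g.val x (b i) (b j) with hA
  have h : (fun i ↦ g.val x v (b i)) = Matrix.vecMul (b.repr v) A := by
    funext i
    conv_lhs => rw [← b.sum_repr v]
    simp only [map_sum, map_smul, _root_.sum_apply, _root_.smul_apply]
    rfl
  rw [h, Matrix.vecMul_vecMul, Matrix.mul_nonsing_inv _
    (isUnit_iff_ne_zero.2 (g.det_gram_basis_ne_zero x b)), Matrix.vecMul_one]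
  exact (b.sum_repr v).symm

/-- `sharp` uses the preferred chart of each point, which may jump from point to point, so its
formula does not show smoothness. Around `x` the gradient is rewritten in the local frame of one
fixed trivialization, where its coefficients involve only the inverse of a smooth Gram matrix. -/
theorem smoothSectionAt_grad {f : M → ℝ} (hf : ContMDiff (𝓡 m) 𝓘(ℝ, ℝ) ∞ f) (x : M) :
    SmoothSectionAt (g.grad f) x := by
  let e := trivializationAt (EuclideanSpace ℝ (Fin m)) (TangentSpace (𝓡 m) : M → Type _) x
  let b := (EuclideanSpace.basisFun (Fin m) ℝ).toBasis
  have hx : x ∈ e.baseSet := FiberBundle.mem_baseSet_trivializationAt' x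
  let E : Fin m → VectorFieldOn m M := e.localFrame b
  have hE : ∀ i, SmoothSectionAt (E i) x := fun i ↦ contMDiffAt_localFrame_of_mem ∞ e b i hx
  let A : M → Matrix (Fin m) (Fin m) ℝ := fun y ↦ Matrix.of fun i j ↦ g.pair (E i) (E j) y
  have hEb : ∀ y (hy : y ∈ e.baseSet) i, E i y = e.basisAt b hy i := fun y hy i ↦ by
    simp [E, hy]
  have hdet : ∀ y ∈ e.baseSet, (A y).det ≠ 0 := by
    intro y hy
    have := g.det_gram_basis_ne_zero y (e.basisAt b hy)
    simpa only [A, pair, hEb y hy] using this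
  have hgrad : g.grad f =ᶠ[𝓝 x] fun y ↦
      ∑ j, Matrix.vecMul (fun i ↦ mvfderiv (𝓡 m) f y (E i y)) (A y)⁻¹ j • E j y := by
    filter_upwards [e.open_baseSet.mem_nhds hx] with y hy
    rw [g.eq_sum_gram_inv y (e.basisAt b hy) (g.grad f y)]
    simp only [g.val_grad, ← hEb y hy]
    rfl
  have : SmoothSectionAt (fun y ↦
      ∑ j, Matrix.vecMul (fun i ↦ mvfderiv (𝓡 m) f y (E i y)) (A y)⁻¹ j • E j y) x := by
    refine ContMDiffAt.sum_section fun j _ ↦ ContMDiffAt.smul_section ?_ (hE j)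
    change SmoothFunAt (m := m)
      (fun y ↦ ∑ i, mvfderiv (𝓡 m) f y (E i y) * (A y)⁻¹ i j) x
    refine ContMDiffAt.sum fun i _ ↦ ContMDiffAt.mul ?_ ?_
    · exact SmoothFunAt.mvfderiv_apply (hf x) (hE i)
    · exact smoothFunAt_matrix_inv (fun i j ↦ g.smoothFunAt_pair (hE i) (hE j)) (hdet x hx) i j
  refine ContMDiffAt.congr_of_eventuallyEq this ?_
  filter_upwards [hgrad] with y hy
  rw [hy]
  rfl

/-- Metric compatibility with a single tangent vector. -/
theorem mvfderiv_pair {Y Z : VectorFieldOn m M} {x : M} (hY : SectionDiffAt Y x)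
    (hZ : SectionDiffAt Z x) (u : TangentSpace (𝓡 m) x) :
    mvfderiv (𝓡 m) (g.pair Y Z) x u =
      g.val x (g.leviCivita Y x u) (Z x) + g.val x (Y x) (g.leviCivita Z x u) := by
  have h := g.leviCivita_metric
    (FiberBundle.mdifferentiableAt_extend (𝓡 m) (EuclideanSpace ℝ (Fin m)) u) hY hZ
  simpa using h

/-- The torsion-free identity on functions gives symmetry of the Hessian. -/
theorem leviCivita_grad_symm {f : M → ℝ} (hf : ContMDiff (𝓡 m) 𝓘(ℝ, ℝ) ∞ f) (x : M)
    (u v : TangentSpace (𝓡 m) x) :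
    g.val x (g.leviCivita (g.grad f) x u) v = g.val x (g.leviCivita (g.grad f) x v) u := by
  set U : VectorFieldOn m M := FiberBundle.extend (EuclideanSpace ℝ (Fin m)) u
  set V : VectorFieldOn m M := FiberBundle.extend (EuclideanSpace ℝ (Fin m)) v
  have hU : SmoothSectionAt U x := smoothSectionAt_extend u
  have hV : SmoothSectionAt V x := smoothSectionAt_extend v
  have hUx : U x = u := by simp [U]
  have hVx : V x = v := by simp [V]
  have hG := g.smoothSectionAt_grad hf x
  have h1 := g.mvfderiv_pair hG.mdifferentiableAt hV.mdifferentiableAt u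
  have h2 := g.mvfderiv_pair hG.mdifferentiableAt hU.mdifferentiableAt v
  have h3 := mvfderiv_mlieBracket (hf x) hU hV
  have h4 := (CovariantDerivative.torsion_eq_zero_iff (cov := g.leviCivita)).1
    g.leviCivita_torsion hU.mdifferentiableAt hV.mdifferentiableAt
  have e : ∀ Z : VectorFieldOn m M, g.pair (g.grad f) Z = fun y ↦ mvfderiv (𝓡 m) f y (Z y) :=
    fun Z ↦ funext fun y ↦ g.val_grad f y _
  rw [e] at h1 h2
  rw [← h4, map_sub, hUx, hVx, h1, h2, g.val_grad, g.val_grad, hUx, hVx] at h3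
  linarith

end LorentzMetric

/-! ### Rules for differentials of real functions -/

section Calculus

variable {m : ℕ} {M : Type*} [TopologicalSpace M]
  [ChartedSpace (EuclideanSpace ℝ (Fin m)) M]

theorem mvfderiv_real_comp {F : ℝ → ℝ} {F' : ℝ} {f : M → ℝ} {x : M}
    (hF : HasDerivAt F F' (f x)) (hf : MDifferentiableAt (𝓡 m) 𝓘(ℝ, ℝ) f x)
    (v : TangentSpace (𝓡 m) x) :
    mvfderiv (𝓡 m) (fun y ↦ F (f y)) x v = F' * mvfderiv (𝓡 m) f x v := by
  have h := mvfderiv_comp_apply (g := F) (f := f) x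
    hF.differentiableAt.mdifferentiableAt hf v
  have e : mvfderiv 𝓘(ℝ, ℝ) F (f x) = fderiv ℝ F (f x) := by
    ext; simp [mvfderiv, mfderiv_eq_fderiv]; rfl
  change mvfderiv (𝓡 m) (F ∘ f) x v = _
  rw [h, e, hF.hasFDerivAt.fderiv]
  change mvfderiv (𝓡 m) f x v * F' = _
  rw [mul_comm]

theorem mvfderiv_finset_sum {ι : Type*} (s : Finset ι) {f : ι → M → ℝ} {x : M}
    (hf : ∀ i, MDifferentiableAt (𝓡 m) 𝓘(ℝ, ℝ) (f i) x) (v : TangentSpace (𝓡 m) x) :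
    mvfderiv (𝓡 m) (fun y ↦ ∑ i ∈ s, f i y) x v = ∑ i ∈ s, mvfderiv (𝓡 m) (f i) x v := by
  classical
  have hd : ∀ s : Finset ι, MDifferentiableAt (𝓡 m) 𝓘(ℝ, ℝ) (fun y ↦ ∑ i ∈ s, f i y) x := by
    intro s
    induction s using Finset.induction_on with
    | empty => simpa using mdifferentiableAt_const
    | insert a s ha ih => simpa [Finset.sum_insert ha] using! (hf a).add ih
  induction s using Finset.induction_on with
  | empty => simp [mvfderiv_const]
  | insert a s ha ih =>
    simp only [Finset.sum_insert ha]
    rw [← ih]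
    have := mvfderiv_add (hf a) (hd s)
    exact congrArg (fun L ↦ L v) this

theorem mvfderiv_mul_apply {f f' : M → ℝ} {x : M} (hf : MDifferentiableAt (𝓡 m) 𝓘(ℝ, ℝ) f x)
    (hf' : MDifferentiableAt (𝓡 m) 𝓘(ℝ, ℝ) f' x) (v : TangentSpace (𝓡 m) x) :
    mvfderiv (𝓡 m) (fun y ↦ f y * f' y) x v =
      f x * mvfderiv (𝓡 m) f' x v + f' x * mvfderiv (𝓡 m) f x v := by
  have := congrArg (fun L ↦ L v) (mvfderiv_mul hf hf')
  simpa using! this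

theorem mvfderiv_add_apply {f f' : M → ℝ} {x : M} (hf : MDifferentiableAt (𝓡 m) 𝓘(ℝ, ℝ) f x)
    (hf' : MDifferentiableAt (𝓡 m) 𝓘(ℝ, ℝ) f' x) (v : TangentSpace (𝓡 m) x) :
    mvfderiv (𝓡 m) (fun y ↦ f y + f' y) x v =
      mvfderiv (𝓡 m) f x v + mvfderiv (𝓡 m) f' x v := by
  have := congrArg (fun L ↦ L v) (mvfderiv_add hf hf')
  simpa using! this

theorem mvfderiv_sub_apply {f f' : M → ℝ} {x : M} (hf : MDifferentiableAt (𝓡 m) 𝓘(ℝ, ℝ) f x)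
    (hf' : MDifferentiableAt (𝓡 m) 𝓘(ℝ, ℝ) f' x) (v : TangentSpace (𝓡 m) x) :
    mvfderiv (𝓡 m) (fun y ↦ f y - f' y) x v =
      mvfderiv (𝓡 m) f x v - mvfderiv (𝓡 m) f' x v := by
  have := congrArg (fun L ↦ L v) (mvfderiv_sub hf hf')
  simpa using! this

theorem mvfderiv_const_apply (c : ℝ) (x : M) (v : TangentSpace (𝓡 m) x) :
    mvfderiv (𝓡 m) (fun _ ↦ c) x v = 0 := by
  rw [mvfderiv_const]; rfl

theorem mvfderiv_congr {f f' : M → ℝ} {x : M} (h : f =ᶠ[𝓝 x] f') :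
    mvfderiv (𝓡 m) f x = mvfderiv (𝓡 m) f' x := by
  ext v
  have := h.mfderiv_eq (I := 𝓡 m) (I' := 𝓘(ℝ, ℝ))
  change mfderiv (𝓡 m) 𝓘(ℝ, ℝ) f x v = mfderiv (𝓡 m) 𝓘(ℝ, ℝ) f' x v
  rw [this]
  rfl

end Calculus

/-! ### Lapse, unit normal and second fundamental form -/

namespace SliceFoliation

variable {m : ℕ} {M : Type*} [TopologicalSpace M]
  [ChartedSpace (EuclideanSpace ℝ (Fin m)) M] [IsManifold (𝓡 m) ∞ M]
  {g : LorentzMetric m M} (F : SliceFoliation g)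

theorem eps_mul_eps : F.eps * F.eps = 1 := by
  rcases F.eps_eq with h | h <;> simp [h]

theorem orient_mul_orient : F.orient * F.orient = 1 := by
  rcases F.orient_eq with h | h <;> simp [h]

/-- The sign `ε` replaces the absolute value, so that the root is taken of a smooth positive
function. -/
theorem lapse_eq (x : M) :
    F.lapse x = (Real.sqrt (F.eps * g.val x (g.grad F.toFun x) (g.grad F.toFun x)))⁻¹ := by
  have h := F.nonnull x
  unfold lapse
  congr 2
  rw [← abs_of_pos h, abs_mul]
  rcases F.eps_eq with h | h <;> simp [h]

theorem lapse_pos (x : M) : 0 < F.lapse x := by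
  rw [F.lapse_eq]
  exact inv_pos.2 (Real.sqrt_pos.2 (F.nonnull x))

theorem lapse_sq_mul (x : M) :
    F.lapse x ^ 2 * g.val x (g.grad F.toFun x) (g.grad F.toFun x) = F.eps := by
  have h := F.nonnull x
  rw [F.lapse_eq, inv_pow, Real.sq_sqrt h.le, inv_mul_eq_iff_eq_mul₀ h.ne']
  linear_combination -g.val x (g.grad F.toFun x) (g.grad F.toFun x) * F.eps_mul_eps

theorem val_normal (x : M) (v : TangentSpace (𝓡 m) x) :
    g.val x (F.normal x) v = F.orient * F.lapse x * mvfderiv (𝓡 m) F.toFun x v := by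
  simp [normal, g.val_grad]

theorem val_normal_normal (x : M) : g.val x (F.normal x) (F.normal x) = F.eps := by
  have h := F.lapse_sq_mul x
  have h' := F.orient_mul_orient
  simp only [normal, map_smul, _root_.smul_apply, smul_eq_mul]
  linear_combination F.orient * F.orient * h + F.eps * h'

/-- The conversion factor between `n` and `d/dΦ`. It turns equations for normal derivatives into
equations `df = A dΦ` and accounts for one power of `φ` in `A`. -/
theorem mvfderiv_toFun_normal (x : M) :
    mvfderiv (𝓡 m) F.toFun x (F.normal x) = F.orient * F.eps * (F.lapse x)⁻¹ := by
  have h := F.val_normal_normal x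
  rw [F.val_normal] at h
  have h' := F.orient_mul_orient
  have := (F.lapse_pos x).ne'
  field_simp
  linear_combination F.orient * h - F.lapse x * mvfderiv (𝓡 m) F.toFun x (F.normal x) * h'

theorem mvfderiv_toFun_eq_zero_iff {x : M} {v : TangentSpace (𝓡 m) x} :
    mvfderiv (𝓡 m) F.toFun x v = 0 ↔ g.val x (F.normal x) v = 0 := by
  rw [F.val_normal]
  have h1 := (F.lapse_pos x).ne'
  have h2 : F.orient ≠ 0 := fun h ↦ by simpa [h] using F.orient_mul_orient
  simp [h1, h2]

theorem val_normal_proj (x : M) (v : TangentSpace (𝓡 m) x) :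
    g.val x (F.normal x) (F.proj x v) = 0 := by
  simp only [proj, map_sub, map_smul, F.val_normal_normal, smul_eq_mul]
  linear_combination -g.val x (F.normal x) v * F.eps_mul_eps

theorem proj_of_tangent {x : M} {v : TangentSpace (𝓡 m) x} (h : g.val x (F.normal x) v = 0) :
    F.proj x v = v := by
  simp [proj, h]

theorem proj_add_normal (x : M) (v : TangentSpace (𝓡 m) x) :
    v = F.proj x v + (F.eps * g.val x (F.normal x) v) • F.normal x := by
  simp [proj]

theorem smoothFunAt_lapse (x : M) : SmoothFunAt (m := m) F.lapse x := by
  have hG := g.smoothSectionAt_grad F.contMDiff x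
  have h1 : SmoothFunAt (m := m)
      (fun y ↦ F.eps * g.pair (g.grad F.toFun) (g.grad F.toFun) y) x :=
    contMDiffAt_const.mul (g.smoothFunAt_pair hG hG)
  have h2 : SmoothFunAt (m := m)
      (fun y ↦ Real.sqrt (F.eps * g.pair (g.grad F.toFun) (g.grad F.toFun) y)) x :=
    ((Real.contDiffAt_sqrt (F.nonnull x).ne').contMDiffAt).comp x h1
  rw [show F.lapse = _ from funext F.lapse_eq]
  exact h2.inv₀ (Real.sqrt_pos.2 (F.nonnull x)).ne'

theorem smoothFunAt_log_lapse (x : M) : SmoothFunAt (m := m) (fun y ↦ Real.log (F.lapse y)) x :=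
  ((Real.contDiffAt_log.2 (F.lapse_pos x).ne').contMDiffAt).comp x (F.smoothFunAt_lapse x)

theorem smoothSectionAt_normal (x : M) : SmoothSectionAt F.normal x :=
  SmoothSectionAt.smul (contMDiffAt_const.mul (F.smoothFunAt_lapse x))
    (g.smoothSectionAt_grad F.contMDiff x)

theorem mvfderiv_log_lapse (x : M) (v : TangentSpace (𝓡 m) x) :
    mvfderiv (𝓡 m) (fun y ↦ Real.log (F.lapse y)) x v =
      (F.lapse x)⁻¹ * mvfderiv (𝓡 m) F.lapse x v :=
  mvfderiv_real_comp (Real.hasDerivAt_log (F.lapse_pos x).ne')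
    (F.smoothFunAt_lapse x).mdifferentiableAt v

theorem val_leviCivita_normal_normal (x : M) (u : TangentSpace (𝓡 m) x) :
    g.val x (g.leviCivita F.normal x u) (F.normal x) = 0 := by
  have hn := (F.smoothSectionAt_normal x).mdifferentiableAt
  have h := g.mvfderiv_pair hn hn u
  rw [show g.pair F.normal F.normal = fun _ ↦ F.eps from funext F.val_normal_normal,
    mvfderiv_const_apply, g.symm x (F.normal x)] at h
  linarith

/-- The antisymmetric part of `∇n`: `∇_α n_β - ∇_β n_α = ∇_α ln φ n_β - ∇_β ln φ n_α`. -/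
theorem val_leviCivita_normal_antisymm (x : M) (u v : TangentSpace (𝓡 m) x) :
    g.val x (g.leviCivita F.normal x u) v - g.val x (g.leviCivita F.normal x v) u =
      mvfderiv (𝓡 m) (fun y ↦ Real.log (F.lapse y)) x u * g.val x (F.normal x) v
        - mvfderiv (𝓡 m) (fun y ↦ Real.log (F.lapse y)) x v * g.val x (F.normal x) u := by
  have hφ := (F.smoothFunAt_lapse x).mdifferentiableAt
  have hc : MDifferentiableAt (𝓡 m) 𝓘(ℝ, ℝ) (fun y ↦ F.orient * F.lapse y) x :=
    (contMDiffAt_const.mul (F.smoothFunAt_lapse x)).mdifferentiableAt (by simp)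
  have hG := (g.smoothSectionAt_grad F.contMDiff x).mdifferentiableAt
  have hdc : ∀ w, mvfderiv (𝓡 m) (fun y ↦ F.orient * F.lapse y) x w =
      F.orient * mvfderiv (𝓡 m) F.lapse x w := fun w ↦ by
    rw [mvfderiv_mul_apply mdifferentiableAt_const hφ, mvfderiv_const_apply]; ring
  -- Leibniz rule for `n = ± φ ∇Φ`. The Hessian of `Φ` is symmetric, so only `dφ` contributes to the
  -- antisymmetric part.
  have hL : ∀ w, g.leviCivita F.normal x w = (F.orient * F.lapse x) • g.leviCivita
      (g.grad F.toFun) x w + (F.orient * mvfderiv (𝓡 m) F.lapse x w) • g.grad F.toFun x := by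
    intro w
    have h := g.leviCivita.isCovariantDerivativeOnUniv.leibniz hG hc
    have := congrArg (fun L ↦ L w) h
    rw [← hdc]
    exact this
  have hs := g.leviCivita_grad_symm F.contMDiff x u v
  rw [hL, hL, F.mvfderiv_log_lapse, F.mvfderiv_log_lapse]
  simp only [normal, map_add, map_smul, _root_.add_apply, _root_.smul_apply, smul_eq_mul, hs]
  have := (F.lapse_pos x).ne'
  field_simp
  ring

/-- The acceleration of the normal: put `u = n` in the antisymmetric part of `∇n` and use that `∇n`
has no component along `n`. -/
theorem val_leviCivita_normal_self {x : M} {t : TangentSpace (𝓡 m) x}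
    (ht : g.val x (F.normal x) t = 0) :
    g.val x (g.leviCivita F.normal x (F.normal x)) t =
      -F.eps * mvfderiv (𝓡 m) (fun y ↦ Real.log (F.lapse y)) x t := by
  have h := F.val_leviCivita_normal_antisymm x (F.normal x) t
  rw [F.val_leviCivita_normal_normal, ht, F.val_normal_normal] at h
  linarith

/-- The antisymmetric part of `∇n` carries a factor `g(n, ·)`, which vanishes on tangent vectors. -/
theorem val_leviCivita_normal_symm {x : M} {u v : TangentSpace (𝓡 m) x}
    (hu : g.val x (F.normal x) u = 0) (hv : g.val x (F.normal x) v = 0) :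
    g.val x (g.leviCivita F.normal x u) v = g.val x (g.leviCivita F.normal x v) u := by
  have h := F.val_leviCivita_normal_antisymm x u v
  rw [hu, hv] at h
  linarith

theorem secondForm_of_tangent {x : M} {u v : TangentSpace (𝓡 m) x}
    (hu : g.val x (F.normal x) u = 0) (hv : g.val x (F.normal x) v = 0) :
    F.secondForm x u v = g.val x (g.leviCivita F.normal x u) v := by
  rw [secondForm, F.proj_of_tangent hu, F.proj_of_tangent hv]

end SliceFoliation

/-! ### The Gram matrix of tangent conformal Killing vectors and the second fundamental form -/

section Symmetries

variable {m : ℕ} {M : Type*} [TopologicalSpace M]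
  [ChartedSpace (EuclideanSpace ℝ (Fin m)) M] [IsManifold (𝓡 m) ∞ M]
  {g : LorentzMetric m M} {n : ℕ} {K : Fin n → VectorFieldOn m M}

theorem gram_comm (K : Fin n → VectorFieldOn m M) (a b : Fin n) (x : M) :
    gram g K x a b = gram g K x b a := g.symm x _ _

theorem gramInv_comm (K : Fin n → VectorFieldOn m M) (a b : Fin n) (x : M) :
    gramInv g K a b x = gramInv g K b a x := by
  have h : (gram g K x).transpose = gram g K x := Matrix.ext fun a b ↦ gram_comm K b a x
  unfold gramInv
  conv_lhs => rw [← h, ← Matrix.transpose_nonsing_inv]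
  rfl

theorem sum_gramInv_mul_gram (hgram : ∀ x, IsUnit (gram g K x).det) (a c : Fin n) (x : M) :
    ∑ b, gramInv g K a b x * gram g K x b c = if a = c then 1 else 0 := by
  have := congrFun (congrFun (Matrix.nonsing_inv_mul (gram g K x) (hgram x)) a) c
  rwa [Matrix.mul_apply, Matrix.one_apply] at this

theorem smoothFunAt_gram (hK : ∀ a, SmoothVectorFieldOn (K a) univ) (a b : Fin n) (x : M) :
    SmoothFunAt (m := m) (fun y ↦ gram g K y a b) x :=
  g.smoothFunAt_pair ((hK a).contMDiffAt Filter.univ_mem) ((hK b).contMDiffAt Filter.univ_mem)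

theorem smoothFunAt_gramInv (hK : ∀ a, SmoothVectorFieldOn (K a) univ)
    (hgram : ∀ x, IsUnit (gram g K x).det) (a b : Fin n) (x : M) :
    SmoothFunAt (m := m) (gramInv g K a b) x :=
  smoothFunAt_matrix_inv (fun i j ↦ smoothFunAt_gram hK i j x) (hgram x).ne_zero a b

/-- The derivative of the inverse Gram matrix, contracted with `G c`. -/
theorem sum_mvfderiv_gramInv (hK : ∀ a, SmoothVectorFieldOn (K a) univ)
    (hgram : ∀ x, IsUnit (gram g K x).det) (x : M) (v : TangentSpace (𝓡 m) x) (c : Fin n → ℝ) :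
    ∑ a, ∑ b, mvfderiv (𝓡 m) (gramInv g K a b) x v *
        (∑ d, c d * gram g K x d a) * (∑ d, c d * gram g K x d b) =
      -∑ a, ∑ b, c a * c b * mvfderiv (𝓡 m) (fun y ↦ gram g K y a b) x v := by
  set G := gram g K x
  let D : Matrix (Fin n) (Fin n) ℝ := Matrix.of fun a b ↦ mvfderiv (𝓡 m) (gramInv g K a b) x v
  let E : Matrix (Fin n) (Fin n) ℝ :=
    Matrix.of fun a b ↦ mvfderiv (𝓡 m) (fun y ↦ gram g K y a b) x v
  -- The derivative of `𝒢⁻¹ 𝒢 = 1`; multiplied by `G` from the left it becomes `G D G = -E`, which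
  -- is then evaluated as a quadratic form on `c`.
  have h1 : D * G + G⁻¹ * E = 0 := by
    ext a c
    have hd : ∀ b, MDifferentiableAt (𝓡 m) 𝓘(ℝ, ℝ)
        (fun y ↦ gramInv g K a b y * gram g K y b c) x := fun b ↦
      ((smoothFunAt_gramInv hK hgram a b x).mul
        (smoothFunAt_gram hK b c x)).mdifferentiableAt (by simp)
    have h := mvfderiv_finset_sum Finset.univ hd v
    simp only [sum_gramInv_mul_gram hgram a c, mvfderiv_const_apply] at h
    simp only [Matrix.add_apply, Matrix.mul_apply, Matrix.zero_apply, ← Finset.sum_add_distrib]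
    rw [h]
    refine Finset.sum_congr rfl fun b _ ↦ ?_
    rw [mvfderiv_mul_apply (smoothFunAt_gramInv hK hgram a b x).mdifferentiableAt
      (smoothFunAt_gram hK b c x).mdifferentiableAt]
    simp only [D, E, Matrix.of_apply, gramInv, G]
    ring
  have h2 : G * D * G = -E := by
    have := congrArg (fun A ↦ G * A) h1
    simp only [Matrix.mul_add, Matrix.mul_zero, ← Matrix.mul_assoc,
      Matrix.mul_nonsing_inv G (hgram x), Matrix.one_mul] at this
    exact eq_neg_of_add_eq_zero_left this
  have hG : G.transpose = G := Matrix.ext fun a b ↦ gram_comm K b a x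
  have h3 : Matrix.vecMul c G ⬝ᵥ (Matrix.mulVec D (Matrix.vecMul c G)) =
      c ⬝ᵥ Matrix.mulVec (-E) c := by
    rw [← h2, ← Matrix.mulVec_mulVec, ← Matrix.mulVec_mulVec, Matrix.dotProduct_mulVec c G,
      ← Matrix.vecMul_transpose G c, hG]
  have e1 : ∀ (A : Matrix (Fin n) (Fin n) ℝ) (w : Fin n → ℝ),
      w ⬝ᵥ A.mulVec w = ∑ a, ∑ b, A a b * w a * w b := by
    intro A w
    simp only [dotProduct, Matrix.mulVec, Finset.mul_sum]
    exact Finset.sum_congr rfl fun a _ ↦ Finset.sum_congr rfl fun b _ ↦ by ring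
  rw [e1, e1] at h3
  rw [show (∑ a, ∑ b, mvfderiv (𝓡 m) (gramInv g K a b) x v *
        (∑ d, c d * G d a) * (∑ d, c d * G d b)) = _ from h3, ← Finset.sum_neg_distrib]
  refine Finset.sum_congr rfl fun a _ ↦ ?_
  rw [← Finset.sum_neg_distrib]
  refine Finset.sum_congr rfl fun b _ ↦ ?_
  simp only [Matrix.neg_apply, E, Matrix.of_apply]
  ring

namespace LorentzMetric

/-- The conformal factor of a conformal Killing vector. -/
noncomputable def conformalFactor (g : LorentzMetric m M) (X : VectorFieldOn m M) (x : M) :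
    ℝ :=
  (1 / (m : ℝ)) * g.divergence X x

theorem IsConformalKilling.val_add_val {X : VectorFieldOn m M} (h : g.IsConformalKilling X) (x : M)
    (u v : TangentSpace (𝓡 m) x) :
    g.val x (g.leviCivita X x u) v + g.val x (g.leviCivita X x v) u =
      2 * g.conformalFactor X x * g.val x u v := by
  rw [h.2 x u v, g.symm x v u, conformalFactor]
  ring

theorem IsConformalKilling.smoothSectionAt {X : VectorFieldOn m M} (h : g.IsConformalKilling X)
    (x : M) : SmoothSectionAt X x := h.1.contMDiffAt Filter.univ_mem

end LorentzMetric

namespace SliceFoliation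

variable (F : SliceFoliation g)

/-- Differentiate `g(n, X) = 0`. Since this moves the derivative onto `n`, tangency is needed on all
of `M`, not only at `x`. -/
theorem val_leviCivita_of_tangent {X : VectorFieldOn m M} (hX : ∀ y, SmoothSectionAt X y)
    (ht : ∀ y, g.val y (F.normal y) (X y) = 0) (x : M) (u : TangentSpace (𝓡 m) x) :
    g.val x (g.leviCivita X x u) (F.normal x) = -g.val x (g.leviCivita F.normal x u) (X x) := by
  have h := g.mvfderiv_pair (F.smoothSectionAt_normal x).mdifferentiableAt
    (hX x).mdifferentiableAt u
  rw [show g.pair F.normal X = fun _ ↦ 0 from funext ht, mvfderiv_const_apply,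
    g.symm x (F.normal x)] at h
  linarith

/-- The conformal factor of a tangent conformal Killing vector is its derivative of `ln φ`. -/
theorem conformalFactor_eq {X : VectorFieldOn m M} (hX : g.IsConformalKilling X)
    (ht : ∀ y, g.val y (F.normal y) (X y) = 0) (x : M) :
    g.conformalFactor X x = mvfderiv (𝓡 m) (fun y ↦ Real.log (F.lapse y)) x (X x) := by
  -- The `(n, n)` component of the conformal Killing equation: its left side is `-2 g(∇_n n, X) = 2ε
  -- X(ln φ)`, its right side `2ε` times the conformal factor.
  have h1 := hX.val_add_val x (F.normal x) (F.normal x)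
  rw [F.val_leviCivita_of_tangent hX.smoothSectionAt ht, F.val_leviCivita_normal_self (ht x),
    F.val_normal_normal] at h1
  linear_combination (-F.eps / 2) * h1 + (mvfderiv (𝓡 m) (fun y ↦ Real.log (F.lapse y)) x (X x)
    - g.conformalFactor X x) * F.eps_mul_eps

/-- The normal derivative of the Gram matrix is twice the second fundamental form. -/
theorem mvfderiv_gram_normal (hK : ∀ a, g.IsConformalKilling (K a))
    (ht : ∀ a x, g.val x (F.normal x) (K a x) = 0) (a b : Fin n) (x : M) :
    mvfderiv (𝓡 m) (fun y ↦ gram g K y a b) x (F.normal x) =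
      2 * g.val x (g.leviCivita F.normal x (K a x)) (K b x) := by
  have h := g.mvfderiv_pair ((hK a).smoothSectionAt x).mdifferentiableAt
    ((hK b).smoothSectionAt x).mdifferentiableAt (F.normal x)
  -- In the mixed components the right side vanishes because `g(n, 𝒦_b) = 0`. So the equation trades
  -- `∇_n 𝒦_a` for a derivative of `𝒦_a` along `𝒦_b`, and tangency turns that into a derivative of
  -- `n`.
  have h1 := (hK a).val_add_val x (F.normal x) (K b x)
  have h2 := (hK b).val_add_val x (F.normal x) (K a x)
  rw [F.val_leviCivita_of_tangent (hK a).smoothSectionAt (ht a), ht] at h1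
  rw [F.val_leviCivita_of_tangent (hK b).smoothSectionAt (ht b), ht] at h2
  rw [F.val_leviCivita_normal_symm (ht b x) (ht a x)] at h1
  rw [g.symm x (K a x)] at h
  change mvfderiv (𝓡 m) (g.pair (K a) (K b)) x (F.normal x) = _
  linarith

theorem isComplementary_complProj (hgram : ∀ x, IsUnit (gram g K x).det)
    (ht : ∀ a x, g.val x (F.normal x) (K a x) = 0) (x : M) (v : TangentSpace (𝓡 m) x) :
    F.IsComplementary K x (F.complProj K x v) := by
  constructor
  · simp [complProj, F.val_normal_proj, ht]
  · intro c
    have h1 : g.val x (K c x) (F.proj x v) = g.val x (K c x) v := by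
      simp [proj, g.symm x (K c x) (F.normal x), ht]
    have h2 : ∑ a, ∑ b, gramInv g K a b x * g.val x (K a x) v * g.val x (K c x) (K b x) =
        g.val x (K c x) v := by
      have : ∀ a, ∑ b, gramInv g K a b x * g.val x (K a x) v * g.val x (K c x) (K b x) =
          (if a = c then 1 else 0) * g.val x (K a x) v := by
        intro a
        rw [← sum_gramInv_mul_gram hgram a c x, Finset.sum_mul]
        refine Finset.sum_congr rfl fun b _ ↦ ?_
        rw [g.symm x (K c x)]
        simp only [gram, Matrix.of_apply]
        ring
      simp [this]
    simp only [complProj, map_sub, map_sum, map_smul, smul_eq_mul, h1, h2, sub_self]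

/-- The pointwise identity behind the conformal Killing equation of the lifted tensor. -/
theorem sum_gramInv_add_normalDeriv (hK : ∀ a, g.IsConformalKilling (K a))
    (hgram : ∀ x, IsUnit (gram g K x).det)
    (ht : ∀ a x, g.val x (F.normal x) (K a x) = 0)
    (hblock : F.IsBlockDiagonal K) (humbilic : F.IsPartiallyUmbilic K) {x : M}
    {t : TangentSpace (𝓡 m) x} (htan : g.val x (F.normal x) t = 0) :
    ∑ a, ∑ b, (2 * F.weightedTrace K x * gramInv g K a b x + F.normalDeriv (gramInv g K a b) x) *
        g.val x (K a x) t * g.val x (K b x) t + 2 * g.val x (g.leviCivita F.normal x t) t =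
      2 * F.weightedTrace K x * g.val x t t := by
  set χ := F.weightedTrace K x
  set X := F.complProj K x t with hX
  -- The coefficients of the orthogonal projection `k` of `t` to the span of the `𝒦_a`, so that `t =
  -- k + X` with `X` complementary.
  let c : Fin n → ℝ := fun b ↦ ∑ a, gramInv g K a b x * g.val x (K a x) t
  set k : TangentSpace (𝓡 m) x := ∑ b, c b • K b x with hk
  have hXc := F.isComplementary_complProj hgram ht x t
  rw [← hX] at hXc
  have htk : t = k + X := by
    simp only [hX, complProj, F.proj_of_tangent htan, hk, c, Finset.sum_smul]
    rw [Finset.sum_comm]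
    abel
  have hKX : ∀ a, g.val x (K a x) X = 0 := hXc.2
  have hXX := humbilic x X X hXc hXc
  have hnk : g.val x (F.normal x) k = 0 := by simp [hk, ht]
  rw [F.secondForm_of_tangent hXc.1 hXc.1] at hXX
  simp only [induced, hXc.1, mul_zero, sub_zero] at hXX
  have hKaX : ∀ a, g.val x (g.leviCivita F.normal x (K a x)) X = 0 := fun a ↦ by
    rw [← F.secondForm_of_tangent (ht a x) hXc.1]; exact hblock x a X hXc
  have hkX : g.val x (g.leviCivita F.normal x k) X = 0 := by
    simp [hk, hKaX]
  have hXk : g.val x (g.leviCivita F.normal x X) k = 0 := by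
    rw [F.val_leviCivita_normal_symm hXc.1 hnk, hkX]
  have hkX' : g.val x k X = 0 := by simp [hk, hKX]
  -- Puts the covector `a ↦ g(𝒦_a, t)` in the form `c 𝒢` in which the derivative of the inverse Gram
  -- matrix can be contracted.
  have hτ : ∀ a, g.val x (K a x) t = ∑ d, c d * gram g K x d a := by
    intro a
    rw [htk, map_add, hKX, add_zero]
    simp [hk, gram, g.symm x (K a x)]
  have hG : ∑ a, ∑ b, gramInv g K a b x * g.val x (K a x) t * g.val x (K b x) t =
      g.val x k k := by
    rw [Finset.sum_comm]
    simp only [← Finset.sum_mul]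
    have : ∀ b, g.val x (K b x) t = g.val x (K b x) k := fun b ↦ by
      conv_lhs => rw [htk, map_add, hKX, add_zero]
    have hkk : g.val x k k = ∑ b, c b * g.val x (K b x) k := by
      conv_lhs => arg 1; rw [hk]
      simp only [map_sum, _root_.sum_apply, map_smul, _root_.smul_apply, smul_eq_mul]
    rw [hkk]
    exact Finset.sum_congr rfl fun b _ ↦ by rw [this b]
  -- Passing from `𝒢^{ab}` to `𝒢_{ab}` reverses the sign, and `n(𝒢_{ab})` is twice the second
  -- fundamental form. This is why the second fundamental form need not be umbilic in the directions
  -- of the `𝒦_a`.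
  have hD : ∑ a, ∑ b, F.normalDeriv (gramInv g K a b) x * g.val x (K a x) t * g.val x (K b x) t =
      -(2 * g.val x (g.leviCivita F.normal x k) k) := by
    simp only [hτ, normalDeriv]
    rw [sum_mvfderiv_gramInv (fun a ↦ (hK a).1) hgram]
    simp only [F.mvfderiv_gram_normal hK ht]
    simp only [hk, map_sum, map_smul, _root_.sum_apply, _root_.smul_apply, smul_eq_mul,
      Finset.mul_sum]
    congr 1
    rw [Finset.sum_comm]
    exact Finset.sum_congr rfl fun a _ ↦ Finset.sum_congr rfl fun b _ ↦ by ring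
  have hsplit : ∑ a, ∑ b, (2 * χ * gramInv g K a b x + F.normalDeriv (gramInv g K a b) x) *
        g.val x (K a x) t * g.val x (K b x) t = 2 * χ * g.val x k k
          - 2 * g.val x (g.leviCivita F.normal x k) k := by
    rw [← hG, sub_eq_add_neg, ← hD, Finset.mul_sum, ← Finset.sum_add_distrib]
    refine Finset.sum_congr rfl fun a _ ↦ ?_
    rw [Finset.mul_sum, ← Finset.sum_add_distrib]
    exact Finset.sum_congr rfl fun b _ ↦ by ring
  rw [hsplit, htk]
  simp only [map_add, _root_.add_apply, hXX, hkX, hXk, hkX', g.symm x X k]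
  ring

end SliceFoliation

end Symmetries

/-! ### Polarization, metric traces and covariant derivatives of bilinear forms -/

/-- A symmetrized trilinear form is determined by its cubic form. -/
theorem permSum_eq_of_diagonal {V : Type*} [AddCommGroup V] {T S : V → V → V → ℝ}
    (hT₁ : ∀ u u' v w, T (u + u') v w = T u v w + T u' v w)
    (hT₂ : ∀ u v v' w, T u (v + v') w = T u v w + T u v' w)
    (hT₃ : ∀ u v w w', T u v (w + w') = T u v w + T u v w')
    (hS₁ : ∀ u u' v w, S (u + u') v w = S u v w + S u' v w)
    (hS₂ : ∀ u v v' w, S u (v + v') w = S u v w + S u v' w)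
    (hS₃ : ∀ u v w w', S u v (w + w') = S u v w + S u v w')
    (h : ∀ u, T u u u = S u u u) (u v w : V) : permSum T u v w = permSum S u v w := by
  -- Inclusion and exclusion: the mixed terms of the cubic form at `u + v + w` remain after
  -- subtracting its values at the pairwise sums and adding those at the single vectors.
  have h1 := h (u + v + w)
  have h2 := h (u + v)
  have h3 := h (u + w)
  have h4 := h (v + w)
  have h5 := h u
  have h6 := h v
  have h7 := h w
  simp only [hT₁, hT₂, hT₃, hS₁, hS₂, hS₃] at h1 h2 h3 h4
  simp only [permSum]
  linarith

namespace LorentzMetric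

variable {m : ℕ} {M : Type*} [TopologicalSpace M]
  [ChartedSpace (EuclideanSpace ℝ (Fin m)) M] [IsManifold (𝓡 m) ∞ M]
  (g : LorentzMetric m M)

theorem invComp_comm (x : M) (i j : Fin m) : g.invComp x i j = g.invComp x j i := by
  have h : (Matrix.of fun i j ↦ g.val x (coordBasis x i) (coordBasis x j)).transpose =
      (Matrix.of fun i j ↦ g.val x (coordBasis x i) (coordBasis x j)) :=
    Matrix.ext fun a b ↦ g.symm x _ _
  unfold invComp
  conv_lhs => rw [← h, ← Matrix.transpose_nonsing_inv]
  rfl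

theorem metricTrace_swap (x : M) (B : TangentSpace (𝓡 m) x → TangentSpace (𝓡 m) x → ℝ) :
    g.metricTrace x (fun u v ↦ B v u) = g.metricTrace x B := by
  unfold metricTrace
  rw [Finset.sum_comm]
  refine Finset.sum_congr rfl fun i _ ↦ Finset.sum_congr rfl fun j _ ↦ ?_
  rw [g.invComp_comm]

theorem metricTrace_add (x : M) (B C : TangentSpace (𝓡 m) x → TangentSpace (𝓡 m) x → ℝ) :
    g.metricTrace x (fun u v ↦ B u v + C u v) = g.metricTrace x B + g.metricTrace x C := by
  simp [metricTrace, mul_add, Finset.sum_add_distrib]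

theorem metricTrace_const_mul (x : M) (c : ℝ)
    (B : TangentSpace (𝓡 m) x → TangentSpace (𝓡 m) x → ℝ) :
    g.metricTrace x (fun u v ↦ c * B u v) = c * g.metricTrace x B := by
  simp only [metricTrace, Finset.mul_sum]
  exact Finset.sum_congr rfl fun i _ ↦ Finset.sum_congr rfl fun j _ ↦ by ring

theorem metricTrace_mul_val (x : M) (θ : TangentSpace (𝓡 m) x →L[ℝ] ℝ)
    (w : TangentSpace (𝓡 m) x) : g.metricTrace x (fun u v ↦ θ u * g.val x w v) = θ w := by
  rw [← g.val_sharp x θ w, g.symm x _ w, sharp]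
  simp [metricTrace, mul_assoc]

theorem metricTrace_val_mul_val (x : M) (w w' : TangentSpace (𝓡 m) x) :
    g.metricTrace x (fun u v ↦ g.val x w u * g.val x w' v) = g.val x w w' :=
  g.metricTrace_mul_val x (g.val x w) w'

theorem metricTrace_val (x : M) : g.metricTrace x (fun u v ↦ g.val x u v) = m := by
  have h := Matrix.nonsing_inv_mul _ (g.isUnit_gram x)
  have h2 := congrArg Matrix.trace h
  rw [Matrix.trace_one, Fintype.card_fin] at h2
  rw [← h2]
  simp only [Matrix.trace, Matrix.diag_apply, Matrix.mul_apply, metricTrace, invComp]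
  refine Finset.sum_congr rfl fun i _ ↦ Finset.sum_congr rfl fun j _ ↦ ?_
  rw [g.symm x]
  rfl

/-- Differentiability at `x` of a bilinear form, together with the fact that its metric trace
commutes with the covariant derivative. -/
structure TensorRegularAt (T : TwoTensorField m M) (x : M) : Prop where
  diff : ∀ V W : VectorFieldOn m M, SectionDiffAt V x → SectionDiffAt W x →
    MDifferentiableAt (𝓡 m) 𝓘(ℝ, ℝ) (fun y ↦ T y (V y) (W y)) x
  trace_diff : MDifferentiableAt (𝓡 m) 𝓘(ℝ, ℝ) (fun y ↦ g.metricTrace y fun u v ↦ T y u v) x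
  trace_deriv : ∀ w, mvfderiv (𝓡 m) (fun y ↦ g.metricTrace y fun u v ↦ T y u v) x w =
    g.metricTrace x fun u v ↦ g.covTensor T x w u v

variable {g}

theorem sectionDiffAt_extend {x : M} (v : TangentSpace (𝓡 m) x) :
    SectionDiffAt (FiberBundle.extend (EuclideanSpace ℝ (Fin m)) v) x :=
  (smoothSectionAt_extend v).mdifferentiableAt

theorem covTensor_val (x : M) (u v w : TangentSpace (𝓡 m) x) : g.covTensor g.val x u v w = 0 := by
  have h := g.mvfderiv_pair (sectionDiffAt_extend v) (sectionDiffAt_extend w) u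
  simp only [FiberBundle.extend_apply_self] at h
  rw [covTensor]
  change mvfderiv (𝓡 m) (g.pair _ _) x u - _ - _ = 0
  rw [h]
  ring

theorem tensorRegularAt_val (x : M) : g.TensorRegularAt g.val x where
  diff _ _ hV hW := g.mdifferentiableAt_pair hV hW
  trace_diff := by
    simp only [g.metricTrace_val]
    exact mdifferentiableAt_const
  trace_deriv w := by
    simp only [g.metricTrace_val, covTensor_val, mvfderiv_const_apply]
    simp [metricTrace]

/-- The bilinear form `X_α Y_β`. -/
noncomputable def outer (g : LorentzMetric m M) (X Y : VectorFieldOn m M) :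
    TwoTensorField m M :=
  fun x ↦ (g.val x (X x)).smulRight (g.val x (Y x))

theorem outer_apply (X Y : VectorFieldOn m M) (x : M) (u v : TangentSpace (𝓡 m) x) :
    g.outer X Y x u v = g.val x (X x) u * g.val x (Y x) v := by
  simp [outer]

theorem covTensor_outer {X Y : VectorFieldOn m M} {x : M} (hX : SectionDiffAt X x)
    (hY : SectionDiffAt Y x) (u v w : TangentSpace (𝓡 m) x) :
    g.covTensor (g.outer X Y) x u v w =
      g.val x (g.leviCivita X x u) v * g.val x (Y x) w
        + g.val x (X x) v * g.val x (g.leviCivita Y x u) w := by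
  have h1 := g.mvfderiv_pair hX (sectionDiffAt_extend v) u
  have h2 := g.mvfderiv_pair hY (sectionDiffAt_extend w) u
  have h3 := mvfderiv_mul_apply (g.mdifferentiableAt_pair hX (sectionDiffAt_extend v))
    (g.mdifferentiableAt_pair hY (sectionDiffAt_extend w)) u
  rw [h1, h2] at h3
  simp only [pair, FiberBundle.extend_apply_self] at h3
  simp only [covTensor, outer_apply, h3]
  ring

/-- The trace of `X ⊗ Y` is `g(X, Y)`, so commuting trace and derivative is metric compatibility.
Together with `g`, sums and multiples by functions, these products generate the lifted tensor, and
no component computation with the chart-dependent `invComp` is needed. -/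
theorem tensorRegularAt_outer {X Y : VectorFieldOn m M} {x : M} (hX : SectionDiffAt X x)
    (hY : SectionDiffAt Y x) : g.TensorRegularAt (g.outer X Y) x where
  diff V W hV hW := by
    simp only [outer_apply]
    exact (g.mdifferentiableAt_pair hX hV).mul (g.mdifferentiableAt_pair hY hW)
  trace_diff := by
    simp only [outer_apply, g.metricTrace_val_mul_val]
    exact g.mdifferentiableAt_pair hX hY
  trace_deriv w := by
    simp only [outer_apply, g.metricTrace_val_mul_val, covTensor_outer hX hY]
    rw [g.metricTrace_add, g.metricTrace_val_mul_val, g.metricTrace_val_mul_val]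
    exact g.mvfderiv_pair hX hY w

theorem covTensor_add {T S : TwoTensorField m M} {x : M} (hT : g.TensorRegularAt T x)
    (hS : g.TensorRegularAt S x) (u v w : TangentSpace (𝓡 m) x) :
    g.covTensor (T + S) x u v w = g.covTensor T x u v w + g.covTensor S x u v w := by
  have h := mvfderiv_add_apply (hT.diff _ _ (sectionDiffAt_extend v) (sectionDiffAt_extend w))
    (hS.diff _ _ (sectionDiffAt_extend v) (sectionDiffAt_extend w)) u
  simp only [covTensor, Pi.add_apply, _root_.add_apply, h]
  ring

theorem TensorRegularAt.add {T S : TwoTensorField m M} {x : M} (hT : g.TensorRegularAt T x)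
    (hS : g.TensorRegularAt S x) : g.TensorRegularAt (T + S) x where
  diff V W hV hW := (hT.diff V W hV hW).add (hS.diff V W hV hW)
  trace_diff := by
    simp only [Pi.add_apply, _root_.add_apply, g.metricTrace_add]
    exact hT.trace_diff.add hS.trace_diff
  trace_deriv w := by
    simp only [Pi.add_apply, _root_.add_apply, g.metricTrace_add, covTensor_add hT hS]
    rw [mvfderiv_add_apply hT.trace_diff hS.trace_diff, hT.trace_deriv, hS.trace_deriv]

theorem covTensor_smul {f : M → ℝ} {T : TwoTensorField m M} {x : M}
    (hf : MDifferentiableAt (𝓡 m) 𝓘(ℝ, ℝ) f x) (hT : g.TensorRegularAt T x)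
    (u v w : TangentSpace (𝓡 m) x) :
    g.covTensor (fun y ↦ f y • T y) x u v w =
      mvfderiv (𝓡 m) f x u * T x v w + f x * g.covTensor T x u v w := by
  have h := mvfderiv_mul_apply hf
    (hT.diff _ _ (sectionDiffAt_extend v) (sectionDiffAt_extend w)) u
  simp only [FiberBundle.extend_apply_self] at h
  simp only [covTensor, _root_.smul_apply, smul_eq_mul, h]
  ring

theorem TensorRegularAt.smul {f : M → ℝ} {T : TwoTensorField m M} {x : M}
    (hf : MDifferentiableAt (𝓡 m) 𝓘(ℝ, ℝ) f x) (hT : g.TensorRegularAt T x) :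
    g.TensorRegularAt (fun y ↦ f y • T y) x where
  diff V W hV hW := hf.mul (hT.diff V W hV hW)
  trace_diff := by
    simp only [_root_.smul_apply, smul_eq_mul, g.metricTrace_const_mul]
    exact hf.mul hT.trace_diff
  trace_deriv w := by
    simp only [_root_.smul_apply, smul_eq_mul, g.metricTrace_const_mul, covTensor_smul hf hT,
      g.metricTrace_add]
    rw [mvfderiv_mul_apply hf hT.trace_diff, hT.trace_deriv]
    ring

theorem covTensor_zero (x : M) (u v w : TangentSpace (𝓡 m) x) :
    g.covTensor (0 : TwoTensorField m M) x u v w = 0 := by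
  simp [covTensor, mvfderiv_const_apply]

theorem tensorRegularAt_zero (x : M) : g.TensorRegularAt (0 : TwoTensorField m M) x where
  diff V W _ _ := by simpa using mdifferentiableAt_const
  trace_diff := by simpa [metricTrace] using mdifferentiableAt_const
  trace_deriv w := by simp [covTensor_zero, metricTrace, mvfderiv_const_apply]

theorem TensorRegularAt.sum {ι : Type*} {s : Finset ι} {T : ι → TwoTensorField m M} {x : M}
    (hT : ∀ i, g.TensorRegularAt (T i) x) : g.TensorRegularAt (∑ i ∈ s, T i) x := by
  classical
  induction s using Finset.induction_on with
  | empty => simpa using tensorRegularAt_zero x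
  | insert a s ha ih => rw [Finset.sum_insert ha]; exact (hT a).add ih

theorem covTensor_sum {ι : Type*} {s : Finset ι} {T : ι → TwoTensorField m M} {x : M}
    (hT : ∀ i, g.TensorRegularAt (T i) x) (u v w : TangentSpace (𝓡 m) x) :
    g.covTensor (∑ i ∈ s, T i) x u v w = ∑ i ∈ s, g.covTensor (T i) x u v w := by
  classical
  induction s using Finset.induction_on with
  | empty => simp [covTensor_zero]
  | insert a s ha ih =>
    rw [Finset.sum_insert ha, Finset.sum_insert ha, covTensor_add (hT a) (.sum hT), ih]

theorem covTensor_comm {T : TwoTensorField m M} {x : M}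
    (hT : ∀ᶠ y in 𝓝 x, ∀ u v, T y u v = T y v u) (u v w : TangentSpace (𝓡 m) x) :
    g.covTensor T x u v w = g.covTensor T x u w v := by
  have hx := hT.self_of_nhds
  simp only [covTensor]
  rw [mvfderiv_congr (hT.mono fun y hy ↦ hy _ _), hx v, hx _ w]
  ring

/-- Tracing the conformal Killing equation identifies the one-form. -/
theorem conformalOneForm_eq {T : TwoTensorField m M} {x : M} (hT : g.TensorRegularAt T x)
    (hsymm : ∀ᶠ y in 𝓝 x, ∀ u v, T y u v = T y v u) (θ : TangentSpace (𝓡 m) x →L[ℝ] ℝ)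
    (h : ∀ u v w, permSum (g.covTensor T x) u v w = permSum (fun a b c ↦ θ a * g.val x b c) u v w)
    (w : TangentSpace (𝓡 m) x) : g.conformalOneForm T x w = θ w := by
  have hc := fun u v w ↦ covTensor_comm (g := g) hsymm u v w
  have h1 : ∀ u v, g.covTensor T x u v w + g.covTensor T x v u w + g.covTensor T x w u v =
      θ u * g.val x w v + θ v * g.val x w u + θ w * g.val x u v := by
    intro u v
    have := h u v w
    simp only [permSum] at this
    rw [hc u w v, hc v w u, hc w v u, g.symm x w v, g.symm x w u, g.symm x v u] at this
    rw [g.symm x w v, g.symm x w u]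
    linarith
  -- Trace over `u`, `v`. On the left, two divergences and the derivative of the trace add up to `(m
  -- + 2) Ω(w)`; on the right, the terms are `θ(w)`, `θ(w)` and `m θ(w)`.
  have h2 : g.metricTrace x (fun u v ↦ g.covTensor T x u v w + g.covTensor T x v u w
      + g.covTensor T x w u v) = g.metricTrace x (fun u v ↦ θ u * g.val x w v + θ v * g.val x w u
        + θ w * g.val x u v) := by
    simp only [h1]
  rw [g.metricTrace_add, g.metricTrace_add, g.metricTrace_add, g.metricTrace_add,
    g.metricTrace_const_mul, g.metricTrace_val, g.metricTrace_mul_val,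
    g.metricTrace_swap x (fun u v ↦ θ u * g.val x w v), g.metricTrace_mul_val,
    g.metricTrace_swap x (fun u v ↦ g.covTensor T x u v w)] at h2
  rw [conformalOneForm, hT.trace_deriv]
  have hm : (m : ℝ) + 2 ≠ 0 := by positivity
  field_simp
  linarith

end LorentzMetric

/-! ### The conformal Killing equation of the lifted tensor -/

namespace SliceFoliation

variable {m : ℕ} {M : Type*} [TopologicalSpace M]
  [ChartedSpace (EuclideanSpace ℝ (Fin m)) M] [IsManifold (𝓡 m) ∞ M]
  {g : LorentzMetric m M} (F : SliceFoliation g) {n : ℕ} {K : Fin n → VectorFieldOn m M}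

theorem mvfderiv_decompose (f : M → ℝ) (x : M) (u : TangentSpace (𝓡 m) x) :
    mvfderiv (𝓡 m) f x u =
      F.sliceDeriv f x u + F.eps * g.val x (F.normal x) u * F.normalDeriv f x := by
  conv_lhs => rw [F.proj_add_normal x u]
  simp [sliceDeriv, normalDeriv]

theorem psi_eq (Ψt : M → ℝ) (x : M) : F.psi Ψt x = 2 * Real.log (F.lapse x) + Ψt x := by
  simp [psi, Real.log_pow]

theorem StepOne.smoothFunAt {F : SliceFoliation g} {U : Set M} (hU : IsOpen U) {Ψt : M → ℝ}
    (h : F.StepOne K U Ψt) {x : M} (hx : x ∈ U) : SmoothFunAt (m := m) Ψt x :=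
  h.1.contMDiffAt (hU.mem_nhds hx)

theorem smoothFunAt_psi {Ψt : M → ℝ} {x : M} (h : SmoothFunAt (m := m) Ψt x) :
    SmoothFunAt (m := m) (F.psi Ψt) x := by
  rw [show F.psi Ψt = _ from funext (F.psi_eq Ψt)]
  exact (contMDiffAt_const.mul (F.smoothFunAt_log_lapse x)).add h

theorem smoothFunAt_exp_psi {Ψt : M → ℝ} {x : M} (h : SmoothFunAt (m := m) Ψt x) :
    SmoothFunAt (m := m) (fun y ↦ Real.exp (F.psi Ψt y)) x :=
  (Real.contDiff_exp.contDiffAt.contMDiffAt).comp x (F.smoothFunAt_psi h)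

/-- The differential of `e^Ψ` after step one. -/
theorem mvfderiv_exp_psi {U : Set M} (hU : IsOpen U) {Ψt : M → ℝ} (h : F.StepOne K U Ψt) {x : M}
    (hx : x ∈ U) (u : TangentSpace (𝓡 m) x) :
    mvfderiv (𝓡 m) (fun y ↦ Real.exp (F.psi Ψt y)) x u =
      Real.exp (F.psi Ψt x) * (2 * F.sliceDeriv (fun y ↦ Real.log (F.lapse y)) x u
        + 2 * F.eps * g.val x (F.normal x) u * F.weightedTrace K x) := by
  have hΨ := (h.smoothFunAt hU hx)
  rw [mvfderiv_real_comp (Real.hasDerivAt_exp _) (F.smoothFunAt_psi hΨ).mdifferentiableAt]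
  have hl := (F.smoothFunAt_log_lapse x).mdifferentiableAt
  have hl2 : MDifferentiableAt (𝓡 m) 𝓘(ℝ, ℝ) (fun y ↦ 2 * Real.log (F.lapse y)) x :=
    (contMDiffAt_const.mul (F.smoothFunAt_log_lapse x)).mdifferentiableAt (by simp)
  -- Along the slice only `ln φ²` contributes. In the normal direction its derivative cancels
  -- against the `ln φ` term of step one, and `2χ` remains.
  rw [show F.psi Ψt = _ from funext (F.psi_eq Ψt), mvfderiv_add_apply hl2 hΨ.mdifferentiableAt,
    mvfderiv_mul_apply mdifferentiableAt_const hl, mvfderiv_const_apply,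
    F.mvfderiv_decompose Ψt, (h.2 x hx).1, (h.2 x hx).2,
    F.mvfderiv_decompose (fun y ↦ Real.log (F.lapse y))]
  ring

/-- The slice part is zero by step two. The normal part is that of `ε e^Ψ 𝒢^{ab}`, because `ν^{ab}`
is constant along `n`. -/
theorem StepTwo.mvfderiv_eq {F : SliceFoliation g} {U : Set M} (hU : IsOpen U)
    (hK : ∀ a, SmoothVectorFieldOn (K a) univ) (hgram : ∀ x, IsUnit (gram g K x).det)
    {Ψt : M → ℝ} {γ ν : Fin n → Fin n → M → ℝ} (h₁ : F.StepOne K U Ψt)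
    (h₂ : F.StepTwo K U Ψt γ ν) {x : M} (hx : x ∈ U) (a b : Fin n) (u : TangentSpace (𝓡 m) x) :
    mvfderiv (𝓡 m) (γ a b) x u = g.val x (F.normal x) u * Real.exp (F.psi Ψt x) *
      (2 * F.weightedTrace K x * gramInv g K a b x + F.normalDeriv (gramInv g K a b) x) := by
  have hE := F.smoothFunAt_exp_psi (h₁.smoothFunAt hU hx)
  have hG := smoothFunAt_gramInv hK hgram a b x
  have hν : SmoothFunAt (m := m) (ν a b) x := (h₂.2.1 a b).contMDiffAt (hU.mem_nhds hx)
  have hεE : SmoothFunAt (m := m) (fun y ↦ F.eps * Real.exp (F.psi Ψt y)) x :=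
    contMDiffAt_const.mul hE
  have hεEG : SmoothFunAt (m := m) (fun y ↦ F.eps * Real.exp (F.psi Ψt y) * gramInv g K a b y) x :=
    hεE.mul hG
  have hc : γ a b =ᶠ[𝓝 x]
      fun y ↦ F.eps * Real.exp (F.psi Ψt y) * gramInv g K a b y + ν a b y := by
    filter_upwards [hU.mem_nhds hx] with y hy
    exact (h₂.2.2 y hy a b).2.1
  have hn : F.normalDeriv (γ a b) x = F.eps * Real.exp (F.psi Ψt x) *
      (2 * F.weightedTrace K x * gramInv g K a b x + F.normalDeriv (gramInv g K a b) x) := by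
    have hν0 := (h₂.2.2 x hx a b).2.2.1
    simp only [normalDeriv] at hν0 ⊢
    rw [mvfderiv_congr hc, mvfderiv_add_apply hεEG.mdifferentiableAt hν.mdifferentiableAt, hν0,
      mvfderiv_mul_apply hεE.mdifferentiableAt hG.mdifferentiableAt,
      mvfderiv_mul_apply mdifferentiableAt_const hE.mdifferentiableAt, mvfderiv_const_apply,
      F.mvfderiv_exp_psi hU h₁ hx, F.val_normal_normal, sliceDeriv,
      show F.proj x (F.normal x) = 0 by
        simp [proj, F.val_normal_normal, F.eps_mul_eps], map_zero]
    linear_combination (2 * gramInv g K a b x * F.eps * Real.exp (F.psi Ψt x)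
      * F.weightedTrace K x) * F.eps_mul_eps
  rw [F.mvfderiv_decompose, (h₂.2.2 x hx a b).2.2.2 u, hn]
  linear_combination (g.val x (F.normal x) u * Real.exp (F.psi Ψt x) *
      (2 * F.weightedTrace K x * gramInv g K a b x + F.normalDeriv (gramInv g K a b) x))
      * F.eps_mul_eps

/-- The one-form `Ω_γ` of the lifted tensor. -/
noncomputable def liftOneForm (K : Fin n → VectorFieldOn m M) (α Ψt : M → ℝ)
    (γ : Fin n → Fin n → M → ℝ) (x : M) : TangentSpace (𝓡 m) x →L[ℝ] ℝ :=
  mvfderiv (𝓡 m) α x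
    + ∑ a, ∑ b, (2 * γ a b x * F.sliceDeriv (fun z ↦ Real.log (F.lapse z)) x (K b x)) •
        g.val x (K a x)
    + (2 * F.weightedTrace K x * Real.exp (F.psi Ψt x)) • g.val x (F.normal x)

theorem liftOneForm_apply (α Ψt : M → ℝ) (γ : Fin n → Fin n → M → ℝ) (x : M)
    (u : TangentSpace (𝓡 m) x) : F.liftOneForm K α Ψt γ x u = mvfderiv (𝓡 m) α x u
      + 2 * ∑ a, ∑ b, γ a b x * g.val x (K a x) u *
          F.sliceDeriv (fun z ↦ Real.log (F.lapse z)) x (K b x)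
      + 2 * F.weightedTrace K x * Real.exp (F.psi Ψt x) * g.val x (F.normal x) u := by
  simp only [liftOneForm, _root_.add_apply, _root_.sum_apply, _root_.smul_apply, smul_eq_mul,
    Finset.mul_sum]
  congr 2
  exact Finset.sum_congr rfl fun a _ ↦ Finset.sum_congr rfl fun b _ ↦ by ring

theorem liftTensor_eq (α Ψt : M → ℝ) (γ : Fin n → Fin n → M → ℝ) :
    F.liftTensor K α Ψt γ = (fun y ↦ α y • g.val y)
      + ∑ a, ∑ b, (fun y ↦ γ a b y • g.outer (K a) (K b) y)
      + (fun y ↦ Real.exp (F.psi Ψt y) • g.outer F.normal F.normal y) := by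
  funext y
  simp [liftTensor, LorentzMetric.outer]

theorem liftTensor_apply (α Ψt : M → ℝ) (γ : Fin n → Fin n → M → ℝ) (x : M)
    (u v : TangentSpace (𝓡 m) x) : F.liftTensor K α Ψt γ x u v = α x * g.val x u v
      + ∑ a, ∑ b, γ a b x * (g.val x (K a x) u * g.val x (K b x) v)
      + Real.exp (F.psi Ψt x) * (g.val x (F.normal x) u * g.val x (F.normal x) v) := by
  simp [liftTensor]

theorem tensorRegularAt_liftTensor (hK : ∀ a, SmoothVectorFieldOn (K a) univ) {α Ψt : M → ℝ}
    {γ : Fin n → Fin n → M → ℝ} {x : M} (hα : SmoothFunAt (m := m) α x)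
    (hΨ : SmoothFunAt (m := m) Ψt x) (hγ : ∀ a b, SmoothFunAt (m := m) (γ a b) x) :
    g.TensorRegularAt (F.liftTensor K α Ψt γ) x := by
  have hKd : ∀ a, SectionDiffAt (K a) x := fun a ↦
    SmoothSectionAt.mdifferentiableAt ((hK a).contMDiffAt Filter.univ_mem)
  have hn := (F.smoothSectionAt_normal x).mdifferentiableAt
  rw [F.liftTensor_eq]
  exact (((LorentzMetric.tensorRegularAt_val x).smul hα.mdifferentiableAt).add
    (.sum fun a ↦ .sum fun b ↦ (LorentzMetric.tensorRegularAt_outer (hKd a) (hKd b)).smul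
      (hγ a b).mdifferentiableAt)).add
    ((LorentzMetric.tensorRegularAt_outer hn hn).smul (F.smoothFunAt_exp_psi hΨ).mdifferentiableAt)

/-- Besides the cubic form, polarization requires additivity in each argument. This is hidden in the
definition of `covTensor`, which extends `v` and `w` to vector fields, and becomes visible in this
formula. -/
theorem covTensor_liftTensor (hK : ∀ a, SmoothVectorFieldOn (K a) univ) {α Ψt : M → ℝ}
    {γ : Fin n → Fin n → M → ℝ} {x : M} (hα : SmoothFunAt (m := m) α x)
    (hΨ : SmoothFunAt (m := m) Ψt x) (hγ : ∀ a b, SmoothFunAt (m := m) (γ a b) x)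
    (u v w : TangentSpace (𝓡 m) x) :
    g.covTensor (F.liftTensor K α Ψt γ) x u v w =
      mvfderiv (𝓡 m) α x u * g.val x v w
      + ∑ a, ∑ b, (mvfderiv (𝓡 m) (γ a b) x u * (g.val x (K a x) v * g.val x (K b x) w)
          + γ a b x * (g.val x (g.leviCivita (K a) x u) v * g.val x (K b x) w
            + g.val x (K a x) v * g.val x (g.leviCivita (K b) x u) w))
      + (mvfderiv (𝓡 m) (fun y ↦ Real.exp (F.psi Ψt y)) x u *
            (g.val x (F.normal x) v * g.val x (F.normal x) w)
          + Real.exp (F.psi Ψt x) * (g.val x (g.leviCivita F.normal x u) v * g.val x (F.normal x) w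
            + g.val x (F.normal x) v * g.val x (g.leviCivita F.normal x u) w)) := by
  have hKd : ∀ a, SectionDiffAt (K a) x := fun a ↦
    SmoothSectionAt.mdifferentiableAt ((hK a).contMDiffAt Filter.univ_mem)
  have hn := (F.smoothSectionAt_normal x).mdifferentiableAt
  have hE := (F.smoothFunAt_exp_psi hΨ).mdifferentiableAt
  have r1 := (LorentzMetric.tensorRegularAt_val (g := g) x).smul hα.mdifferentiableAt
  have r2 := fun a b ↦ (LorentzMetric.tensorRegularAt_outer (g := g) (hKd a) (hKd b)).smul
      (hγ a b).mdifferentiableAt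
  have r3 := (LorentzMetric.tensorRegularAt_outer (g := g) hn hn).smul hE
  rw [F.liftTensor_eq, LorentzMetric.covTensor_add (r1.add (.sum fun a ↦ .sum fun b ↦ r2 a b)) r3,
    LorentzMetric.covTensor_add r1 (.sum fun a ↦ .sum fun b ↦ r2 a b),
    LorentzMetric.covTensor_sum (fun a ↦ .sum fun b ↦ r2 a b),
    LorentzMetric.covTensor_smul hα.mdifferentiableAt (LorentzMetric.tensorRegularAt_val x),
    LorentzMetric.covTensor_smul hE (LorentzMetric.tensorRegularAt_outer hn hn),
    LorentzMetric.covTensor_outer hn hn, LorentzMetric.covTensor_val]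
  simp only [LorentzMetric.covTensor_sum (r2 _), LorentzMetric.covTensor_smul
    (hγ _ _).mdifferentiableAt (LorentzMetric.tensorRegularAt_outer (hKd _) (hKd _)),
    LorentzMetric.covTensor_outer (hKd _) (hKd _), LorentzMetric.outer_apply, mul_zero, add_zero]

/-- The cubic form of the conformal Killing equation of the lifted tensor. -/
theorem covTensor_liftTensor_diagonal (hK : ∀ a, g.IsConformalKilling (K a))
    (hgram : ∀ x, IsUnit (gram g K x).det)
    (ht : ∀ a x, g.val x (F.normal x) (K a x) = 0)
    (hblock : F.IsBlockDiagonal K) (humbilic : F.IsPartiallyUmbilic K) {U : Set M}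
    (hU : IsOpen U) {α Ψt : M → ℝ} {γ ν : Fin n → Fin n → M → ℝ} (h₁ : F.StepOne K U Ψt)
    (h₂ : F.StepTwo K U Ψt γ ν) {x : M} (hx : x ∈ U) (hα : SmoothFunAt (m := m) α x)
    (u : TangentSpace (𝓡 m) x) :
    g.covTensor (F.liftTensor K α Ψt γ) x u u u =
      F.liftOneForm K α Ψt γ x u * g.val x u u := by
  have hΨ := h₁.smoothFunAt hU hx
  have hγ : ∀ a b, SmoothFunAt (m := m) (γ a b) x := fun a b ↦
    (h₂.1 a b).contMDiffAt (hU.mem_nhds hx)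
  rw [F.covTensor_liftTensor (fun a ↦ (hK a).1) hα hΨ hγ, F.liftOneForm_apply]
  set t := F.proj x u with htdef
  set N := g.val x (F.normal x) u with hN
  set E := Real.exp (F.psi Ψt x) with hEdef
  set χ := F.weightedTrace K x with hχ
  have htan : g.val x (F.normal x) t = 0 := F.val_normal_proj x u
  have hu : u = t + (F.eps * N) • F.normal x := F.proj_add_normal x u
  have hKu : ∀ a, g.val x (K a x) u = g.val x (K a x) t := by
    intro a
    conv_lhs => rw [hu]
    simp [g.symm x (K a x) (F.normal x), ht]
  have hlog : ∀ b, F.sliceDeriv (fun z ↦ Real.log (F.lapse z)) x (K b x) =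
      g.conformalFactor (K b) x := fun b ↦ by
    rw [F.conformalFactor_eq (hK b) (ht b), sliceDeriv, F.proj_of_tangent (ht b x)]
  have hcov : ∀ a, g.val x (g.leviCivita (K a) x u) u = g.conformalFactor (K a) x * g.val x u u :=
    fun a ↦ by linarith [(hK a).val_add_val x u u]
  -- The second fundamental form on `t` together with the acceleration of `n`; `∇n` has no component
  -- along `n`.
  have hnn : g.val x (g.leviCivita F.normal x u) u = g.val x (g.leviCivita F.normal x t) t
      - N * mvfderiv (𝓡 m) (fun y ↦ Real.log (F.lapse y)) x t := by
    conv_lhs => rw [hu]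
    simp only [map_add, map_smul, _root_.add_apply, _root_.smul_apply, smul_eq_mul,
      F.val_leviCivita_normal_normal, F.val_leviCivita_normal_self htan]
    linear_combination (-N * mvfderiv (𝓡 m) (fun y ↦ Real.log (F.lapse y)) x t) * F.eps_mul_eps
  have huu : g.val x u u = g.val x t t + F.eps * N ^ 2 := by
    conv_lhs => rw [hu]
    simp only [map_add, map_smul, _root_.add_apply, _root_.smul_apply, smul_eq_mul,
      F.val_normal_normal, htan, g.symm x t (F.normal x)]
    linear_combination (F.eps * N ^ 2) * F.eps_mul_eps
  have key := F.sum_gramInv_add_normalDeriv hK hgram ht hblock humbilic htan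
  rw [F.mvfderiv_exp_psi hU h₁ hx, sliceDeriv, ← htdef, ← hN, ← hEdef, ← hχ, hnn]
  -- `dγ` gives `N e^Ψ` times the quadratic form of `key`. The derivatives of `𝒦_a` and `𝒦_b` give
  -- conformal factors times `g(u, u)`, and the symmetry of `γ` merges the two resulting sums into
  -- one with factor two.
  have hsum : ∑ a, ∑ b, (mvfderiv (𝓡 m) (γ a b) x u * (g.val x (K a x) u * g.val x (K b x) u)
          + γ a b x * (g.val x (g.leviCivita (K a) x u) u * g.val x (K b x) u
            + g.val x (K a x) u * g.val x (g.leviCivita (K b) x u) u)) =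
      N * E * ∑ a, ∑ b, (2 * χ * gramInv g K a b x + F.normalDeriv (gramInv g K a b) x) *
        g.val x (K a x) t * g.val x (K b x) t
      + (2 * ∑ a, ∑ b, γ a b x * g.val x (K a x) u * g.conformalFactor (K b) x) * g.val x u u := by
    have hswap : ∑ a, ∑ b, γ a b x * g.conformalFactor (K a) x * g.val x (K b x) u =
        ∑ a, ∑ b, γ a b x * g.val x (K a x) u * g.conformalFactor (K b) x := by
      rw [Finset.sum_comm]
      refine Finset.sum_congr rfl fun a _ ↦ Finset.sum_congr rfl fun b _ ↦ ?_
      rw [(h₂.2.2 x hx b a).1]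
      ring
    rw [two_mul (∑ a, ∑ b, γ a b x * g.val x (K a x) u * g.conformalFactor (K b) x)]
    conv_rhs => arg 2; arg 1; arg 1; rw [← hswap]
    simp only [Finset.mul_sum, Finset.sum_mul, ← Finset.sum_add_distrib]
    refine Finset.sum_congr rfl fun a _ ↦ Finset.sum_congr rfl fun b _ ↦ ?_
    rw [h₂.mvfderiv_eq hU (fun a ↦ (hK a).1) hgram h₁ hx, hcov, hcov, hKu a, hKu b]
    ring
  rw [hsum]
  simp only [hlog]
  rw [huu]
  -- The two `𝒟 ln φ` terms, from `d e^Ψ` and from `∇n`, cancel. `key` turns the rest into `2χ e^Ψ N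
  -- (g(t, t) + ε N²)`, and the bracket is `g(u, u)`.
  linear_combination (N * E) * key

theorem liftTensor_comm {U : Set M} {α Ψt : M → ℝ} {γ ν : Fin n → Fin n → M → ℝ}
    (h₂ : F.StepTwo K U Ψt γ ν) {x : M} (hx : x ∈ U) (u v : TangentSpace (𝓡 m) x) :
    F.liftTensor K α Ψt γ x u v = F.liftTensor K α Ψt γ x v u := by
  rw [F.liftTensor_apply, F.liftTensor_apply, g.symm x u v, mul_comm (g.val x (F.normal x) u),
    Finset.sum_comm]
  congr 2
  refine Finset.sum_congr rfl fun a _ ↦ Finset.sum_congr rfl fun b _ ↦ ?_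
  rw [(h₂.2.2 x hx b a).1]
  ring

/-- The lifted tensor satisfies the conformal Killing equation with one-form `liftOneForm`. -/
theorem permSum_covTensor_liftTensor (hK : ∀ a, g.IsConformalKilling (K a))
    (hgram : ∀ x, IsUnit (gram g K x).det)
    (ht : ∀ a x, g.val x (F.normal x) (K a x) = 0)
    (hblock : F.IsBlockDiagonal K) (humbilic : F.IsPartiallyUmbilic K) {U : Set M}
    (hU : IsOpen U) {α Ψt : M → ℝ} {γ ν : Fin n → Fin n → M → ℝ} (h₁ : F.StepOne K U Ψt)
    (h₂ : F.StepTwo K U Ψt γ ν) {x : M} (hx : x ∈ U) (hα : SmoothFunAt (m := m) α x)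
    (u v w : TangentSpace (𝓡 m) x) :
    permSum (g.covTensor (F.liftTensor K α Ψt γ) x) u v w =
      permSum (fun a b c ↦ F.liftOneForm K α Ψt γ x a * g.val x b c) u v w := by
  have hΨ := h₁.smoothFunAt hU hx
  have hγ : ∀ a b, SmoothFunAt (m := m) (γ a b) x := fun a b ↦
    (h₂.1 a b).contMDiffAt (hU.mem_nhds hx)
  have formula := F.covTensor_liftTensor (fun a ↦ (hK a).1) hα hΨ hγ
  refine permSum_eq_of_diagonal ?_ ?_ ?_ ?_ ?_ ?_ (fun u ↦ ?_) u v w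
  · intro u u' v w
    simp only [formula, map_add, _root_.add_apply, add_mul, mul_add, Finset.sum_add_distrib]
    ring
  · intro u v v' w
    simp only [formula, map_add, _root_.add_apply, add_mul, mul_add, Finset.sum_add_distrib]
    ring
  · intro u v w w'
    simp only [formula, map_add, mul_add, Finset.sum_add_distrib]
    ring
  · intro u u' v w
    simp only [map_add]; ring
  · intro u v v' w
    simp only [map_add, _root_.add_apply]; ring
  · intro u v w w'
    simp only [map_add]; ring
  · exact F.covTensor_liftTensor_diagonal hK hgram ht hblock humbilic hU h₁ h₂ hx hα u

theorem conformalOneForm_liftTensor (hK : ∀ a, g.IsConformalKilling (K a))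
    (hgram : ∀ x, IsUnit (gram g K x).det)
    (ht : ∀ a x, g.val x (F.normal x) (K a x) = 0)
    (hblock : F.IsBlockDiagonal K) (humbilic : F.IsPartiallyUmbilic K) {U : Set M}
    (hU : IsOpen U) {α Ψt : M → ℝ} {γ ν : Fin n → Fin n → M → ℝ} (h₁ : F.StepOne K U Ψt)
    (h₂ : F.StepTwo K U Ψt γ ν) {x : M} (hx : x ∈ U) (hα : SmoothFunAt (m := m) α x)
    (w : TangentSpace (𝓡 m) x) :
    g.conformalOneForm (F.liftTensor K α Ψt γ) x w = F.liftOneForm K α Ψt γ x w := by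
  refine LorentzMetric.conformalOneForm_eq
    (F.tensorRegularAt_liftTensor (fun a ↦ (hK a).1) hα (h₁.smoothFunAt hU hx)
      fun a b ↦ (h₂.1 a b).contMDiffAt (hU.mem_nhds hx)) ?_ _
    (F.permSum_covTensor_liftTensor hK hgram ht hblock humbilic hU h₁ h₂ hx hα) w
  filter_upwards [hU.mem_nhds hx] with y hy
  exact F.liftTensor_comm h₂ hy

end SliceFoliation

/-! ### Smoothness of the lifted tensor -/

theorem ContMDiffWithinAt.clm_smulRight {m : ℕ} {M E G : Type*} [TopologicalSpace M]
    [ChartedSpace (EuclideanSpace ℝ (Fin m)) M] [NormedAddCommGroup E] [NormedSpace ℝ E]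
    [NormedAddCommGroup G] [NormedSpace ℝ G] {f : M → E →L[ℝ] ℝ} {h : M → G} {U : Set M} {x : M}
    (hf : ContMDiffWithinAt (𝓡 m) 𝓘(ℝ, E →L[ℝ] ℝ) ∞ f U x)
    (hh : ContMDiffWithinAt (𝓡 m) 𝓘(ℝ, G) ∞ h U x) :
    ContMDiffWithinAt (𝓡 m) 𝓘(ℝ, E →L[ℝ] G) ∞ (fun y ↦ (f y).smulRight (h y)) U x := by
  have h : ContDiff ℝ ∞ fun p : (E →L[ℝ] ℝ) × G ↦ p.1.smulRight p.2 :=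
    ContDiff.smulRight contDiff_fst contDiff_snd
  exact h.contDiffAt.contMDiffAt.comp_contMDiffWithinAt x (hf.prodMk_space hh)

section TensorSmoothness

variable {m : ℕ} {M : Type*} [TopologicalSpace M]
  [ChartedSpace (EuclideanSpace ℝ (Fin m)) M] [IsManifold (𝓡 m) ∞ M]

/-- The product of two smooth one-forms is smooth. -/
theorem contMDiffOn_smulRight {A B : (x : M) → TangentSpace (𝓡 m) x →L[ℝ] ℝ} {U : Set M}
    (hA : ContMDiffOn (𝓡 m) ((𝓡 m).prod 𝓘(ℝ, EuclideanSpace ℝ (Fin m) →L[ℝ] ℝ)) ∞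
      (fun x ↦ TotalSpace.mk' (EuclideanSpace ℝ (Fin m) →L[ℝ] ℝ)
        (E := fun x ↦ TangentSpace (𝓡 m) x →L[ℝ] Bundle.Trivial M ℝ x) x (A x)) U)
    (hB : ContMDiffOn (𝓡 m) ((𝓡 m).prod 𝓘(ℝ, EuclideanSpace ℝ (Fin m) →L[ℝ] ℝ)) ∞
      (fun x ↦ TotalSpace.mk' (EuclideanSpace ℝ (Fin m) →L[ℝ] ℝ)
        (E := fun x ↦ TangentSpace (𝓡 m) x →L[ℝ] Bundle.Trivial M ℝ x) x (B x)) U) :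
    SmoothTwoTensorOn (fun x ↦ (A x).smulRight (B x)) U := by
  intro x hx
  have hA' := (contMDiffWithinAt_hom_bundle _).1 (hA x hx)
  have hB' := (contMDiffWithinAt_hom_bundle _).1 (hB x hx)
  refine (contMDiffWithinAt_hom_bundle _).2 ⟨contMDiffWithinAt_id, ?_⟩
  -- In the trivialization at `x`, the coordinates of the product are the product of the coordinates
  -- of the factors; the rest of the proof checks this near `x`.
  refine (hA'.2.clm_smulRight hB'.2).congr_of_eventuallyEq_of_mem ?_ hx
  have hmem : ∀ᶠ y in 𝓝[U] x, y ∈ (trivializationAt (EuclideanSpace ℝ (Fin m))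
      (TangentSpace (𝓡 m) : M → Type _) x).baseSet :=
    nhdsWithin_le_nhds ((trivializationAt (EuclideanSpace ℝ (Fin m))
      (TangentSpace (𝓡 m) : M → Type _) x).open_baseSet.mem_nhds
      (FiberBundle.mem_baseSet_trivializationAt' x))
  filter_upwards [hmem] with y hy
  ext v w
  have hmem' : y ∈ (trivializationAt (EuclideanSpace ℝ (Fin m) →L[ℝ] ℝ)
      (fun b : M ↦ TangentSpace (𝓡 m) b →L[ℝ] Bundle.Trivial M ℝ b) x).baseSet := by
    rw [hom_trivializationAt_baseSet]
    exact ⟨hy, mem_univ _⟩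
  have e : Trivialization.linearMapAt ℝ (trivializationAt (EuclideanSpace ℝ (Fin m) →L[ℝ] ℝ)
      (fun b : M ↦ TangentSpace (𝓡 m) b →L[ℝ] Bundle.Trivial M ℝ b) x) y (B y) w =
      B y (Trivialization.symmL ℝ (trivializationAt (EuclideanSpace ℝ (Fin m))
        (TangentSpace (𝓡 m) : M → Type _) x) y w) := by
    rw [Trivialization.linearMapAt_apply, if_pos hmem', hom_trivializationAt_apply]
    simp [ContinuousLinearMap.inCoordinates]
  simp only [ContinuousLinearMap.inCoordinates]
  simp
  exact Or.inl e

theorem LorentzMetric.contMDiffOn_flat (g : LorentzMetric m M) {X : VectorFieldOn m M} {U : Set M}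
    (hX : SmoothVectorFieldOn X U) :
    ContMDiffOn (𝓡 m) ((𝓡 m).prod 𝓘(ℝ, EuclideanSpace ℝ (Fin m) →L[ℝ] ℝ)) ∞
      (fun x ↦ TotalSpace.mk' (EuclideanSpace ℝ (Fin m) →L[ℝ] ℝ)
        (E := fun x ↦ TangentSpace (𝓡 m) x →L[ℝ] Bundle.Trivial M ℝ x) x (g.val x (X x))) U := by
  apply ContMDiffOn.clm_bundle_apply (F₁ := EuclideanSpace ℝ (Fin m))
    (F₂ := EuclideanSpace ℝ (Fin m) →L[ℝ] ℝ)
  · exact g.contMDiff.contMDiffOn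
  · exact hX

theorem LorentzMetric.smoothTwoTensorOn_outer (g : LorentzMetric m M) {X Y : VectorFieldOn m M}
    {U : Set M} (hX : SmoothVectorFieldOn X U) (hY : SmoothVectorFieldOn Y U) :
    SmoothTwoTensorOn (g.outer X Y) U := by
  have h := contMDiffOn_smulRight (A := fun x ↦ g.val x (X x)) (B := fun x ↦ g.val x (Y x))
    (g.contMDiffOn_flat hX) (g.contMDiffOn_flat hY)
  exact h

theorem SmoothTwoTensorOn.add {S T : TwoTensorField m M} {U : Set M}
    (hS : SmoothTwoTensorOn S U) (hT : SmoothTwoTensorOn T U) : SmoothTwoTensorOn (S + T) U :=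
  ContMDiffOn.add_section hS hT

theorem SmoothTwoTensorOn.smul {f : M → ℝ} {T : TwoTensorField m M} {U : Set M}
    (hT : SmoothTwoTensorOn T U) (hf : ContMDiffOn (𝓡 m) 𝓘(ℝ, ℝ) ∞ f U) :
    SmoothTwoTensorOn (fun y ↦ f y • T y) U :=
  ContMDiffOn.smul_section hf hT

theorem SmoothTwoTensorOn.sum {ι : Type*} [Fintype ι] {T : ι → TwoTensorField m M} {U : Set M}
    (hT : ∀ i, SmoothTwoTensorOn (T i) U) : SmoothTwoTensorOn (∑ i, T i) U := by
  rw [show ∑ i, T i = fun x ↦ ∑ i, T i x from funext fun x ↦ Finset.sum_apply x _ _]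
  exact ContMDiffOn.sum_section fun i _ ↦ hT i

theorem SliceFoliation.smoothTwoTensorOn_liftTensor {g : LorentzMetric m M} (F : SliceFoliation g)
    {n : ℕ} {K : Fin n → VectorFieldOn m M} (hK : ∀ a, SmoothVectorFieldOn (K a) univ) {U : Set M}
    {α Ψt : M → ℝ} {γ : Fin n → Fin n → M → ℝ} (hα : ContMDiffOn (𝓡 m) 𝓘(ℝ, ℝ) ∞ α U)
    (hΨ : ContMDiffOn (𝓡 m) 𝓘(ℝ, ℝ) ∞ Ψt U)
    (hγ : ∀ a b, ContMDiffOn (𝓡 m) 𝓘(ℝ, ℝ) ∞ (γ a b) U) :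
    SmoothTwoTensorOn (F.liftTensor K α Ψt γ) U := by
  have hKU : ∀ a, SmoothVectorFieldOn (K a) U := fun a ↦ (hK a).mono (subset_univ U)
  have hn : SmoothVectorFieldOn F.normal U :=
    fun x _ ↦ (F.smoothSectionAt_normal x).contMDiffWithinAt
  have hE : ContMDiffOn (𝓡 m) 𝓘(ℝ, ℝ) ∞ (fun y ↦ Real.exp (F.psi Ψt y)) U := by
    intro x hx
    rw [show F.psi Ψt = _ from funext (F.psi_eq Ψt)]
    exact Real.contDiff_exp.contDiffAt.contMDiffAt.comp_contMDiffWithinAt x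
      ((contMDiffAt_const.mul (F.smoothFunAt_log_lapse x)).contMDiffWithinAt.add (hΨ x hx))
  rw [F.liftTensor_eq]
  have hg : SmoothTwoTensorOn g.val U := g.contMDiff.contMDiffOn
  exact ((hg.smul hα).add (.sum fun a ↦ .sum fun b ↦
    (g.smoothTwoTensorOn_outer (hKU a) (hKU b)).smul (hγ a b))).add
    ((g.smoothTwoTensorOn_outer hn hn).smul hE)

end TensorSmoothness

/-! ### Straightening of the foliation function and flow boxes -/

/-- A smooth function without critical point at `x₀` becomes linear in suitable coordinates. -/
theorem exists_straightening {E : Type*} [NormedAddCommGroup E] [NormedSpace ℝ E] [CompleteSpace E]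
    {f : E → ℝ} {W : Set E} (hW : IsOpen W) (hf : ContDiffOn ℝ ∞ f W) {x₀ : E} (hx₀ : x₀ ∈ W)
    (hD : fderiv ℝ f x₀ ≠ 0) :
    ∃ (τ : OpenPartialHomeomorph E E) (l : E →L[ℝ] ℝ) (e : E), l e = 1 ∧ x₀ ∈ τ.source ∧
      τ.source ⊆ W ∧ ContDiffOn ℝ ∞ τ.symm τ.target ∧ ∀ z ∈ τ.target, f (τ.symm z) = l z := by
  obtain ⟨v, hv⟩ : ∃ v, fderiv ℝ f x₀ v ≠ 0 := by
    by_contra! h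
    exact hD (ContinuousLinearMap.ext h)
  set l := fderiv ℝ f x₀ with hl
  set e := (l v)⁻¹ • v with he
  have hle : l e = 1 := by simp [he, hv]
  -- `T` moves `z` along `e` by just the amount that makes `l (T z) = f z`. Since `l` is the
  -- derivative of `f` at `x₀`, the derivative of `T` there is the identity and the inverse function
  -- theorem applies.
  let T : E → E := fun z ↦ z + (f z - l z) • e
  have hlT : ∀ z, l (T z) = f z := fun z ↦ by simp [T, hle]
  have hTW : ContDiffOn ℝ ∞ T W :=
    contDiffOn_id.add ((hf.sub l.contDiff.contDiffOn).smul contDiffOn_const)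
  have hfx : DifferentiableAt ℝ f x₀ := (hf.contDiffAt (hW.mem_nhds hx₀)).differentiableAt (by simp)
  have hT0 : HasFDerivAt T ((ContinuousLinearEquiv.refl ℝ E : E ≃L[ℝ] E) : E →L[ℝ] E) x₀ := by
    have h := (hasFDerivAt_id x₀).add
      ((hfx.hasFDerivAt.sub l.hasFDerivAt).smul (hasFDerivAt_const e x₀))
    convert! h using 1
    ext w
    simp [hl]
  have hTx : ContDiffAt ℝ ∞ T x₀ := hTW.contDiffAt (hW.mem_nhds hx₀)
  let τ₀ := hTx.toOpenPartialHomeomorph T hT0 (by simp)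
  -- The inverse has to be smooth on the whole target, not only at the image of `x₀`. So the domain
  -- is cut down to the open set of points of `W` at which the derivative of `T` is invertible.
  have hS : IsOpen (W ∩ fderiv ℝ T ⁻¹' range ((↑) : (E ≃L[ℝ] E) → E →L[ℝ] E)) :=
    (hTW.continuousOn_fderiv_of_isOpen hW (by simp)).isOpen_inter_preimage hW
      ContinuousLinearEquiv.isOpen
  refine ⟨τ₀.restrOpen _ hS, l, e, hle, ⟨?_, hx₀, ?_⟩, fun z hz ↦ hz.2.1, fun z hz ↦ ?_,
    fun z hz ↦ ?_⟩
  · exact hTx.mem_toOpenPartialHomeomorph_source hT0 (by simp)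
  · exact ⟨ContinuousLinearEquiv.refl ℝ E, hT0.fderiv.symm⟩
  · have hz' := (τ₀.restrOpen _ hS).map_target hz
    obtain ⟨-, hzW, A, hA⟩ := hz'
    have hc := hTW.contDiffAt (hW.mem_nhds hzW)
    refine ((τ₀.restrOpen _ hS).contDiffAt_symm (f₀' := A) hz ?_ hc).contDiffWithinAt
    rw [hA]
    exact (hc.differentiableAt (by simp)).hasFDerivAt
  · have h := (τ₀.restrOpen _ hS).right_inv hz
    have h2 : T ((τ₀.restrOpen _ hS).symm z) = z := h
    rw [← hlT, h2]

section FlowBoxes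

variable {m : ℕ} {M : Type*} [TopologicalSpace M]
  [ChartedSpace (EuclideanSpace ℝ (Fin m)) M]

/-- A smooth parametrization of an open subset of `M` by a ball, in which the function `Φ` is
linear. -/
structure FlowBox (Φ : M → ℝ) where
  param : EuclideanSpace ℝ (Fin m) → M
  center : EuclideanSpace ℝ (Fin m)
  radius : ℝ
  radius_pos : 0 < radius
  form : EuclideanSpace ℝ (Fin m) →L[ℝ] ℝ
  dir : EuclideanSpace ℝ (Fin m)
  form_dir : form dir = 1
  contMDiffOn : ContMDiffOn (𝓡 m) (𝓡 m) ∞ param (Metric.ball center radius)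
  isOpen_image : IsOpen (param '' Metric.ball center radius)
  apply_param : ∀ z ∈ Metric.ball center radius, Φ (param z) = form z

namespace FlowBox

variable {Φ : M → ℝ}

/-- The open subset of `M` covered by a flow box. -/
def region (B : FlowBox (m := m) Φ) : Set M := B.param '' Metric.ball B.center B.radius

theorem center_mem (B : FlowBox (m := m) Φ) : B.center ∈ Metric.ball B.center B.radius :=
  Metric.mem_ball_self B.radius_pos

/-- Read `Φ` in a chart at `p`, straighten it there, and keep a ball in the target that is mapped
into `O`. -/
theorem exists_subset [IsManifold (𝓡 m) ∞ M] (hΦ : ContMDiff (𝓡 m) 𝓘(ℝ, ℝ) ∞ Φ) {p : M}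
    {v : TangentSpace (𝓡 m) p} (hv : mvfderiv (𝓡 m) Φ p v ≠ 0) {O : Set M} (hO : IsOpen O)
    (hp : p ∈ O) : ∃ B : FlowBox (m := m) Φ, B.param B.center = p ∧ B.region ⊆ O := by
  set c := extChartAt (𝓡 m) p with hc
  have hW : IsOpen (c.target ∩ c.symm ⁻¹' O) :=
    (continuousOn_extChartAt_symm p).isOpen_inter_preimage (isOpen_extChartAt_target p) hO
  have hcp : c p ∈ c.target ∩ c.symm ⁻¹' O :=
    ⟨mem_extChartAt_target p, by simpa [hc] using hp⟩
  have hcs : ContMDiffOn (𝓡 m) (𝓡 m) ∞ c.symm c.target := contMDiffOn_extChartAt_symm p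
  have hf : ContDiffOn ℝ ∞ (Φ ∘ c.symm) (c.target ∩ c.symm ⁻¹' O) :=
    (hΦ.comp_contMDiffOn (hcs.mono inter_subset_left)).contDiffOn
  have hD : fderiv ℝ (Φ ∘ c.symm) (c p) ≠ 0 := by
    intro h0
    apply hv
    have h1 := ((hΦ p).mdifferentiableAt (by simp)).mfderiv
    have h2 : writtenInExtChartAt (𝓡 m) 𝓘(ℝ, ℝ) p Φ = Φ ∘ c.symm := by
      ext z
      simp only [writtenInExtChartAt, extChartAt_model_space_eq_id, Function.comp_apply,
        PartialEquiv.refl_coe, id, hc]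
    rw [h2, ModelWithCorners.range_eq_univ, fderivWithin_univ, h0] at h1
    simp only [mvfderiv, h1]
    rfl
  obtain ⟨τ, l, e, hle, hcτ, hτW, hτ, hτl⟩ := exists_straightening hW hf hcp hD
  obtain ⟨r, hr, hball⟩ := Metric.isOpen_iff.1 τ.open_target (τ (c p)) (τ.map_source hcτ)
  have hmem : ∀ z ∈ Metric.ball (τ (c p)) r, τ.symm z ∈ c.target ∩ c.symm ⁻¹' O :=
    fun z hz ↦ hτW (τ.map_target (hball hz))
  refine ⟨⟨c.symm ∘ τ.symm, τ (c p), r, hr, l, e, hle, ?_, ?_, fun z hz ↦ hτl z (hball hz)⟩,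
    ?_, ?_⟩
  · exact hcs.comp (hτ.mono hball).contMDiffOn fun z hz ↦ (hmem z hz).1
  · rw [image_comp, c.symm_image_eq_source_inter_preimage]
    · exact isOpen_extChartAt_preimage' p
        (τ.isOpen_image_symm_of_subset_target Metric.isOpen_ball hball)
    · rintro _ ⟨z, hz, rfl⟩
      exact (hmem z hz).1
  · change c.symm (τ.symm (τ (c p))) = p
    rw [τ.left_inv hcτ]
    exact extChartAt_to_inv p
  · rintro _ ⟨z, hz, rfl⟩
    exact (hmem z hz).2

theorem fderiv_comp_param (B : FlowBox (m := m) Φ) {f : M → ℝ} {z : EuclideanSpace ℝ (Fin m)}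
    (hz : z ∈ Metric.ball B.center B.radius)
    (hf : MDifferentiableAt (𝓡 m) 𝓘(ℝ, ℝ) f (B.param z)) (w : EuclideanSpace ℝ (Fin m)) :
    HasFDerivAt (f ∘ B.param) (fderiv ℝ (f ∘ B.param) z) z ∧ fderiv ℝ (f ∘ B.param) z w =
      mvfderiv (𝓡 m) f (B.param z) (mfderiv (𝓡 m) (𝓡 m) B.param z w) := by
  have hp : MDifferentiableAt (𝓡 m) (𝓡 m) B.param z :=
    (B.contMDiffOn.contMDiffAt (Metric.isOpen_ball.mem_nhds hz)).mdifferentiableAt (by simp)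
  have h := mfderiv_comp z hf hp
  rw [mfderiv_eq_fderiv] at h
  refine ⟨(hf.comp z hp).differentiableAt.hasFDerivAt, ?_⟩
  rw [h]
  rfl

/-- A function whose differential vanishes along the level sets of `Φ` is constant on the level
sets in a flow box. -/
theorem apply_param_eq (B : FlowBox (m := m) Φ) {f : M → ℝ}
    (hΦ : ContMDiff (𝓡 m) 𝓘(ℝ, ℝ) ∞ Φ)
    (hf : ∀ x ∈ B.region, MDifferentiableAt (𝓡 m) 𝓘(ℝ, ℝ) f x)
    (hf0 : ∀ x ∈ B.region, ∀ v, mvfderiv (𝓡 m) Φ x v = 0 → mvfderiv (𝓡 m) f x v = 0)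
    {z w : EuclideanSpace ℝ (Fin m)} (hz : z ∈ Metric.ball B.center B.radius)
    (hw : w ∈ Metric.ball B.center B.radius) (hzw : B.form z = B.form w) :
    f (B.param z) = f (B.param w) := by
  have hmem : ∀ t ∈ Icc (0 : ℝ) 1, AffineMap.lineMap z w t ∈ Metric.ball B.center B.radius :=
    fun t ht ↦ (convex_ball _ _).lineMap_mem hz hw ht
  -- The linear form takes equal values at `z` and `w`, so the segment between them stays in a level
  -- set of `Φ`, and its velocity is annihilated by `dΦ`, hence by `df`.
  have hd : ∀ t ∈ Icc (0 : ℝ) 1,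
      HasDerivAt (fun t : ℝ ↦ f (B.param (AffineMap.lineMap z w t))) 0 t := by
    intro t ht
    have hzt := hmem t ht
    have hx : B.param (AffineMap.lineMap z w t) ∈ B.region := mem_image_of_mem _ hzt
    have h1 := B.fderiv_comp_param hzt (hf _ hx) (w - z)
    have h2 := B.fderiv_comp_param hzt ((hΦ _).mdifferentiableAt (by simp)) (w - z)
    have h3 : fderiv ℝ (Φ ∘ B.param) (AffineMap.lineMap z w t) = B.form := by
      have : Φ ∘ B.param =ᶠ[𝓝 (AffineMap.lineMap z w t)] B.form := by
        filter_upwards [Metric.isOpen_ball.mem_nhds hzt] with y hy using B.apply_param y hy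
      rw [this.fderiv_eq, B.form.fderiv]
    rw [h3, map_sub, hzw, sub_self] at h2
    have h4 := h1.1.comp_hasDerivAt t (AffineMap.hasDerivAt_lineMap (a := z) (b := w) (x := t))
    rwa [h1.2, hf0 _ hx _ h2.2.symm] at h4
  have h := constant_of_has_deriv_right_zero
    (fun t ht ↦ (hd t ht).continuousAt.continuousWithinAt)
    (fun t ht ↦ (hd t (Ico_subset_Icc_self ht)).hasDerivWithinAt) 1 (by simp)
  simpa using h.symm

end FlowBox

end FlowBoxes

/-! ### Functions constant along the slices, and primitives with respect to `Φ` -/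

/-- Every smooth function on an open set of reals has a smooth antiderivative. -/
theorem exists_antiderivative {S : Set ℝ} (hS : IsOpen S) {a : ℝ → ℝ} (ha : ContDiffOn ℝ ∞ a S) :
    ∃ f : ℝ → ℝ, ContDiffOn ℝ ∞ f S ∧ ∀ t ∈ S, HasDerivAt f (a t) t := by
  classical
  -- `S` may have several components, and each gets its own base point of integration. The base
  -- point is locally constant, so it does not affect the derivative.
  let f : ℝ → ℝ := fun t ↦ if h : t ∈ S then ∫ s in (ordConnectedProj S ⟨t, h⟩)..t, a s else 0
  have hf : ∀ t ∈ S, HasDerivAt f (a t) t := by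
    intro t ht
    obtain ⟨r, hr, hball⟩ := Metric.isOpen_iff.1 hS t ht
    set q := ordConnectedProj S ⟨t, ht⟩ with hq
    have hqt : uIcc q t ⊆ S := mem_ordConnectedComponent.1
      (mem_ordConnectedComponent_ordConnectedProj S ⟨t, ht⟩)
    have hev : f =ᶠ[𝓝 t] fun u ↦ ∫ s in q..u, a s := by
      filter_upwards [Metric.ball_mem_nhds t hr] with u hu
      have hsub : uIcc t u ⊆ S :=
        ((convex_ball t r).ordConnected.uIcc_subset (Metric.mem_ball_self hr) hu).trans hball
      simp only [f, dif_pos (hball hu)]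
      rw [hq, ordConnectedProj_eq (x := ⟨t, ht⟩) (y := ⟨u, hball hu⟩) |>.2 hsub]
    refine HasDerivAt.congr_of_eventuallyEq ?_ hev
    exact intervalIntegral.integral_hasDerivAt_right
      (ha.continuousOn.mono hqt).intervalIntegrable
      (ha.continuousOn.stronglyMeasurableAtFilter hS t ht)
      (ha.continuousOn.continuousAt (hS.mem_nhds ht))
  refine ⟨f, ?_, hf⟩
  rw [contDiffOn_infty_iff_deriv_of_isOpen hS]
  exact ⟨fun t ht ↦ (hf t ht).differentiableAt.differentiableWithinAt,
    ha.congr fun t ht ↦ (hf t ht).deriv⟩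

namespace SliceFoliation

variable {m : ℕ} {M : Type*} [TopologicalSpace M]
  [ChartedSpace (EuclideanSpace ℝ (Fin m)) M] [IsManifold (𝓡 m) ∞ M]
  {g : LorentzMetric m M} (F : SliceFoliation g)

theorem exists_flowBox {O : Set M} (hO : IsOpen O) {p : M} (hp : p ∈ O) :
    ∃ B : FlowBox (m := m) F.toFun, B.param B.center = p ∧ B.region ⊆ O := by
  refine FlowBox.exists_subset F.contMDiff (v := F.normal p) ?_ hO hp
  rw [F.mvfderiv_toFun_normal]
  have h1 := F.orient_mul_orient
  have h2 := F.eps_mul_eps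
  have h3 := F.lapse_pos p
  refine mul_ne_zero (mul_ne_zero ?_ ?_) (inv_ne_zero h3.ne') <;> intro h <;> simp [h] at h1 h2

theorem mvfderiv_eq_zero_of_sliceDeriv {f : M → ℝ} {x : M} (h : ∀ v, F.sliceDeriv f x v = 0)
    {v : TangentSpace (𝓡 m) x} (hv : mvfderiv (𝓡 m) F.toFun x v = 0) :
    mvfderiv (𝓡 m) f x v = 0 := by
  have h1 := h v
  rwa [sliceDeriv, F.proj_of_tangent (F.mvfderiv_toFun_eq_zero_iff.1 hv)] at h1

/-- A function with vanishing slice derivative is constant on connected subsets of the slices. -/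
theorem eq_of_isPreconnected {U C : Set M} (hU : IsOpen U) {f : M → ℝ}
    (hf : ContMDiffOn (𝓡 m) 𝓘(ℝ, ℝ) ∞ f U) (hf0 : ∀ x ∈ U, ∀ v, F.sliceDeriv f x v = 0) {s : ℝ}
    (hC : IsPreconnected C) (hCU : C ⊆ U ∩ F.slice s) {p q : M} (hp : p ∈ C) (hq : q ∈ C) :
    f p = f q := by
  -- Connectedness is only available for `C`, not for its intersection with a flow box. So the flow
  -- box is used for local constancy: nearby points of `C` have the same value of `Φ` as `x`.
  have hloc : IsLocallyConstant fun x : C ↦ f x := by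
    rw [IsLocallyConstant.iff_eventually_eq]
    rintro ⟨x, hx⟩
    obtain ⟨B, hBx, hBU⟩ := F.exists_flowBox hU (hCU hx).1
    have hxB : x ∈ B.region := ⟨_, B.center_mem, hBx⟩
    filter_upwards [continuous_subtype_val.continuousAt.preimage_mem_nhds
      (B.isOpen_image.mem_nhds hxB)]
    rintro ⟨y, hy⟩ ⟨z, hz, rfl⟩
    have key := B.apply_param_eq F.contMDiff
      (fun x hx ↦ (hf.contMDiffAt (hU.mem_nhds (hBU hx))).mdifferentiableAt (by simp))
      (fun x hx v ↦ F.mvfderiv_eq_zero_of_sliceDeriv (hf0 x (hBU hx))) hz B.center_mem ?_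
    · simpa [hBx] using key
    · rw [← B.apply_param z hz, ← B.apply_param _ B.center_mem, hBx]
      exact (hCU hy).2.trans (hCU hx).2.symm
  have := isPreconnected_iff_preconnectedSpace.1 hC
  exact hloc.apply_eq_of_isPreconnected isPreconnected_univ (x := ⟨p, hp⟩) (y := ⟨q, hq⟩)
    (mem_univ _) (mem_univ _)

/-- A function with vanishing slice derivative is a function of the foliation function, if the
slices are connected. -/
theorem exists_eq_comp {U : Set M} (hU : IsOpen U) (hconn : ∀ s, IsPreconnected (U ∩ F.slice s))
    {A : M → ℝ} (hA : ContMDiffOn (𝓡 m) 𝓘(ℝ, ℝ) ∞ A U)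
    (hA0 : ∀ x ∈ U, ∀ v, F.sliceDeriv A x v = 0) :
    ∃ a : ℝ → ℝ, IsOpen (F.toFun '' U) ∧ ContDiffOn ℝ ∞ a (F.toFun '' U) ∧
      ∀ x ∈ U, A x = a (F.toFun x) := by
  have hex : ∀ t, ∃ c, ∀ x ∈ U, F.toFun x = t → A x = c := by
    intro t
    by_cases h : ∃ y ∈ U, F.toFun y = t
    · obtain ⟨y, hy, rfl⟩ := h
      exact ⟨A y, fun x hx hxy ↦ F.eq_of_isPreconnected hU hA hA0 (hconn (F.toFun y)) subset_rfl
        ⟨hx, hxy⟩ ⟨hy, rfl⟩⟩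
    · push Not at h
      exact ⟨0, fun x hx hxt ↦ absurd hxt (h x hx)⟩
  choose a ha using hex
  have hloc : ∀ p ∈ U, F.toFun '' U ∈ 𝓝 (F.toFun p) ∧ ContDiffAt ℝ ∞ a (F.toFun p) := by
    intro p hp
    obtain ⟨B, hBp, hBU⟩ := F.exists_flowBox hU hp
    set t₀ := F.toFun p with ht₀
    -- A curve transversal to the slices on which `Φ` is the parameter `t`. It shows that the image
    -- of `U` contains a neighbourhood of `t₀`, and that near `t₀` the function `a` is `A` along a
    -- smooth curve.
    let c : ℝ → EuclideanSpace ℝ (Fin m) := fun t ↦ B.center + (t - t₀) • B.dir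
    have hc : ContDiff ℝ ∞ c :=
      contDiff_const.add ((contDiff_id.sub contDiff_const).smul contDiff_const)
    have hct₀ : c t₀ = B.center := by simp [c]
    have hcB : ∀ᶠ t in 𝓝 t₀, c t ∈ Metric.ball B.center B.radius :=
      hc.continuous.continuousAt.preimage_mem_nhds
        (Metric.isOpen_ball.mem_nhds (by rw [hct₀]; exact B.center_mem))
    have hform : B.form B.center = t₀ := by
      rw [← B.apply_param _ B.center_mem, hBp]
    have hct : ∀ t, c t ∈ Metric.ball B.center B.radius → F.toFun (B.param (c t)) = t := by
      intro t ht
      rw [B.apply_param _ ht]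
      simp [c, hform, B.form_dir]
    refine ⟨?_, ?_⟩
    · filter_upwards [hcB] with t ht using ⟨_, hBU ⟨_, ht, rfl⟩, hct t ht⟩
    · have hsm : ContMDiffAt 𝓘(ℝ, ℝ) 𝓘(ℝ, ℝ) ∞ (fun t ↦ A (B.param (c t))) t₀ := by
        have h1 : ContMDiffAt (𝓡 m) 𝓘(ℝ, ℝ) ∞ A (B.param (c t₀)) := by
          rw [hct₀, hBp]
          exact hA.contMDiffAt (hU.mem_nhds hp)
        have h2 : ContMDiffAt (𝓡 m) (𝓡 m) ∞ B.param (c t₀) := by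
          rw [hct₀]
          exact B.contMDiffOn.contMDiffAt (Metric.isOpen_ball.mem_nhds B.center_mem)
        exact (h1.comp _ h2).comp t₀ hc.contMDiff.contMDiffAt
      refine hsm.contDiffAt.congr_of_eventuallyEq ?_
      filter_upwards [hcB] with t ht using (ha t _ (hBU ⟨_, ht, rfl⟩) (hct t ht)).symm
  refine ⟨a, isOpen_iff_mem_nhds.2 ?_, ?_, fun x hx ↦ ha _ x hx rfl⟩
  · rintro _ ⟨p, hp, rfl⟩
    exact (hloc p hp).1
  · rintro _ ⟨p, hp, rfl⟩
    exact (hloc p hp).2.contDiffWithinAt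

/-- If the slices are connected and `𝒟 A = 0`, the equation `d f = A dΦ` can be solved. -/
theorem exists_primitive {U : Set M} (hU : IsOpen U)
    (hconn : ∀ s, IsPreconnected (U ∩ F.slice s))
    {A : M → ℝ} (hA : ContMDiffOn (𝓡 m) 𝓘(ℝ, ℝ) ∞ A U)
    (hA0 : ∀ x ∈ U, ∀ v, F.sliceDeriv A x v = 0) :
    ∃ f : M → ℝ, ContMDiffOn (𝓡 m) 𝓘(ℝ, ℝ) ∞ f U ∧ ∀ x ∈ U, ∀ v,
      mvfderiv (𝓡 m) f x v = A x * mvfderiv (𝓡 m) F.toFun x v := by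
  obtain ⟨a, hS, ha, haA⟩ := F.exists_eq_comp hU hconn hA hA0
  obtain ⟨f, hf, hfa⟩ := exists_antiderivative hS ha
  refine ⟨fun x ↦ f (F.toFun x), ?_, fun x hx v ↦ ?_⟩
  · exact hf.contMDiffOn.comp F.contMDiff.contMDiffOn fun x hx ↦ mem_image_of_mem _ hx
  · rw [mvfderiv_real_comp (hfa _ (mem_image_of_mem _ hx))
      ((F.contMDiff x).mdifferentiableAt (by simp)), haA x hx]

/-- The slices in a flow box are connected. -/
theorem isPreconnected_region_inter_slice (B : FlowBox (m := m) F.toFun) (s : ℝ) :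
    IsPreconnected (B.region ∩ F.slice s) := by
  -- In a flow box a slice is the image of the intersection of a ball with a level set of a linear
  -- form, a convex set.
  have h : B.region ∩ F.slice s =
      B.param '' (Metric.ball B.center B.radius ∩ B.form ⁻¹' {s}) := by
    ext x
    constructor
    · rintro ⟨⟨z, hz, rfl⟩, hs⟩
      exact ⟨z, ⟨hz, by rw [mem_preimage, ← B.apply_param z hz]; exact hs⟩, rfl⟩
    · rintro ⟨z, ⟨hz, hs⟩, rfl⟩
      exact ⟨⟨z, hz, rfl⟩, (B.apply_param z hz).trans hs⟩
  rw [h]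
  refine IsPreconnected.image ?_ _ (B.contMDiffOn.continuousOn.mono inter_subset_left)
  exact ((convex_ball _ _).inter
    ((convex_singleton s).linear_preimage B.form.toLinearMap)).isPreconnected

end SliceFoliation

/-! ### Solvability of steps one and two -/

section StepsSolvable

variable {m : ℕ} {M : Type*} [TopologicalSpace M]
  [ChartedSpace (EuclideanSpace ℝ (Fin m)) M] [IsManifold (𝓡 m) ∞ M]
  {g : LorentzMetric m M}

/-- By the Koszul formula this is smoothness of the functions `g(∇_X Y, Z)`, the only form in which
smoothness of the connection is needed. -/
theorem LorentzMetric.smoothFunAt_koszul (g : LorentzMetric m M) {X Y Z : VectorFieldOn m M} {x : M}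
    (hX : SmoothSectionAt X x) (hY : SmoothSectionAt Y x) (hZ : SmoothSectionAt Z x) :
    SmoothFunAt (m := m) (g.koszul Y X Z) x := by
  have h1 := (g.smoothFunAt_pair hY hZ).mvfderiv_apply hX
  have h2 := (g.smoothFunAt_pair hX hZ).mvfderiv_apply hY
  have h3 := (g.smoothFunAt_pair hX hY).mvfderiv_apply hZ
  have h4 := g.smoothFunAt_pair (hX.mlieBracket hY) hZ
  have h5 := g.smoothFunAt_pair (hX.mlieBracket hZ) hY
  have h6 := g.smoothFunAt_pair (hY.mlieBracket hZ) hX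
  exact contMDiffAt_const.mul (((((h1.add h2).sub h3).add h4).sub h5).sub h6)

theorem LorentzMetric.koszul_eq (g : LorentzMetric m M) {X Y Z : VectorFieldOn m M} {x : M}
    (hX : SectionDiffAt X x) (hY : SectionDiffAt Y x) (hZ : SectionDiffAt Z x) :
    g.val x (g.leviCivita Y x (X x)) (Z x) = g.koszul Y X Z x :=
  g.val_leviCivitaAux hY hX hZ

theorem SmoothSectionAt.sum {ι : Type*} [Fintype ι] {X : ι → VectorFieldOn m M} {x : M}
    (hX : ∀ i, SmoothSectionAt (X i) x) : SmoothSectionAt (fun y ↦ ∑ i, X i y) x :=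
  ContMDiffAt.sum_section fun i _ ↦ hX i

namespace SliceFoliation

variable (F : SliceFoliation g) {n : ℕ} {K : Fin n → VectorFieldOn m M}

theorem smoothSectionAt_proj {X : VectorFieldOn m M} {x : M} (hX : SmoothSectionAt X x) :
    SmoothSectionAt (fun y ↦ F.proj y (X y)) x := by
  have hn := F.smoothSectionAt_normal x
  have hf : SmoothFunAt (m := m) (fun y ↦ F.eps * g.pair F.normal X y) x :=
    contMDiffAt_const.mul (g.smoothFunAt_pair hn hX)
  exact hX.sub (SmoothSectionAt.smul hf hn)

theorem smoothSectionAt_complProj (hK : ∀ a, SmoothVectorFieldOn (K a) univ)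
    (hgram : ∀ x, IsUnit (gram g K x).det) {X : VectorFieldOn m M} {x : M}
    (hX : SmoothSectionAt X x) : SmoothSectionAt (fun y ↦ F.complProj K y (X y)) x := by
  have hKx : ∀ a, SmoothSectionAt (K a) x := fun a ↦ (hK a).contMDiffAt Filter.univ_mem
  have hf : ∀ a b, SmoothFunAt (m := m) (fun y ↦ gramInv g K a b y * g.pair (K a) X y) x :=
    fun a b ↦ (smoothFunAt_gramInv hK hgram a b x).mul (g.smoothFunAt_pair (hKx a) hX)
  exact (F.smoothSectionAt_proj hX).sub
    (SmoothSectionAt.sum fun a ↦ SmoothSectionAt.sum fun b ↦ SmoothSectionAt.smul (hf a b) (hKx b))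

theorem complProj_of_isComplementary {x : M} {v : TangentSpace (𝓡 m) x}
    (hv : F.IsComplementary K x v) : F.complProj K x v = v := by
  simp [complProj, F.proj_of_tangent hv.1, hv.2]

/-- The complementary directions contain a vector which is not null. -/
theorem exists_isComplementary_ne_zero (hn : n + 2 ≤ m) (hgram : ∀ x, IsUnit (gram g K x).det)
    (ht : ∀ a x, g.val x (F.normal x) (K a x) = 0) (x : M) :
    ∃ v, F.IsComplementary K x v ∧ g.val x v v ≠ 0 := by
  by_contra! h
  let L : TangentSpace (𝓡 m) x →ₗ[ℝ] ℝ × (Fin n → ℝ) :=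
    (g.val x (F.normal x)).toLinearMap.prod (LinearMap.pi fun a ↦ (g.val x (K a x)).toLinearMap)
  -- Being complementary means `n + 1` linear conditions in dimension `m ≥ n + 2`.
  have hlt : Module.finrank ℝ (ℝ × (Fin n → ℝ)) <
      Module.finrank ℝ (EuclideanSpace ℝ (Fin m)) := by
    simp
    omega
  have hfd : FiniteDimensional ℝ (TangentSpace (𝓡 m) x) :=
    inferInstanceAs (FiniteDimensional ℝ (EuclideanSpace ℝ (Fin m)))
  obtain ⟨v, hvL, hv⟩ := Submodule.exists_mem_ne_zero_of_ne_bot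
    (LinearMap.ker_ne_bot_of_finrank_lt (f := L) hlt)
  have hvc : F.IsComplementary K x v := by
    have h1 : L v = 0 := hvL
    exact ⟨congrArg Prod.fst h1, fun a ↦ congrFun (congrArg Prod.snd h1) a⟩
  -- If every complementary vector is null, polarization makes them mutually orthogonal. But `v`
  -- pairs with any `w` as with the complementary projection of `w`, so `v` would be orthogonal to
  -- everything.
  refine hv (g.nondegenerate x v fun w ↦ ?_)
  have hw := F.isComplementary_complProj hgram ht x w
  set w' := F.complProj K x w with hw'
  have h1 : g.val x v w' = 0 := by
    have h2 := h (v + w') ⟨by simp [hvc.1, hw.1], fun a ↦ by simp [hvc.2, hw.2]⟩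
    simp only [map_add, _root_.add_apply, h v hvc, h w' hw, g.symm x w' v] at h2
    linarith
  have h3 : g.val x v w' = g.val x v w := by
    simp [hw', complProj, proj, g.symm x v (F.normal x), g.symm x v (K _ x), hvc.1, hvc.2]
  rw [← h3, h1]

/-- The definition as a metric trace uses a chart that depends on the point, so it does not show
smoothness. By umbilicity, `χ` is the quotient `g(∇_X n, X) / g(X, X)` for a smooth complementary
field `X` that is not null near `x`. -/
theorem smoothFunAt_weightedTrace (hn : n + 2 ≤ m) (hK : ∀ a, SmoothVectorFieldOn (K a) univ)
    (hgram : ∀ x, IsUnit (gram g K x).det) (ht : ∀ a x, g.val x (F.normal x) (K a x) = 0)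
    (humbilic : F.IsPartiallyUmbilic K) (x : M) :
    SmoothFunAt (m := m) (F.weightedTrace K) x := by
  obtain ⟨v, hv, hvv⟩ := F.exists_isComplementary_ne_zero hn hgram ht x
  let X : VectorFieldOn m M := fun y ↦
    F.complProj K y (FiberBundle.extend (EuclideanSpace ℝ (Fin m)) v y)
  have hX : SmoothSectionAt X x := F.smoothSectionAt_complProj hK hgram (smoothSectionAt_extend v)
  have hN := F.smoothSectionAt_normal x
  have hXX := g.smoothFunAt_pair hX hX
  have hne : g.pair X X x ≠ 0 := by
    simpa [LorentzMetric.pair, X, F.complProj_of_isComplementary hv] using hvv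
  have hk := g.smoothFunAt_koszul hX hN hX
  refine (hk.div₀ hXX hne).congr_of_eventuallyEq ?_
  filter_upwards [hX.eventually_mdifferentiableAt, hN.eventually_mdifferentiableAt,
    hXX.continuousAt.eventually_ne hne] with y hXy hNy hney
  have hc : F.IsComplementary K y (X y) := F.isComplementary_complProj hgram ht y _
  have hχ := humbilic y _ _ hc hc
  rw [F.secondForm_of_tangent hc.1 hc.1, g.koszul_eq hXy hNy hXy] at hχ
  simp only [induced, hc.1, mul_zero, sub_zero] at hχ
  simp only [Pi.div_apply]
  rw [eq_div_iff hney, hχ, LorentzMetric.pair]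

theorem smoothFunAt_normalDeriv {f : M → ℝ} {x : M} (hf : SmoothFunAt (m := m) f x) :
    SmoothFunAt (m := m) (F.normalDeriv f) x :=
  hf.mvfderiv_apply (F.smoothSectionAt_normal x)

theorem sliceDeriv_mul {f h : M → ℝ} {x : M} (hf : SmoothFunAt (m := m) f x)
    (hh : SmoothFunAt (m := m) h x) (v : TangentSpace (𝓡 m) x) :
    F.sliceDeriv (fun y ↦ f y * h y) x v = f x * F.sliceDeriv h x v + h x * F.sliceDeriv f x v :=
  mvfderiv_mul_apply hf.mdifferentiableAt hh.mdifferentiableAt _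

/-- The foliation function has vanishing derivative along the slices. -/
theorem sliceDeriv_toFun (x : M) (v : TangentSpace (𝓡 m) x) :
    mvfderiv (𝓡 m) F.toFun x (F.proj x v) = 0 :=
  F.mvfderiv_toFun_eq_zero_iff.2 (F.val_normal_proj x v)

/-- Step one is the equation `dΨ̃ = A dΦ`. As `n(Φ) = ± ε / φ`, its coefficient `A` is `± 2ε` times
the function whose slice derivative vanishes by the first integrability condition. -/
theorem exists_stepOne (hn : n + 2 ≤ m) (hK : ∀ a, SmoothVectorFieldOn (K a) univ)
    (hgram : ∀ x, IsUnit (gram g K x).det) (ht : ∀ a x, g.val x (F.normal x) (K a x) = 0)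
    (humbilic : F.IsPartiallyUmbilic K) (hPsi : F.IntegrabilityPsi K) {U : Set M} (hU : IsOpen U)
    (hconn : ∀ s, IsPreconnected (U ∩ F.slice s)) : ∃ Ψt, F.StepOne K U Ψt := by
  have hB : ∀ x, SmoothFunAt (m := m) (fun y ↦ F.lapse y * F.weightedTrace K y
      - F.lapse y * F.normalDeriv (fun z ↦ Real.log (F.lapse z)) y) x := fun x ↦
    ((F.smoothFunAt_lapse x).mul (F.smoothFunAt_weightedTrace hn hK hgram ht humbilic x)).sub
      ((F.smoothFunAt_lapse x).mul (F.smoothFunAt_normalDeriv (F.smoothFunAt_log_lapse x)))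
  obtain ⟨f, hf, hfA⟩ := F.exists_primitive hU hconn (A := fun x ↦ (2 * F.orient * F.eps) *
      (F.lapse x * F.weightedTrace K x
        - F.lapse x * F.normalDeriv (fun z ↦ Real.log (F.lapse z)) x))
    (fun x _ ↦ (contMDiffAt_const.mul (hB x)).contMDiffWithinAt) fun x _ v ↦ by
      rw [F.sliceDeriv_mul contMDiffAt_const (hB x), hPsi x v, sliceDeriv, mvfderiv_const_apply]
      ring
  refine ⟨f, hf, fun x hx ↦ ⟨?_, fun v ↦ ?_⟩⟩
  · rw [normalDeriv, hfA x hx, F.mvfderiv_toFun_normal]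
    have h1 := F.orient_mul_orient
    have h2 := F.eps_mul_eps
    have h3 : F.lapse x * (F.lapse x)⁻¹ = 1 := mul_inv_cancel₀ (F.lapse_pos x).ne'
    linear_combination (2 * (F.weightedTrace K x
      - F.normalDeriv (fun z ↦ Real.log (F.lapse z)) x)) * (F.eps * F.eps *
        (F.lapse x * (F.lapse x)⁻¹) * h1 + F.lapse x * (F.lapse x)⁻¹ * h2 + h3)
  · rw [sliceDeriv, hfA x hx, F.sliceDeriv_toFun, mul_zero]

/-- The integrability conditions say that products of this form are constant along the slices. -/
theorem sliceDeriv_mul_eq_zero {P Q : M → ℝ} {x : M} (hP : SmoothFunAt (m := m) P x)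
    (hQ : SmoothFunAt (m := m) Q x) (hPx : P x ≠ 0) {v : TangentSpace (𝓡 m) x}
    (h : F.sliceDeriv Q x v = -F.sliceDeriv (fun y ↦ Real.log (P y)) x v * Q x) :
    F.sliceDeriv (fun y ↦ P y * Q y) x v = 0 := by
  have hlog : F.sliceDeriv (fun y ↦ Real.log (P y)) x v = (P x)⁻¹ * F.sliceDeriv P x v :=
    mvfderiv_real_comp (Real.hasDerivAt_log hPx) hP.mdifferentiableAt _
  rw [F.sliceDeriv_mul hP hQ, h, hlog]
  field_simp
  ring

theorem exp_psi (Ψt : M → ℝ) (x : M) :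
    Real.exp (F.psi Ψt x) = F.lapse x ^ 2 * Real.exp (Ψt x) := by
  rw [psi, Real.exp_add, Real.exp_log (pow_pos (F.lapse_pos x) 2)]

/-- The derivative of `γ^{ab}` with respect to the foliation function. -/
noncomputable def gammaRate (K : Fin n → VectorFieldOn m M) (Ψt : M → ℝ) (a b : Fin n) (x : M) :
    ℝ :=
  F.orient * Real.exp (Ψt x) * (F.lapse x ^ 3 *
    (2 * F.weightedTrace K x * gramInv g K a b x + F.normalDeriv (gramInv g K a b) x))

theorem gammaRate_comm (Ψt : M → ℝ) (a b : Fin n) (x : M) :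
    F.gammaRate K Ψt a b x = F.gammaRate K Ψt b a x := by
  simp only [gammaRate, show gramInv g K a b = gramInv g K b a from funext (gramInv_comm K a b)]

theorem smoothFunAt_gammaRate (hn : n + 2 ≤ m) (hK : ∀ a, SmoothVectorFieldOn (K a) univ)
    (hgram : ∀ x, IsUnit (gram g K x).det) (ht : ∀ a x, g.val x (F.normal x) (K a x) = 0)
    (humbilic : F.IsPartiallyUmbilic K) {Ψt : M → ℝ} {x : M} (hΨ : SmoothFunAt (m := m) Ψt x)
    (a b : Fin n) : SmoothFunAt (m := m) (F.gammaRate K Ψt a b) x := by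
  have hG := smoothFunAt_gramInv hK hgram a b x
  exact (contMDiffAt_const.mul (Real.contDiff_exp.contDiffAt.contMDiffAt.comp x hΨ)).mul
    (((F.smoothFunAt_lapse x).pow 3).mul
      (((contMDiffAt_const.mul (F.smoothFunAt_weightedTrace hn hK hgram ht humbilic x)).mul hG).add
        (F.smoothFunAt_normalDeriv hG)))

/-- A function `c e^Ψ̃ f` has vanishing slice derivative if `f` does. -/
theorem sliceDeriv_const_mul_exp_mul {Ψt f : M → ℝ} {x : M} {v : TangentSpace (𝓡 m) x} (c : ℝ)
    (hΨ : SmoothFunAt (m := m) Ψt x) (hf : SmoothFunAt (m := m) f x)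
    (hΨ0 : F.sliceDeriv Ψt x v = 0) (hf0 : F.sliceDeriv f x v = 0) :
    F.sliceDeriv (fun y ↦ c * Real.exp (Ψt y) * f y) x v = 0 := by
  have hE : SmoothFunAt (m := m) (fun y ↦ Real.exp (Ψt y)) x :=
    Real.contDiff_exp.contDiffAt.contMDiffAt.comp x hΨ
  have hE0 : F.sliceDeriv (fun y ↦ Real.exp (Ψt y)) x v = 0 := by
    refine (mvfderiv_real_comp (Real.hasDerivAt_exp _) hΨ.mdifferentiableAt _).trans ?_
    change _ * F.sliceDeriv Ψt x v = 0
    rw [hΨ0, mul_zero]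
  have hcE : SmoothFunAt (m := m) (fun y ↦ c * Real.exp (Ψt y)) x := contMDiffAt_const.mul hE
  rw [F.sliceDeriv_mul hcE hf, F.sliceDeriv_mul contMDiffAt_const hE, hE0,
    hf0, sliceDeriv, mvfderiv_const_apply]
  ring

theorem sliceDeriv_congr {f h : M → ℝ} {x : M} (hfh : f =ᶠ[𝓝 x] h) (v : TangentSpace (𝓡 m) x) :
    F.sliceDeriv f x v = F.sliceDeriv h x v := by
  rw [sliceDeriv, sliceDeriv, mvfderiv_congr hfh]

/-- Where `χ ≠ 0` the rate is a constant times `e^Ψ̃` times the product of `χ φ³` and `𝒢^{ab} +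
(2χ)⁻¹ n(𝒢^{ab})`. The integrability condition is the logarithmic form of the statement that this
product is constant along the slices. -/
theorem sliceDeriv_gammaRate_of_ne_zero (hn : n + 2 ≤ m)
    (hK : ∀ a, SmoothVectorFieldOn (K a) univ)
    (hgram : ∀ x, IsUnit (gram g K x).det) (ht : ∀ a x, g.val x (F.normal x) (K a x) = 0)
    (humbilic : F.IsPartiallyUmbilic K) (hGamma : F.IntegrabilityGamma K) {Ψt : M → ℝ} {x : M}
    (hΨ : SmoothFunAt (m := m) Ψt x) (hΨ0 : ∀ v, F.sliceDeriv Ψt x v = 0)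
    (hχ : F.weightedTrace K x ≠ 0) (a b : Fin n) (v : TangentSpace (𝓡 m) x) :
    F.sliceDeriv (F.gammaRate K Ψt a b) x v = 0 := by
  have hχs := F.smoothFunAt_weightedTrace hn hK hgram ht humbilic x
  have hG := smoothFunAt_gramInv hK hgram a b x
  have hP : SmoothFunAt (m := m) (fun y ↦ F.weightedTrace K y * F.lapse y ^ 3) x :=
    hχs.mul ((F.smoothFunAt_lapse x).pow 3)
  have h2χ : SmoothFunAt (m := m) (fun y ↦ 1 / (2 * F.weightedTrace K y)) x :=
    contMDiffAt_const.div₀ (contMDiffAt_const.mul hχs) (mul_ne_zero two_ne_zero hχ)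
  have hQ : SmoothFunAt (m := m) (fun y ↦ gramInv g K a b y
        + 1 / (2 * F.weightedTrace K y) * F.normalDeriv (gramInv g K a b) y) x :=
    hG.add (h2χ.mul (F.smoothFunAt_normalDeriv hG))
  have h0 := F.sliceDeriv_mul_eq_zero hP hQ
    (mul_ne_zero hχ (pow_ne_zero 3 (F.lapse_pos x).ne')) (hGamma.1 x hχ a b v)
  have hPQ : SmoothFunAt (m := m) (fun y ↦ F.weightedTrace K y * F.lapse y ^ 3 *
      (gramInv g K a b y + 1 / (2 * F.weightedTrace K y) * F.normalDeriv (gramInv g K a b) y)) x :=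
    hP.mul hQ
  rw [← F.sliceDeriv_const_mul_exp_mul (2 * F.orient) hΨ hPQ (hΨ0 v) h0]
  refine F.sliceDeriv_congr ?_ v
  filter_upwards [hχs.continuousAt.eventually_ne hχ] with y hy
  simp only [gammaRate]
  field_simp

theorem sliceDeriv_gammaRate_of_mem_interior (hK : ∀ a, SmoothVectorFieldOn (K a) univ)
    (hgram : ∀ x, IsUnit (gram g K x).det) (hGamma : F.IntegrabilityGamma K) {Ψt : M → ℝ} {x : M}
    (hΨ : SmoothFunAt (m := m) Ψt x) (hΨ0 : ∀ v, F.sliceDeriv Ψt x v = 0)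
    (hχ : x ∈ interior {y : M | F.weightedTrace K y = 0}) (a b : Fin n)
    (v : TangentSpace (𝓡 m) x) : F.sliceDeriv (F.gammaRate K Ψt a b) x v = 0 := by
  have hP : SmoothFunAt (m := m) (fun y ↦ F.lapse y ^ 3) x := (F.smoothFunAt_lapse x).pow 3
  have hQ := F.smoothFunAt_normalDeriv (smoothFunAt_gramInv hK hgram a b x)
  have h0 := F.sliceDeriv_mul_eq_zero hP hQ (pow_ne_zero 3 (F.lapse_pos x).ne')
    (hGamma.2 x hχ a b v)
  have hPQ : SmoothFunAt (m := m)
      (fun y ↦ F.lapse y ^ 3 * F.normalDeriv (gramInv g K a b) y) x := hP.mul hQ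
  rw [← F.sliceDeriv_const_mul_exp_mul F.orient hΨ hPQ (hΨ0 v) h0]
  refine F.sliceDeriv_congr ?_ v
  filter_upwards [mem_interior_iff_mem_nhds.1 hχ] with y hy
  simp only [gammaRate, show F.weightedTrace K y = 0 from hy]
  ring

/-- The two cases of the integrability condition leave out the boundary of `{χ = 0}`. There the
slice derivative is a limit of its values at points with `χ ≠ 0`, hence zero, since the rate itself
is smooth across that set. -/
theorem sliceDeriv_gammaRate (hn : n + 2 ≤ m) (hK : ∀ a, SmoothVectorFieldOn (K a) univ)
    (hgram : ∀ x, IsUnit (gram g K x).det) (ht : ∀ a x, g.val x (F.normal x) (K a x) = 0)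
    (humbilic : F.IsPartiallyUmbilic K) (hGamma : F.IntegrabilityGamma K) {U : Set M}
    (hU : IsOpen U) {Ψt : M → ℝ} (h₁ : F.StepOne K U Ψt) {x : M} (hx : x ∈ U) (a b : Fin n)
    (v : TangentSpace (𝓡 m) x) : F.sliceDeriv (F.gammaRate K Ψt a b) x v = 0 := by
  by_cases hcl : x ∈ closure {y : M | F.weightedTrace K y ≠ 0}
  · by_contra hne
    have hsm := (F.smoothFunAt_gammaRate hn hK hgram ht humbilic (h₁.smoothFunAt hU hx)
      a b).mvfderiv_apply (F.smoothSectionAt_proj (smoothSectionAt_extend v))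
    -- Along the projected extension of `v` the slice derivative is a continuous function. If it is
    -- nonzero at `x`, it is nonzero at some nearby point with `χ ≠ 0`.
    have hev := hsm.continuousAt.eventually_ne (y := 0) (by simpa [sliceDeriv] using hne)
    obtain ⟨y, hy, hyne, hyU⟩ :=
      ((mem_closure_iff_frequently.1 hcl).and_eventually (hev.and (hU.mem_nhds hx))).exists
    exact hyne (F.sliceDeriv_gammaRate_of_ne_zero hn hK hgram ht humbilic hGamma
      (h₁.smoothFunAt hU hyU) (h₁.2 y hyU).2 hy a b _)
  · refine F.sliceDeriv_gammaRate_of_mem_interior hK hgram hGamma (h₁.smoothFunAt hU hx)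
      (h₁.2 x hx).2 ?_ a b v
    rw [← mem_compl_iff, ← interior_compl] at hcl
    convert hcl using 2
    ext y
    simp

/-- Eliminating `ν` turns step two into `dγ = A dΦ` with `A` the `gammaRate`. Its factor `φ³`
consists of `φ²` from `e^Ψ = φ² e^Ψ̃` and of `φ` from `n(Φ) = ± ε / φ`. -/
theorem exists_stepTwo (hn : n + 2 ≤ m) (hK : ∀ a, SmoothVectorFieldOn (K a) univ)
    (hgram : ∀ x, IsUnit (gram g K x).det) (ht : ∀ a x, g.val x (F.normal x) (K a x) = 0)
    (humbilic : F.IsPartiallyUmbilic K) (hGamma : F.IntegrabilityGamma K) {U : Set M}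
    (hU : IsOpen U) (hconn : ∀ s, IsPreconnected (U ∩ F.slice s)) {Ψt : M → ℝ}
    (h₁ : F.StepOne K U Ψt) : ∃ γ ν, F.StepTwo K U Ψt γ ν := by
  have hex := fun a b ↦ F.exists_primitive hU hconn (A := F.gammaRate K Ψt a b)
    (fun x hx ↦ (F.smoothFunAt_gammaRate hn hK hgram ht humbilic
      (h₁.smoothFunAt hU hx) a b).contMDiffWithinAt)
    (fun x hx ↦ F.sliceDeriv_gammaRate hn hK hgram ht humbilic hGamma hU h₁ hx a b)
  choose f hf hfA using hex
  -- The primitives for `(a, b)` and `(b, a)` are chosen independently and need not agree. Their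
  -- mean is symmetric and has the same differential, as the rate is symmetric.
  let γ : Fin n → Fin n → M → ℝ := fun a b x ↦ (1 / 2) * (f a b x + f b a x)
  have hγ : ∀ a b, ContMDiffOn (𝓡 m) 𝓘(ℝ, ℝ) ∞ (γ a b) U := fun a b ↦
    contMDiffOn_const.mul ((hf a b).add (hf b a))
  have hγA : ∀ a b, ∀ x ∈ U, ∀ v, mvfderiv (𝓡 m) (γ a b) x v =
      F.gammaRate K Ψt a b x * mvfderiv (𝓡 m) F.toFun x v := by
    intro a b x hx v
    have hd : ∀ a b, SmoothFunAt (m := m) (f a b) x := fun a b ↦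
      (hf a b).contMDiffAt (hU.mem_nhds hx)
    have hd2 : SmoothFunAt (m := m) (fun y ↦ f a b y + f b a y) x := (hd a b).add (hd b a)
    rw [mvfderiv_mul_apply mdifferentiableAt_const hd2.mdifferentiableAt,
      mvfderiv_add_apply (hd a b).mdifferentiableAt (hd b a).mdifferentiableAt,
      mvfderiv_const_apply, hfA a b x hx, hfA b a x hx, F.gammaRate_comm Ψt b a]
    ring
  have hεE : ∀ x ∈ U, SmoothFunAt (m := m) (fun y ↦ F.eps * Real.exp (F.psi Ψt y)) x :=
    fun x hx ↦ contMDiffAt_const.mul (F.smoothFunAt_exp_psi (h₁.smoothFunAt hU hx))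
  have hεEG : ∀ a b, ∀ x ∈ U,
      SmoothFunAt (m := m) (fun y ↦ F.eps * Real.exp (F.psi Ψt y) * gramInv g K a b y) x :=
    fun a b x hx ↦ (hεE x hx).mul (smoothFunAt_gramInv hK hgram a b x)
  refine ⟨γ, fun a b x ↦ γ a b x - F.eps * Real.exp (F.psi Ψt x) * gramInv g K a b x, hγ,
    fun a b ↦ (hγ a b).sub fun x hx ↦ (hεEG a b x hx).contMDiffWithinAt,
    fun x hx a b ↦ ⟨?_, by ring, ?_, fun v ↦ ?_⟩⟩
  · simp only [γ, add_comm]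
  · have hγx : SmoothFunAt (m := m) (γ a b) x := (hγ a b).contMDiffAt (hU.mem_nhds hx)
    rw [normalDeriv, mvfderiv_sub_apply hγx.mdifferentiableAt (hεEG a b x hx).mdifferentiableAt,
      mvfderiv_mul_apply (hεE x hx).mdifferentiableAt
        (smoothFunAt_gramInv hK hgram a b x).mdifferentiableAt,
      mvfderiv_mul_apply mdifferentiableAt_const
        (F.smoothFunAt_exp_psi (h₁.smoothFunAt hU hx)).mdifferentiableAt, mvfderiv_const_apply,
      F.mvfderiv_exp_psi hU h₁ hx, F.val_normal_normal, sliceDeriv,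
      show F.proj x (F.normal x) = 0 by
        simp [proj, F.val_normal_normal, F.eps_mul_eps], map_zero, hγA a b x hx,
      F.mvfderiv_toFun_normal, F.exp_psi, gammaRate, normalDeriv]
    have h1 := F.orient_mul_orient
    have h2 := F.eps_mul_eps
    have h3 : F.lapse x * (F.lapse x)⁻¹ = 1 := mul_inv_cancel₀ (F.lapse_pos x).ne'
    set H := 2 * F.weightedTrace K x * gramInv g K a b x
      + mvfderiv (𝓡 m) (gramInv g K a b) x (F.normal x) with hH
    -- With `ν` defined as the difference, what remains is that `± A ε / φ` equals the normal
    -- derivative `ε e^Ψ (2χ 𝒢^{ab} + n(𝒢^{ab}))` of `ε e^Ψ 𝒢^{ab}`.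
    linear_combination (F.eps * F.lapse x ^ 2 * Real.exp (Ψt x) * H) *
      (F.lapse x * (F.lapse x)⁻¹ * h1 + h3)
      - 2 * F.eps * F.lapse x ^ 2 * Real.exp (Ψt x) * F.weightedTrace K x * gramInv g K a b x * h2
  · rw [sliceDeriv, hγA a b x hx, F.sliceDeriv_toFun, mul_zero]

theorem stepsSolvableOn (hn : n + 2 ≤ m) (hK : ∀ a, SmoothVectorFieldOn (K a) univ)
    (hgram : ∀ x, IsUnit (gram g K x).det) (ht : ∀ a x, g.val x (F.normal x) (K a x) = 0)
    (humbilic : F.IsPartiallyUmbilic K) (hPsi : F.IntegrabilityPsi K)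
    (hGamma : F.IntegrabilityGamma K) {U : Set M}
    (hU : IsOpen U) (hconn : ∀ s, IsPreconnected (U ∩ F.slice s)) : F.StepsSolvableOn K U :=
  ⟨F.exists_stepOne hn hK hgram ht humbilic hPsi hU hconn,
    fun _ h₁ ↦ F.exists_stepTwo hn hK hgram ht humbilic hGamma hU hconn h₁⟩

end SliceFoliation

end StepsSolvable

/-! ### Slice-reducibility, the components of `Ω`, and the theorem -/

section MainResults

variable {m : ℕ} {M : Type*} [TopologicalSpace M]
  [ChartedSpace (EuclideanSpace ℝ (Fin m)) M] [IsManifold (𝓡 m) ∞ M]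
  {g : LorentzMetric m M}

namespace SliceFoliation

variable (F : SliceFoliation g) {n : ℕ} {K : Fin n → VectorFieldOn m M}

theorem val_proj_proj (x : M) (u v : TangentSpace (𝓡 m) x) :
    g.val x (F.proj x u) (F.proj x v) = F.induced x u v := by
  have h : g.val x (F.proj x u) (F.normal x) = 0 := by
    rw [g.symm]; exact F.val_normal_proj x u
  conv_lhs => arg 2; rw [proj]
  rw [map_sub, map_smul, h, smul_zero, sub_zero, proj, induced]
  simp only [map_sub, map_smul, _root_.sub_apply, _root_.smul_apply, smul_eq_mul]
  ring

/-- A tangent conformal Killing vector of `M` is a conformal Killing vector of the slices. -/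
theorem sliceConformalKillingAt {X : VectorFieldOn m M} (hX : g.IsConformalKilling X) {x : M}
    (ht : g.val x (F.normal x) (X x) = 0) : F.SliceConformalKillingAt X x :=
  ⟨ht, g.conformalFactor X x, fun u v ↦ by rw [hX.val_add_val, F.val_proj_proj]⟩

/-- On the component of the slice through `p`, `γ` keeps its value at `p`, which serves as the
matrix of constants, with `β = α`. The term `e^Ψ n n` disappears under the tangent projection. -/
theorem isSliceReducibleOn_liftTensor (hK : ∀ a, g.IsConformalKilling (K a))
    (ht : ∀ a x, g.val x (F.normal x) (K a x) = 0) {U : Set M} (hU : IsOpen U)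
    {α Ψt : M → ℝ} {γ ν : Fin n → Fin n → M → ℝ} (h₂ : F.StepTwo K U Ψt γ ν)
    (hα : ContMDiffOn (𝓡 m) 𝓘(ℝ, ℝ) ∞ α U) :
    F.IsSliceReducibleOn U (F.liftTensor K α Ψt γ) := by
  intro p hp
  refine ⟨n, K, fun a b ↦ γ a b p, α, fun a ↦ (hK a).1.mono (subset_univ U), hα,
    fun a b ↦ (h₂.2.2 p hp a b).1, fun x hx ↦
      ⟨fun a ↦ F.sliceConformalKillingAt (hK a) (ht a x), fun u v ↦ ?_⟩⟩
  have hγ : ∀ a b, γ a b x = γ a b p := fun a b ↦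
    F.eq_of_isPreconnected hU (h₂.1 a b) (fun y hy ↦ (h₂.2.2 y hy a b).2.2.2)
      isPreconnected_connectedComponentIn (connectedComponentIn_subset _ _) hx
      (mem_connectedComponentIn ⟨hp, rfl⟩)
  rw [F.liftTensor_apply, F.val_proj_proj, F.val_normal_proj, F.val_normal_proj]
  simp only [hγ, mul_zero, add_zero]

theorem isConformalKillingTensorOn_liftTensor (hK : ∀ a, g.IsConformalKilling (K a))
    (hgram : ∀ x, IsUnit (gram g K x).det) (ht : ∀ a x, g.val x (F.normal x) (K a x) = 0)
    (hblock : F.IsBlockDiagonal K) (humbilic : F.IsPartiallyUmbilic K) {U : Set M}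
    (hU : IsOpen U) {α Ψt : M → ℝ} {γ ν : Fin n → Fin n → M → ℝ} (h₁ : F.StepOne K U Ψt)
    (h₂ : F.StepTwo K U Ψt γ ν) (hα : ContMDiffOn (𝓡 m) 𝓘(ℝ, ℝ) ∞ α U) :
    g.IsConformalKillingTensorOn U (F.liftTensor K α Ψt γ) := by
  refine ⟨F.smoothTwoTensorOn_liftTensor (fun a ↦ (hK a).1) hα h₁.1 h₂.1,
    fun x hx ↦ ⟨F.liftTensor_comm h₂ hx, fun u v w ↦ ?_⟩⟩
  have hαx : SmoothFunAt (m := m) α x := hα.contMDiffAt (hU.mem_nhds hx)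
  rw [F.permSum_covTensor_liftTensor hK hgram ht hblock humbilic hU h₁ h₂ hx hαx]
  simp only [permSum, F.conformalOneForm_liftTensor hK hgram ht hblock humbilic hU h₁ h₂ hx hαx]

theorem liftOneForm_normal (ht : ∀ a x, g.val x (F.normal x) (K a x) = 0) (α Ψt : M → ℝ)
    (γ : Fin n → Fin n → M → ℝ) (x : M) : F.liftOneForm K α Ψt γ x (F.normal x) =
      F.normalDeriv α x + 2 * F.eps * F.weightedTrace K x * Real.exp (F.psi Ψt x) := by
  rw [F.liftOneForm_apply, F.val_normal_normal, normalDeriv]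
  simp only [g.symm x (K _ x) (F.normal x), ht, mul_zero, zero_mul, Finset.sum_const_zero]
  ring

theorem liftOneForm_proj (ht : ∀ a x, g.val x (F.normal x) (K a x) = 0) (α Ψt : M → ℝ)
    (γ : Fin n → Fin n → M → ℝ) (x : M) (v : TangentSpace (𝓡 m) x) :
    F.liftOneForm K α Ψt γ x (F.proj x v) = F.sliceDeriv α x v
      + 2 * ∑ a, ∑ b, γ a b x * g.val x (K a x) v *
          F.sliceDeriv (fun z ↦ Real.log (F.lapse z)) x (K b x) := by
  have h : ∀ a, g.val x (K a x) (F.proj x v) = g.val x (K a x) v := fun a ↦ by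
    simp [proj, g.symm x (K a x) (F.normal x), ht]
  rw [F.liftOneForm_apply, F.val_normal_proj, mul_zero, add_zero]
  simp only [h]
  rfl

end SliceFoliation

end MainResults

theorem mainTheorem1 {m : ℕ} {M : Type*} [TopologicalSpace M]
    [ChartedSpace (EuclideanSpace ℝ (Fin m)) M] [IsManifold (𝓡 m) ∞ M]
    (g : LorentzMetric m M) (F : SliceFoliation g)
    {n : ℕ} (hn : n + 2 ≤ m) (K : Fin n → VectorFieldOn m M)
    (hK : ∀ a, g.IsConformalKilling (K a))
    (hgram : ∀ x, IsUnit (gram g K x).det)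
    (htangent : ∀ a x, g.val x (F.normal x) (K a x) = 0)
    (hblock : F.IsBlockDiagonal K)
    (humbilic : F.IsPartiallyUmbilic K)
    (hPsi : F.IntegrabilityPsi K)
    (hGamma : F.IntegrabilityGamma K) :
    -- Steps one and two can be carried out near every point,
    (∀ p : M, ∃ U : Set M, IsOpen U ∧ p ∈ U ∧ F.StepsSolvableOn K U) ∧
    -- and on every open set (for example on `M`) in which the slices are connected.
    (∀ U : Set M, IsOpen U → (∀ s : ℝ, IsPreconnected (U ∩ F.slice s)) →
      F.StepsSolvableOn K U) ∧
    -- Step three then always gives a slice-reducible conformal Killing tensor.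
    (∀ U : Set M, IsOpen U → ∀ (Ψt : M → ℝ) (γ ν : Fin n → Fin n → M → ℝ) (α : M → ℝ),
      F.StepOne K U Ψt → F.StepTwo K U Ψt γ ν → ContMDiffOn (𝓡 m) 𝓘(ℝ, ℝ) ∞ α U →
      g.IsConformalKillingTensorOn U (F.liftTensor K α Ψt γ) ∧
      F.IsSliceReducibleOn U (F.liftTensor K α Ψt γ) ∧
      ∀ x ∈ U,
        g.conformalOneForm (F.liftTensor K α Ψt γ) x (F.normal x) =
          F.normalDeriv α x + 2 * F.eps * F.weightedTrace K x * Real.exp (F.psi Ψt x) ∧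
        ∀ v : TangentSpace (𝓡 m) x,
          g.conformalOneForm (F.liftTensor K α Ψt γ) x (F.proj x v) =
            F.sliceDeriv α x v
              + 2 * ∑ a, ∑ b, γ a b x * g.val x (K a x) v *
                  F.sliceDeriv (fun z ↦ Real.log (F.lapse z)) x (K b x)) := by
  have hKs : ∀ a, SmoothVectorFieldOn (K a) univ := fun a ↦ (hK a).1
  refine ⟨fun p ↦ ?_, fun U hU hconn ↦
    F.stepsSolvableOn hn hKs hgram htangent humbilic hPsi hGamma hU hconn,
    fun U hU Ψt γ ν α h₁ h₂ hα ↦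
      ⟨F.isConformalKillingTensorOn_liftTensor hK hgram htangent hblock humbilic hU h₁ h₂ hα,
        F.isSliceReducibleOn_liftTensor hK htangent hU h₂ hα, fun x hx ↦ ?_⟩⟩
  -- The slices of a flow box are connected, so the local claim is a case of the claim for open sets
  -- with connected slices.
  · obtain ⟨B, hBp, -⟩ := F.exists_flowBox isOpen_univ (mem_univ p)
    exact ⟨B.region, B.isOpen_image, ⟨_, B.center_mem, hBp⟩,
      F.stepsSolvableOn hn hKs hgram htangent humbilic hPsi hGamma B.isOpen_image
        (F.isPreconnected_region_inter_slice B)⟩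
  · have hαx : SmoothFunAt (m := m) α x := hα.contMDiffAt (hU.mem_nhds hx)
    have hΩ := F.conformalOneForm_liftTensor hK hgram htangent hblock humbilic hU h₁ h₂ hx hαx
    exact ⟨by rw [hΩ, F.liftOneForm_normal htangent], fun v ↦ by
      rw [hΩ, F.liftOneForm_proj htangent]⟩
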